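/- Let $a<b$ be real numbers and $I=(a,b)$, and let $N\subset\mathbb R^m$ be a compact connected smooth embedded submanifold without boundary. Let $s>0$ and $1\le p<\infty$. Write $s=k+\sigma$ with $k\in\{0,1,2,\dots\}$ and $0\le\sigma<1$. Let $W^{s,p}(I;\mathbb R^m)$ be the space of functions $u$ whose weak derivatives $u^{(0)}=u,u',\dots,u^{(k)}$ exist and for which the norm $$\|u\|_{W^{s,p}(I)}=\sum_{j=0}^{k}\|u^{(j)}\|_{L^p(I)}+\Big(\int_I\int_I\frac{|u^{(k)}(x)-u^{(k)}(y)|^p}{|x-y|^{1+\sigma p}}\,dx\,dy\Big)^{1/p}$$ is finite, where the double-integral term is omitted when $\sigma=0$, and set $W^{s,p}(I;N)=\{u\in W^{s,p}(I;\mathbb R^m): u(x)\in N\text{ for a.e. }x\in I\}$. Let $C^\infty(\overline I;N)$ be the set of maps $[a,b]\to\mathbb R^m$ that are smooth up to the end points and take values in $N$. Then $C^\infty(\overline I;N)\subset W^{s,p}(I;N)$, and $C^\infty(\overline I;N)$ is dense in $W^{s,p}(I;N)$: for every $u\in W^{s,p}(I;N)$ and every $\varepsilon>0$ there is $v\in C^\infty(\overline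 I;N)$ with $\|u-v\|_{W^{s,p}(I)}<\varepsilon$. -/

import Mathlib

open MeasureTheory Set
open scoped ContDiff ENNReal

namespace IntervalSobolev

noncomputable section

/-- `N` is a smooth `d`-dimensional submanifold (without boundary) of `ℝᵐ`: around each of its
points some smooth diffeomorphism between open subsets of `ℝᵐ` carries `N` onto the slice where
all the coordinates after the first `d` vanish. -/
def IsSmoothSubmanifold {m : ℕ} (d : ℕ) (N : Set (EuclideanSpace ℝ (Fin m))) : Prop :=
  d ≤ m ∧ ∀ x ∈ N,
    ∃ Φ : OpenPartialHomeomorph (EuclideanSpace ℝ (Fin m)) (EuclideanSpace ℝ (Fin m)),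
      x ∈ Φ.source ∧
      ContDiffOn ℝ ∞ Φ Φ.source ∧
      ContDiffOn ℝ ∞ Φ.symm Φ.target ∧
      ∀ y ∈ Φ.source, y ∈ N ↔ ∀ i : Fin m, d ≤ (i : ℕ) → Φ y i = 0

variable {E : Type*} [NormedAddCommGroup E]

/-- `g` is a weak derivative of order `j` of `u` on the open interval `(a, b)`. -/
structure IsWeakDeriv [NormedSpace ℝ E] (a b : ℝ) (j : ℕ) (u g : ℝ → E) : Prop where
  locallyIntegrable_fun : LocallyIntegrableOn u (Ioo a b)
  locallyIntegrable_deriv : LocallyIntegrableOn g (Ioo a b)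
  integral_eq : ∀ φ : ℝ → ℝ, ContDiff ℝ ∞ φ → HasCompactSupport φ → tsupport φ ⊆ Ioo a b →
    ∫ x in Ioo a b, iteratedDeriv j φ x • u x = (-1 : ℝ) ^ j • ∫ x in Ioo a b, φ x • g x

/-- The Gagliardo seminorm of order `σ` and exponent `p` on `(a, b)`, with values in `[0, ∞]`. -/
def gagliardo (a b σ p : ℝ) (g : ℝ → E) : ℝ≥0∞ :=
  (∫⁻ x in Ioo a b, ∫⁻ y in Ioo a b,
    ‖g x - g y‖ₑ ^ p / ENNReal.ofReal (|x - y| ^ (1 + σ * p))) ^ (1 / p)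

/-- The `W^{s,p}(a, b)` norm of a function whose weak derivatives of orders `0, …, ⌊s⌋` are
`D 0, …, D ⌊s⌋`: the sum of their `Lᵖ` norms and, when `s` is not an integer, of the Gagliardo
seminorm of order `s - ⌊s⌋` of `D ⌊s⌋`. -/
def sobolevNormOf (a b s p : ℝ) (D : ℕ → ℝ → E) : ℝ≥0∞ :=
  (∑ j ∈ Finset.range (⌊s⌋₊ + 1),
      eLpNorm (D j) (ENNReal.ofReal p) (volume.restrict (Ioo a b))) +
    (if s = (⌊s⌋₊ : ℝ) then 0 else gagliardo a b (s - ⌊s⌋₊) p (D ⌊s⌋₊))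

/-- The `W^{s,p}(a, b)` norm, with value `∞` for functions that do not have the required weak
derivatives. Weak derivatives are unique up to null sets, so the infimum is over equal numbers
(see `sobolevNorm_eq`). -/
def sobolevNorm [NormedSpace ℝ E] (a b s p : ℝ) (u : ℝ → E) : ℝ≥0∞ :=
  ⨅ (D : ℕ → ℝ → E) (_ : ∀ j ≤ ⌊s⌋₊, IsWeakDeriv a b j u (D j)), sobolevNormOf a b s p D

/-- `u` represents an element of `W^{s,p}((a, b); E)`. -/
def MemSobolev [NormedSpace ℝ E] (a b s p : ℝ) (u : ℝ → E) : Prop :=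
  ∃ D : ℕ → ℝ → E, (∀ j ≤ ⌊s⌋₊, IsWeakDeriv a b j u (D j)) ∧ sobolevNormOf a b s p D < ⊤

/-- `W^{s,p}((a, b); N)`: the `W^{s,p}` functions with values in `N` almost everywhere. -/
def sobolevMaps [NormedSpace ℝ E] (a b s p : ℝ) (N : Set E) : Set (ℝ → E) :=
  {u | MemSobolev a b s p u ∧ ∀ᵐ x ∂(volume.restrict (Ioo a b)), u x ∈ N}

/-- `C^∞([a, b]; N)`: maps smooth on `[a, b]`, up to the end points, with values in `N` there. -/
def smoothMaps [NormedSpace ℝ E] (a b : ℝ) (N : Set E) : Set (ℝ → E) :=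
  {v | ContDiffOn ℝ ∞ v (Icc a b) ∧ ∀ x ∈ Icc a b, v x ∈ N}

theorem IsWeakDeriv.ae_eq [NormedSpace ℝ E] [CompleteSpace E] {a b : ℝ} {j : ℕ} {u g h : ℝ → E}
    (hg : IsWeakDeriv a b j u g) (hh : IsWeakDeriv a b j u h) :
    g =ᵐ[volume.restrict (Ioo a b)] h := by
  have key := isOpen_Ioo.ae_eq_zero_of_integral_contDiff_smul_eq_zero (μ := volume)
    (f := g - h) (U := Ioo a b)
    (hg.locallyIntegrable_deriv.sub hh.locallyIntegrable_deriv) ?_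
  · rw [Filter.EventuallyEq, ae_restrict_iff' measurableSet_Ioo]
    filter_upwards [key] with x hx hxI
    exact sub_eq_zero.1 (hx hxI)
  · intro φ hφ hc hs
    have hint : ∀ f : ℝ → E, LocallyIntegrableOn f (Ioo a b) →
        IntegrableOn (fun x => φ x • f x) (Ioo a b) := by
      intro f hf
      have h1 : IntegrableOn f (tsupport φ) := hf.integrableOn_compact_subset hs hc
      have h2 : IntegrableOn (fun x => φ x • f x) (tsupport φ) :=
        h1.continuousOn_smul hφ.continuous.continuousOn hc
      refine (integrableOn_iff_integrable_of_support_subset ?_).1 h2 |>.integrableOn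
      intro x hx
      apply subset_tsupport
      intro h0
      exact hx (by simp [h0])
    have hz : ∀ x, x ∉ Ioo a b → φ x • (g - h) x = 0 := by
      intro x hx
      have : φ x = 0 := by
        by_contra h0
        exact hx (hs (subset_tsupport _ h0))
      simp [this]
    rw [← setIntegral_eq_integral_of_forall_compl_eq_zero hz]
    simp only [Pi.sub_apply, smul_sub]
    rw [integral_sub (hint g hg.locallyIntegrable_deriv) (hint h hh.locallyIntegrable_deriv),
      sub_eq_zero]
    have e := (hg.integral_eq φ hφ hc hs).symm.trans (hh.integral_eq φ hφ hc hs)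
    exact smul_right_injective E (pow_ne_zero j (by norm_num : (-1 : ℝ) ≠ 0)) e

theorem sobolevNormOf_congr {a b s p : ℝ} {D D' : ℕ → ℝ → E}
    (h : ∀ j ≤ ⌊s⌋₊, D j =ᵐ[volume.restrict (Ioo a b)] D' j) :
    sobolevNormOf a b s p D = sobolevNormOf a b s p D' := by
  unfold sobolevNormOf
  congr 1
  · refine Finset.sum_congr rfl fun j hj => eLpNorm_congr_ae (h j ?_)
    exact Nat.lt_succ_iff.1 (Finset.mem_range.1 hj)
  · split_ifs
    · rfl
    · unfold gagliardo
      congr 1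
      refine lintegral_congr_ae ?_
      filter_upwards [h _ le_rfl] with x hx
      refine lintegral_congr_ae ?_
      filter_upwards [h _ le_rfl] with y hy
      rw [hx, hy]

/-- The norm may be computed with any choice of the weak derivatives. -/
theorem sobolevNorm_eq [NormedSpace ℝ E] [CompleteSpace E] {a b s p : ℝ} {u : ℝ → E} {D : ℕ → ℝ → E}
    (hD : ∀ j ≤ ⌊s⌋₊, IsWeakDeriv a b j u (D j)) :
    sobolevNorm a b s p u = sobolevNormOf a b s p D := by
  refine le_antisymm (iInf₂_le D hD) (le_iInf₂ fun D' hD' => ?_)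
  exact (sobolevNormOf_congr fun j hj => (hD j hj).ae_eq (hD' j hj)).le

end

end IntervalSobolev

/-!
Near `N` there is a smooth retraction `π` onto `N`, obtained by patching retractions read off the
charts. How smooth maps into `N` are produced depends on `s`.

For `s < 1` the map `u` may be discontinuous, and `π` cannot be composed with a mollification of
`u`. Instead, sample `u` on a fine grid, at nodes where its local oscillation is at most average,
and join consecutive samples inside `N` by smooth paths. The Lipschitz constants of these paths can
be taken proportional to the distances of their end points because `N` is compact and connected, and
the Gagliardo seminorm of the error is then controlled by the part of that of `u` near the diagonal.

For `s ≥ 1` the map `u` is an iterated primitive of its top derivative `f`. Approximate `f` by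
smooth functions `F n`; the corresponding primitives `w n` converge uniformly, so that `π ∘ w n`
eventually takes its values in `N`. The derivatives of `π ∘ w n` are affine in `F n`, with
coefficients depending on the lower derivatives, which gives convergence of the `Lᵖ` norms. In the
Gagliardo seminorm the increments of `f` pass to the limit directly, while those of the
coefficients, multiplied by `f`, are dominated by an interpolation inequality bounding `f` in terms
of its bounded primitive and the inner integral of its Gagliardo seminorm.
-/

namespace IntervalSobolev

open Filter Topology
open scoped NNReal

section Retracts

open Manifold

variable {V : Type*} [NormedAddCommGroup V] [NormedSpace ℝ V] {N W : Set V} {r : V → V}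

/-- `r` is a smooth retraction of the open set `W` into `N`, fixing `N ∩ W`. -/
structure IsRetractionOn (N W : Set V) (r : V → V) : Prop where
  isOpen : IsOpen W
  contDiffOn : ContDiffOn ℝ ∞ r W
  mapsTo : MapsTo r W N
  eq_self : ∀ x ∈ N, x ∈ W → r x = x

/-- `N` is a smooth neighbourhood retract: some open set around `N` retracts smoothly onto it. -/
def IsSmoothNhdRetract (N : Set V) : Prop :=
  ∃ W r, IsRetractionOn N W r ∧ N ⊆ W

/-- `Φ` is a smooth chart of the ambient space that straightens `N` to the range of the linear
projection `P`. -/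
structure IsSliceChart (N : Set V) (Φ : OpenPartialHomeomorph V V) (P : V →L[ℝ] V) : Prop where
  contDiffOn : ContDiffOn ℝ ∞ Φ Φ.source
  contDiffOn_symm : ContDiffOn ℝ ∞ Φ.symm Φ.target
  proj_proj : ∀ x, P (P x) = P x
  mem_iff : ∀ y ∈ Φ.source, y ∈ N ↔ P (Φ y) = Φ y

theorem IsRetractionOn.mono {W' : Set V} (h : IsRetractionOn N W r) (hW' : IsOpen W')
    (hsub : W' ⊆ W) : IsRetractionOn N W' r where
  isOpen := hW'
  contDiffOn := h.contDiffOn.mono hsub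
  mapsTo := h.mapsTo.mono_left hsub
  eq_self x hx hxW := h.eq_self x hx (hsub hxW)

theorem IsRetractionOn.congr {r' : V → V} (h : IsRetractionOn N W r) (heq : EqOn r r' W) :
    IsRetractionOn N W r' where
  isOpen := h.isOpen
  contDiffOn := h.contDiffOn.congr heq.symm
  mapsTo := h.mapsTo.congr heq
  eq_self x hx hxW := (heq hxW).symm.trans (h.eq_self x hx hxW)

theorem IsRetractionOn.union {W' : Set V} (h : IsRetractionOn N W r)
    (h' : IsRetractionOn N W' r) : IsRetractionOn N (W ∪ W') r where
  isOpen := h.isOpen.union h'.isOpen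
  contDiffOn := h.contDiffOn.union_of_isOpen h'.contDiffOn h.isOpen h'.isOpen
  mapsTo := h.mapsTo.union h'.mapsTo
  eq_self x hx hxW := hxW.elim (h.eq_self x hx) (h'.eq_self x hx)

/-- In the chart `Φ`, interpolate between `r` and the linear projection `P` by means of `χ`. -/
theorem IsRetractionOn.exists_chart_extension (hr : IsRetractionOn N W r) {χ : V → ℝ}
    (hχ : ContDiff ℝ ∞ χ) (hχW : tsupport χ ⊆ W) {Φ : OpenPartialHomeomorph V V} {P : V →L[ℝ] V}
    (hΦ : IsSliceChart N Φ P) :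
    ∃ W' r', IsRetractionOn N W' r' ∧ N ∩ Φ.source ⊆ W' ∧ ∀ x ∈ W', χ x = 1 → r' x = r x := by
  set g : V → V := fun x => P (Φ x) + χ x • (Φ (r x) - P (Φ x)) with hg
  set A₁ : Set V := Φ.source ∩ (tsupport χ)ᶜ
  set A₂ : Set V := Φ.source ∩ (W ∩ r ⁻¹' Φ.source)
  have hA₁ : IsOpen A₁ := Φ.open_source.inter (isClosed_tsupport χ).isOpen_compl
  have hA₂ : IsOpen A₂ := Φ.open_source.inter
    (hr.contDiffOn.continuousOn.isOpen_inter_preimage hr.isOpen Φ.open_source)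
  have hg₁ : ∀ x ∈ A₁, g x = P (Φ x) := fun x hx => by
    simp [hg, image_eq_zero_of_notMem_tsupport hx.2]
  have hPΦ : ContDiffOn ℝ ∞ (fun x => P (Φ x)) Φ.source := P.contDiff.comp_contDiffOn hΦ.contDiffOn
  have hg_smooth : ContDiffOn ℝ ∞ g (A₁ ∪ A₂) := by
    refine ((hPΦ.mono inter_subset_left).congr hg₁).union_of_isOpen ?_ hA₁ hA₂
    have hΦr : ContDiffOn ℝ ∞ (fun x => Φ (r x)) A₂ :=
      hΦ.contDiffOn.comp (hr.contDiffOn.mono fun x hx => hx.2.1) fun x hx => hx.2.2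
    have hPΦ₂ := hPΦ.mono (inter_subset_left : A₂ ⊆ Φ.source)
    exact hPΦ₂.add (hχ.contDiffOn.smul (hΦr.sub hPΦ₂))
  have hPg : ∀ x ∈ A₁ ∪ A₂, P (g x) = g x := by
    rintro x (hx | hx)
    · rw [hg₁ x hx, hΦ.proj_proj]
    · have : P (Φ (r x)) = Φ (r x) := (hΦ.mem_iff _ hx.2.2).1 (hr.mapsTo hx.2.1)
      simp only [hg, map_add, map_smul, map_sub, hΦ.proj_proj, this]
  have hgN : ∀ x ∈ N, x ∈ A₁ ∪ A₂ → g x = Φ x := by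
    rintro x hxN (hx | hx)
    · rw [hg₁ x hx, (hΦ.mem_iff x hx.1).1 hxN]
    · simp [hg, hr.eq_self x hxN hx.2.1, (hΦ.mem_iff x hx.1).1 hxN]
  refine ⟨(A₁ ∪ A₂) ∩ g ⁻¹' Φ.target, Φ.symm ∘ g, ⟨?_, ?_, fun x hx => ?_, fun x hxN hx => ?_⟩,
    fun x hx => ?_, fun x hx hχx => ?_⟩
  · exact hg_smooth.continuousOn.isOpen_inter_preimage (hA₁.union hA₂) Φ.open_target
  · exact hΦ.contDiffOn_symm.comp (hg_smooth.mono inter_subset_left) fun x hx => hx.2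
  · rw [Function.comp_apply, hΦ.mem_iff _ (Φ.map_target hx.2), Φ.right_inv hx.2, hPg x hx.1]
  · rw [Function.comp_apply, hgN x hxN hx.1, Φ.left_inv (hx.1.elim And.left And.left)]
  · have hxA : x ∈ A₁ ∪ A₂ := by
      refine or_iff_not_imp_left.2 fun hx₁ => ⟨hx.2, ?_⟩
      have hxW : x ∈ W := hχW (not_not.1 fun h => hx₁ ⟨hx.2, h⟩)
      exact ⟨hxW, by rw [mem_preimage, hr.eq_self x hx.1 hxW]; exact hx.2⟩
    exact ⟨hxA, by rw [mem_preimage, hgN x hx.1 hxA]; exact Φ.map_source hx.2⟩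
  · have hx₂ : x ∈ A₂ := hx.1.resolve_left fun h => one_ne_zero (α := ℝ) <|
      hχx ▸ image_eq_zero_of_notMem_tsupport h.2
    simp [hg, hχx, Φ.left_inv hx₂.2.2]

variable [FiniteDimensional ℝ V]

theorem exists_contDiff_eventually_eq_one {K : Set V} (hK : IsClosed K) (hW : IsOpen W)
    (hKW : K ⊆ W) :
    ∃ χ : V → ℝ, ContDiff ℝ ∞ χ ∧ tsupport χ ⊆ W ∧ ∀ᶠ x in 𝓝ˢ K, χ x = 1 := by
  obtain ⟨χ, hχ0, hχ1, -⟩ := exists_contMDiffMap_zero_one_nhds_of_isClosed 𝓘(ℝ, V) (n := ⊤)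
    hW.isClosed_compl hK (disjoint_compl_left_iff_subset.2 hKW)
  refine ⟨χ, χ.contMDiff.contDiff, fun x hx => ?_, hχ1⟩
  by_contra hxW
  exact notMem_tsupport_iff_eventuallyEq.2 (hχ0.filter_mono (nhds_le_nhdsSet hxW)) hx

theorem IsRetractionOn.exists_union (hr : IsRetractionOn N W r) {K : Set V} (hK : IsClosed K)
    (hKW : K ⊆ W) {Φ : OpenPartialHomeomorph V V} {P : V →L[ℝ] V} (hΦ : IsSliceChart N Φ P) :
    ∃ W' r', IsRetractionOn N W' r' ∧ K ∪ (N ∩ Φ.source) ⊆ W' := by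
  classical
  obtain ⟨χ, hχ, hχW, hχ1⟩ := exists_contDiff_eventually_eq_one hK hr.isOpen hKW
  obtain ⟨W₁, hW₁, hKW₁, hχ1 : ∀ x ∈ W₁, χ x = 1⟩ := mem_nhdsSet_iff_exists.1 hχ1
  obtain ⟨W₂, r₂, hr₂, hNW₂, heq⟩ := hr.exists_chart_extension hχ hχW hΦ
  have hW₁W : W₁ ⊆ W := fun x hx => hχW (subset_tsupport _ (by simp [hχ1 x hx]))
  have hr₁ : IsRetractionOn N W₁ (W₁.piecewise r r₂) :=
    (hr.mono hW₁ hW₁W).congr (piecewise_eqOn W₁ r r₂).symm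
  have hr₂' : IsRetractionOn N W₂ (W₁.piecewise r r₂) := hr₂.congr fun x hx => by
    by_cases hx₁ : x ∈ W₁
    · rw [piecewise_eq_of_mem _ _ _ hx₁, heq x hx (hχ1 x hx₁)]
    · rw [piecewise_eq_of_notMem _ _ _ hx₁]
  exact ⟨W₁ ∪ W₂, _, hr₁.union hr₂', union_subset_union hKW₁ hNW₂⟩

theorem isSmoothNhdRetract_of_isSliceChart (hc : IsCompact N)
    (h : ∀ x ∈ N, ∃ Φ P, x ∈ Φ.source ∧ IsSliceChart N Φ P) : IsSmoothNhdRetract N := by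
  suffices ∀ K, IsClosed K → (∃ W r, IsRetractionOn N W r ∧ K ⊆ W) →
      ∃ W r, IsRetractionOn N W r ∧ K ∪ (N ∩ closure N) ⊆ W by
    simpa [IsSmoothNhdRetract, hc.isClosed.closure_eq] using this ∅ isClosed_empty
      ⟨∅, id, ⟨isOpen_empty, contDiffOn_id, mapsTo_empty _ _, fun _ _ h => h.elim⟩, subset_rfl⟩
  refine hc.induction_on (p := fun s => ∀ K, IsClosed K → (∃ W r, IsRetractionOn N W r ∧ K ⊆ W) →
    ∃ W r, IsRetractionOn N W r ∧ K ∪ (N ∩ closure s) ⊆ W) (by simp) ?_ ?_ fun x hx => ?_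
  · intro s t hst ht K hK hKW
    obtain ⟨W, r, hr, hW⟩ := ht K hK hKW
    exact ⟨W, r, hr, subset_trans (by gcongr) hW⟩
  · intro s t hs ht K hK hKW
    obtain ⟨W, r, hr, hW⟩ := ht _ (hK.union (hc.isClosed.inter isClosed_closure)) (hs K hK hKW)
    exact ⟨W, r, hr, by rwa [closure_union, inter_union_distrib_left, ← union_assoc]⟩
  · obtain ⟨Φ, P, hxΦ, hΦ⟩ := h x hx
    obtain ⟨s, hs, hsc, hsΦ⟩ := exists_mem_nhds_isClosed_subset (Φ.open_source.mem_nhds hxΦ)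
    refine ⟨s, mem_nhdsWithin_of_mem_nhds hs, fun K hK ⟨W, r, hr, hKW⟩ => ?_⟩
    obtain ⟨W', r', hr', hW'⟩ := hr.exists_union hK hKW hΦ
    exact ⟨W', r', hr', subset_trans (by rw [hsc.closure_eq]; gcongr) hW'⟩

theorem IsSmoothNhdRetract.exists_contDiff (h : IsSmoothNhdRetract N) (hN : IsClosed N) :
    ∃ π W, ContDiff ℝ ∞ π ∧ IsRetractionOn N W π ∧ N ⊆ W := by
  obtain ⟨W, r, hr, hNW⟩ := h
  obtain ⟨χ, hχ, hχW, hχ1⟩ := exists_contDiff_eventually_eq_one hN hr.isOpen hNW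
  obtain ⟨W', hW', hNW', hχ1 : ∀ x ∈ W', χ x = 1⟩ := mem_nhdsSet_iff_exists.1 hχ1
  have hW'W : W' ⊆ W := fun x hx => hχW (subset_tsupport _ (by simp [hχ1 x hx]))
  refine ⟨fun x => χ x • r x, W', contDiff_iff_contDiffAt.2 fun x => ?_,
    (hr.mono hW' hW'W).congr fun x hx => by simp [hχ1 x hx], hNW'⟩
  by_cases hx : x ∈ W
  · exact hχ.contDiffAt.smul (hr.contDiffOn.contDiffAt (hr.isOpen.mem_nhds hx))
  · refine (contDiffAt_const (c := 0)).congr_of_eventuallyEq ?_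
    filter_upwards [notMem_tsupport_iff_eventuallyEq.1 fun h => hx (hχW h)] with y hy
    simp [hy]

theorem IsSmoothSubmanifold.isSmoothNhdRetract {m d : ℕ} {N : Set (EuclideanSpace ℝ (Fin m))}
    (hN : IsSmoothSubmanifold d N) (hc : IsCompact N) : IsSmoothNhdRetract N := by
  let F : Submodule ℝ (EuclideanSpace ℝ (Fin m)) :=
    ⨅ i : {i : Fin m // d ≤ i}, LinearMap.ker (EuclideanSpace.proj (𝕜 := ℝ) i.1).toLinearMap
  refine isSmoothNhdRetract_of_isSliceChart hc fun x hx => ?_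
  obtain ⟨Φ, hxΦ, hΦ, hΦ', hmem⟩ := hN.2 x hx
  refine ⟨Φ, F.starProjection, hxΦ, hΦ, hΦ', fun y => ?_, fun y hy => (hmem y hy).trans ?_⟩
  · exact F.starProjection_eq_self_iff.2 (F.starProjection_apply_mem y)
  · simp [F.starProjection_eq_self_iff, F]

end Retracts

section Quasiconvexity

variable {V F : Type*} [NormedAddCommGroup V] [NormedSpace ℝ V] [NormedAddCommGroup F]
  [NormedSpace ℝ F] {N W : Set V} {p q r : V} {C C' : ℝ} {Γ Γ' : ℝ → V} {π : V → V}

/-- `Γ` is a smooth `C`-Lipschitz path in `N` from `p` to `q`, constant outside `[0, 1]`. -/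
structure IsSmoothPath (N : Set V) (p q : V) (C : ℝ) (Γ : ℝ → V) : Prop where
  contDiff : ContDiff ℝ ∞ Γ
  mem : ∀ t, Γ t ∈ N
  eq_left : ∀ t ≤ 0, Γ t = p
  eq_right : ∀ t, 1 ≤ t → Γ t = q
  norm_sub_le : ∀ t t', ‖Γ t - Γ t'‖ ≤ C * |t - t'|

/-- Any two points of `N` are joined in `N` by a smooth path whose speed is at most a constant
times their distance. -/
def IsQuasiconvex (N : Set V) : Prop :=
  ∃ C : ℝ, 0 ≤ C ∧ ∀ p ∈ N, ∀ q ∈ N, ∃ Γ, IsSmoothPath N p q (C * ‖p - q‖) Γ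

theorem exists_norm_sub_le_of_isCompact {f : V → F} (hf : ContDiff ℝ 1 f) {K : Set V}
    (hK : IsCompact K) : ∃ C : ℝ, 0 ≤ C ∧ ∀ x ∈ K, ∀ y ∈ K, ‖f x - f y‖ ≤ C * ‖x - y‖ := by
  obtain ⟨C, hC⟩ := hf.locallyLipschitz.locallyLipschitzOn (s := K)
    |>.exists_lipschitzOnWith_of_compact hK
  exact ⟨C, C.2, fun x hx y hy => hC.norm_sub_le hx hy⟩

theorem exists_smoothTransition_sub_le :
    ∃ L : ℝ, 0 ≤ L ∧ ∀ t t' : ℝ,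
      |Real.smoothTransition t - Real.smoothTransition t'| ≤ L * |t - t'| := by
  obtain ⟨L, hL, h⟩ := exists_norm_sub_le_of_isCompact
    (Real.smoothTransition.contDiff (n := 1)) (isCompact_Icc (a := (0 : ℝ)) (b := 1))
  refine ⟨L, hL, fun t t' => ?_⟩
  rw [← Real.smoothTransition.projIcc (x := t), ← Real.smoothTransition.projIcc (x := t')]
  refine (h _ (projIcc 0 1 zero_le_one t).2 _ (projIcc 0 1 zero_le_one t').2).trans ?_
  gcongr
  have := (LipschitzWith.projIcc (zero_le_one' ℝ)).dist_le_mul t t'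
  simpa [Subtype.dist_eq, Real.dist_eq] using this

theorem IsSmoothPath.mono (h : IsSmoothPath N p q C Γ) (hC : C ≤ C') :
    IsSmoothPath N p q C' Γ :=
  { h with norm_sub_le := fun t t' => (h.norm_sub_le t t').trans (by gcongr) }

theorem IsSmoothPath.symm (h : IsSmoothPath N p q C Γ) :
    IsSmoothPath N q p C fun t => Γ (1 - t) where
  contDiff := h.contDiff.comp (contDiff_const.sub contDiff_id)
  mem t := h.mem _
  eq_left t ht := h.eq_right _ (by linarith)
  eq_right t ht := h.eq_left _ (by linarith)
  norm_sub_le t t' := by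
    refine (h.norm_sub_le _ _).trans_eq ?_
    rw [show 1 - t - (1 - t') = -(t - t') by ring, abs_neg]

theorem IsSmoothPath.trans (h : IsSmoothPath N p q C Γ) (h' : IsSmoothPath N q r C' Γ') :
    IsSmoothPath N p r (2 * (C + C')) fun t => Γ (2 * t) + Γ' (2 * t - 1) - q where
  contDiff := ((h.contDiff.comp (contDiff_const.mul contDiff_id)).add
    (h'.contDiff.comp ((contDiff_const.mul contDiff_id).sub contDiff_const))).sub contDiff_const
  mem t := by
    rcases le_total (2 * t) 1 with ht | ht
    · rw [h'.eq_left (2 * t - 1) (by linarith), add_sub_cancel_right]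
      exact h.mem _
    · rw [h.eq_right (2 * t) ht, add_sub_cancel_left]
      exact h'.mem _
  eq_left t ht := by
    rw [h'.eq_left (2 * t - 1) (by linarith), h.eq_left _ (by linarith), add_sub_cancel_right]
  eq_right t ht := by
    rw [h'.eq_right (2 * t - 1) (by linarith), h.eq_right _ (by linarith), add_sub_cancel_left]
  norm_sub_le t t' := by
    have h1 := h.norm_sub_le (2 * t) (2 * t')
    have h2 := h'.norm_sub_le (2 * t - 1) (2 * t' - 1)
    rw [← mul_sub, abs_mul, abs_two] at h1
    rw [show 2 * t - 1 - (2 * t' - 1) = 2 * (t - t') by ring, abs_mul, abs_two] at h2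
    calc _ = ‖(Γ (2 * t) - Γ (2 * t')) + (Γ' (2 * t - 1) - Γ' (2 * t' - 1))‖ := by
          congr 1; abel
      _ ≤ _ := (norm_add_le _ _).trans (by linarith)

theorem isQuasiconvex_univ : IsQuasiconvex (univ : Set V) := by
  obtain ⟨L, hL, h⟩ := exists_smoothTransition_sub_le
  refine ⟨L, hL, fun p _ q _ => ⟨fun t => p + Real.smoothTransition t • (q - p), ?_⟩⟩
  refine ⟨contDiff_const.add (Real.smoothTransition.contDiff.smul contDiff_const),
    fun t => mem_univ _, fun t ht => ?_, fun t ht => ?_, fun t t' => ?_⟩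
  · simp [Real.smoothTransition.zero_of_nonpos ht]
  · simp [Real.smoothTransition.one_of_one_le ht]
  · rw [add_sub_add_left_eq_sub, ← sub_smul, norm_smul, Real.norm_eq_abs, norm_sub_rev p q]
    nlinarith [h t t', norm_nonneg (q - p)]

theorem IsRetractionOn.exists_isSmoothPath_of_norm_sub_lt [FiniteDimensional ℝ V]
    (hπ : IsRetractionOn N W π) (hπ' : ContDiff ℝ ∞ π) (hc : IsCompact N) (hNW : N ⊆ W) :
    ∃ C δ : ℝ, 0 ≤ C ∧ 0 < δ ∧ ∀ p ∈ N, ∀ q ∈ N, ‖p - q‖ < δ →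
      ∃ Γ, IsSmoothPath N p q (C * ‖p - q‖) Γ := by
  obtain ⟨L, hL, hθ⟩ := exists_smoothTransition_sub_le
  obtain ⟨δ, hδ, hδW⟩ := hc.exists_thickening_subset_open hπ.isOpen hNW
  obtain ⟨R, hR⟩ := hc.isBounded.subset_closedBall (0 : V)
  obtain ⟨M, hM, hπM⟩ := exists_norm_sub_le_of_isCompact (hπ'.of_le (by simp))
    (isCompact_closedBall (0 : V) R)
  refine ⟨M * L, δ, by positivity, hδ, fun p hp q hq hpq =>
    ⟨fun t => π (p + Real.smoothTransition t • (q - p)), ?_⟩⟩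
  have hseg : ∀ t, p + Real.smoothTransition t • (q - p) ∈ Metric.closedBall (0 : V) R := fun t =>
    (convex_closedBall (0 : V) R).add_smul_sub_mem (hR hp) (hR hq)
      ⟨Real.smoothTransition.nonneg t, Real.smoothTransition.le_one t⟩
  refine ⟨hπ'.comp (contDiff_const.add (Real.smoothTransition.contDiff.smul contDiff_const)),
    fun t => hπ.mapsTo (hδW ?_), fun t ht => ?_, fun t ht => ?_, fun t t' => ?_⟩
  · refine Metric.mem_thickening_iff.2 ⟨p, hp, ?_⟩
    rw [dist_eq_norm, add_sub_cancel_left, norm_smul, Real.norm_eq_abs,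
      abs_of_nonneg (Real.smoothTransition.nonneg t), norm_sub_rev]
    exact (mul_le_of_le_one_left (norm_nonneg _) (Real.smoothTransition.le_one t)).trans_lt hpq
  · simp [Real.smoothTransition.zero_of_nonpos ht, hπ.eq_self p hp (hNW hp)]
  · simp [Real.smoothTransition.one_of_one_le ht, hπ.eq_self q hq (hNW hq)]
  · refine (hπM _ (hseg t) _ (hseg t')).trans ?_
    rw [add_sub_add_left_eq_sub, ← sub_smul, norm_smul, Real.norm_eq_abs, norm_sub_rev p q,
      mul_assoc, mul_assoc]
    refine mul_le_mul_of_nonneg_left ?_ hM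
    nlinarith [hθ t t', norm_nonneg (q - p)]

theorem exists_isSmoothPath_of_isPreconnected (hN : IsPreconnected N) {δ : ℝ} (hδ : 0 < δ)
    (hnear : ∀ p ∈ N, ∀ q ∈ N, ‖p - q‖ < δ → ∃ K Γ, IsSmoothPath N p q K Γ)
    (hp : p ∈ N) (hq : q ∈ N) : ∃ K Γ, IsSmoothPath N p q K Γ := by
  refine hN.induction₂ (fun p q => ∃ K Γ, IsSmoothPath N p q K Γ) (fun x hx => ?_) ?_ ?_ hp hq
  · filter_upwards [mem_nhdsWithin_of_mem_nhds (Metric.ball_mem_nhds x hδ), self_mem_nhdsWithin]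
      with y hy hyN
    exact hnear x hx y hyN (by rwa [← dist_eq_norm, dist_comm])
  · rintro x y z - - - ⟨K, Γ, h⟩ ⟨K', Γ', h'⟩
    exact ⟨_, _, h.trans h'⟩
  · rintro x y - - ⟨K, Γ, h⟩
    exact ⟨_, _, h.symm⟩

/-- Finitely many joining paths serve all pairs: move each end point to the centre of a ball of a
finite cover. -/
theorem exists_isSmoothPath_uniform (hc : IsCompact N) (hN : IsPreconnected N) {δ : ℝ}
    (hδ : 0 < δ) (hnear : ∀ p ∈ N, ∀ q ∈ N, ‖p - q‖ < δ → ∃ Γ, IsSmoothPath N p q C Γ) :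
    ∃ K, ∀ p ∈ N, ∀ q ∈ N, ∃ Γ, IsSmoothPath N p q K Γ := by
  have hjoin : ∀ p ∈ N, ∀ q ∈ N, ∃ K Γ, IsSmoothPath N p q K Γ := fun p hp q hq =>
    exists_isSmoothPath_of_isPreconnected hN hδ (fun p hp q hq h => ⟨C, hnear p hp q hq h⟩) hp hq
  choose! K hK using hjoin
  obtain ⟨t, htN, ht⟩ := hc.elim_nhds_subcover (fun x => Metric.ball x δ)
    fun x _ => Metric.ball_mem_nhds x hδ
  obtain ⟨B, hB⟩ := ((t ×ˢ t).finite_toSet.image fun z : V × V => K z.1 z.2).bddAbove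
  refine ⟨2 * (C + 2 * (B + C)), fun p hp q hq => ?_⟩
  obtain ⟨c, hct, hpc⟩ : ∃ c ∈ t, p ∈ Metric.ball c δ := by simpa using ht hp
  obtain ⟨c', hct', hqc⟩ : ∃ c ∈ t, q ∈ Metric.ball c δ := by simpa using ht hq
  rw [Metric.mem_ball, dist_eq_norm] at hpc hqc
  obtain ⟨Γ₁, h₁⟩ := hnear p hp c (htN c hct) hpc
  obtain ⟨Γ₂, h₂⟩ := hK c (htN c hct) c' (htN c' hct')
  obtain ⟨Γ₃, h₃⟩ := hnear c' (htN c' hct') q hq (by rwa [norm_sub_rev])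
  exact ⟨_, h₁.trans ((h₂.mono (hB ⟨(c, c'), by simp [hct, hct'], rfl⟩)).trans h₃)⟩

theorem IsSmoothNhdRetract.isQuasiconvex [FiniteDimensional ℝ V] (h : IsSmoothNhdRetract N)
    (hc : IsCompact N) (hN : IsPreconnected N) : IsQuasiconvex N := by
  obtain ⟨π, W, hπ', hπ, hNW⟩ := h.exists_contDiff hc.isClosed
  obtain ⟨C, δ, hC, hδ, hnear⟩ := hπ.exists_isSmoothPath_of_norm_sub_lt hπ' hc hNW
  obtain ⟨K, hfar⟩ := exists_isSmoothPath_uniform (C := C * δ) hc hN hδ fun p hp q hq hpq =>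
    (hnear p hp q hq hpq).imp fun Γ hΓ => hΓ.mono (by gcongr)
  refine ⟨max C (K / δ), le_max_of_le_left hC, fun p hp q hq => ?_⟩
  rcases lt_or_ge ‖p - q‖ δ with hpq | hpq
  · exact (hnear p hp q hq hpq).imp fun Γ hΓ => hΓ.mono (by gcongr; exact le_max_left _ _)
  · refine (hfar p hp q hq).imp fun Γ hΓ => hΓ.mono ?_
    calc K = K / δ * δ := by field_simp
      _ ≤ max C (K / δ) * δ := by gcongr; exact le_max_right _ _
      _ ≤ max C (K / δ) * ‖p - q‖ :=
        mul_le_mul_of_nonneg_left hpq (le_max_of_le_left hC)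

/-- The curve running through the paths `Γ j` one after the other, `Γ j` being traversed during
the time interval `[j, j + 1]`. -/
noncomputable def concat (Γ : ℤ → ℝ → V) (t : ℝ) : V := Γ ⌊t⌋ (t - ⌊t⌋)

section Concat

variable {γ : ℤ → V} {c : ℤ → ℝ} {G : ℤ → ℝ → V}

theorem contDiff_concat (hG : ∀ j, IsSmoothPath N (γ j) (γ (j + 1)) (c j) (G j)) :
    ContDiff ℝ ∞ (concat G) := by
  refine contDiff_iff_contDiffAt.2 fun t => ?_
  obtain ⟨j, hj⟩ : ∃ j : ℤ, j = ⌊t⌋ := ⟨_, rfl⟩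
  obtain ⟨hjt, htj⟩ := Int.floor_eq_iff.1 hj.symm
  have hloc : concat G =ᶠ[𝓝 t] fun s => G (j - 1) (s - (j - 1)) + G j (s - j) - γ j := by
    filter_upwards [Ioo_mem_nhds (show (j : ℝ) - 1 < t by linarith) htj] with s hs
    rcases lt_or_ge s j with h | h
    · have hs' : ⌊s⌋ = j - 1 := Int.floor_eq_iff.2
        ⟨by push_cast; exact hs.1.le, by push_cast; linarith⟩
      rw [concat, hs', (hG j).eq_left _ (by linarith)]
      simp
    · have hs' : ⌊s⌋ = j := Int.floor_eq_iff.2 ⟨h, hs.2⟩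
      rw [concat, hs', (hG (j - 1)).eq_right _ (by linarith)]
      simp
  refine ContDiffAt.congr_of_eventuallyEq (ContDiff.contDiffAt ?_) hloc
  exact (((hG (j - 1)).contDiff.comp (contDiff_id.sub contDiff_const)).add
    ((hG j).contDiff.comp (contDiff_id.sub contDiff_const))).sub contDiff_const

theorem norm_concat_sub_le (hG : ∀ j, IsSmoothPath N (γ j) (γ (j + 1)) (c j) (G j)) (t : ℝ) :
    ‖concat G t - γ ⌊t⌋‖ ≤ c ⌊t⌋ := by
  have hc : 0 ≤ c ⌊t⌋ := by simpa using (norm_nonneg _).trans ((hG ⌊t⌋).norm_sub_le 1 0)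
  rw [← (hG ⌊t⌋).eq_left 0 le_rfl]
  refine ((hG ⌊t⌋).norm_sub_le _ _).trans (mul_le_of_le_one_right hc ?_)
  rw [sub_zero, Int.self_sub_floor, abs_of_nonneg (Int.fract_nonneg t)]
  exact (Int.fract_lt_one t).le

theorem norm_concat_sub_concat_le (hG : ∀ j, IsSmoothPath N (γ j) (γ (j + 1)) (c j) (G j))
    {t t' : ℝ} (h : |t - t'| ≤ 1) :
    ‖concat G t - concat G t'‖ ≤ |t - t'| * (c ⌊t⌋ + c ⌊t'⌋) := by
  wlog htt : t ≤ t' generalizing t t'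
  · rw [norm_sub_rev, abs_sub_comm, add_comm]
    exact this (by rwa [abs_sub_comm]) (le_of_not_ge htt)
  have hc : ∀ j, 0 ≤ c j := fun j => by
    simpa using (norm_nonneg _).trans ((hG j).norm_sub_le 1 0)
  rw [abs_sub_comm, abs_of_nonneg (sub_nonneg.2 htt)] at *
  have hfl : ⌊t'⌋ = ⌊t⌋ ∨ ⌊t'⌋ = ⌊t⌋ + 1 := by
    have h₁ : ⌊t⌋ ≤ ⌊t'⌋ := Int.floor_mono htt
    have h₂ : ⌊t'⌋ ≤ ⌊t + 1⌋ := Int.floor_mono (by linarith)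
    rw [Int.floor_add_one] at h₂
    omega
  rcases hfl with hfl | hfl
  · rw [concat, concat, hfl]
    refine ((hG ⌊t⌋).norm_sub_le _ _).trans ?_
    rw [sub_sub_sub_cancel_right, abs_sub_comm, abs_of_nonneg (sub_nonneg.2 htt)]
    nlinarith [mul_nonneg (sub_nonneg.2 htt) (hc ⌊t⌋)]
  · have ht' : (⌊t⌋ : ℝ) + 1 ≤ t' := by exact_mod_cast hfl ▸ Int.floor_le t'
    have hend : ‖concat G t - γ (⌊t⌋ + 1)‖ ≤ c ⌊t⌋ * (⌊t⌋ + 1 - t) := by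
      rw [concat, ← (hG ⌊t⌋).eq_right 1 le_rfl]
      refine ((hG ⌊t⌋).norm_sub_le _ _).trans_eq ?_
      rw [abs_sub_comm, abs_of_nonneg (by linarith [Int.lt_floor_add_one t])]
      ring
    have hstart : ‖γ (⌊t⌋ + 1) - concat G t'‖ ≤ c ⌊t'⌋ * (t' - (⌊t⌋ + 1)) := by
      rw [concat, hfl, ← (hG (⌊t⌋ + 1)).eq_left 0 le_rfl]
      refine ((hG (⌊t⌋ + 1)).norm_sub_le _ _).trans_eq ?_
      push_cast
      rw [zero_sub, abs_neg, abs_of_nonneg (by linarith)]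
    have htri := norm_sub_le_norm_sub_add_norm_sub (concat G t) (γ (⌊t⌋ + 1)) (concat G t')
    nlinarith [hc ⌊t⌋, hc ⌊t'⌋, Int.lt_floor_add_one t]

end Concat

theorem IsQuasiconvex.exists_interpolation (hN : IsQuasiconvex N) :
    ∃ C : ℝ, 0 ≤ C ∧ ∀ γ : ℤ → V, (∀ j, γ j ∈ N) → ∃ v : ℝ → V, ContDiff ℝ ∞ v ∧ (∀ t, v t ∈ N) ∧
      (∀ t, ‖v t - γ ⌊t⌋‖ ≤ C * ‖γ ⌊t⌋ - γ (⌊t⌋ + 1)‖) ∧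
      ∀ t t', |t - t'| ≤ 1 → ‖v t - v t'‖ ≤
        |t - t'| * (C * ‖γ ⌊t⌋ - γ (⌊t⌋ + 1)‖ + C * ‖γ ⌊t'⌋ - γ (⌊t'⌋ + 1)‖) := by
  obtain ⟨C, hC, hpath⟩ := hN
  refine ⟨C, hC, fun γ hγ => ?_⟩
  choose G hG using fun j => hpath (γ j) (hγ j) (γ (j + 1)) (hγ (j + 1))
  exact ⟨concat G, contDiff_concat hG, fun t => (hG ⌊t⌋).mem _, norm_concat_sub_le hG,
    fun t t' => norm_concat_sub_concat_le hG⟩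

end Quasiconvexity

section GagliardoMeasure

variable {E : Type*} [NormedAddCommGroup E] {a b σ p : ℝ}

/-- The measure `dx dy / |x - y| ^ (1 + σ p)` on `(a, b) × (a, b)`: the Gagliardo seminorm of `g`
is the `Lᵖ` norm of `g x - g y` with respect to it. -/
noncomputable def gagliardoMeasure (a b σ p : ℝ) : Measure (ℝ × ℝ) :=
  ((volume.restrict (Ioo a b)).prod (volume.restrict (Ioo a b))).withDensity
    fun z => ‖z.1 - z.2‖ₑ ^ (-(1 + σ * p))

theorem gagliardoMeasure_absolutelyContinuous :
    gagliardoMeasure a b σ p ≪ (volume.restrict (Ioo a b)).prod (volume.restrict (Ioo a b)) :=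
  withDensity_absolutelyContinuous _ _

theorem lintegral_gagliardoMeasure {F : ℝ × ℝ → ℝ≥0∞}
    (hF : AEMeasurable F ((volume.restrict (Ioo a b)).prod (volume.restrict (Ioo a b)))) :
    ∫⁻ z, F z ∂gagliardoMeasure a b σ p =
      ∫⁻ x in Ioo a b, ∫⁻ y in Ioo a b, F (x, y) * ‖x - y‖ₑ ^ (-(1 + σ * p)) := by
  have hk : Measurable fun z : ℝ × ℝ => ‖z.1 - z.2‖ₑ ^ (-(1 + σ * p)) := by fun_prop
  rw [gagliardoMeasure, lintegral_withDensity_eq_lintegral_mul₀ hk.aemeasurable hF,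
    lintegral_prod _ (hk.aemeasurable.mul hF)]
  simp only [Pi.mul_apply, mul_comm]

theorem measurePreserving_swap_gagliardoMeasure :
    MeasurePreserving Prod.swap (gagliardoMeasure a b σ p) (gagliardoMeasure a b σ p) := by
  refine ⟨measurable_swap, Measure.ext_of_lintegral _ fun F hF => ?_⟩
  rw [lintegral_map hF measurable_swap, lintegral_gagliardoMeasure hF.aemeasurable,
    lintegral_gagliardoMeasure (F := fun z => F z.swap) (by fun_prop),
    lintegral_lintegral_swap (by fun_prop)]
  simp only [Prod.swap_prod_mk, enorm_sub_rev]

theorem gagliardo_eq_eLpNorm (hσ : 0 ≤ σ) (hp : 0 < p) {g : ℝ → E}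
    (hg : AEStronglyMeasurable g (volume.restrict (Ioo a b))) :
    gagliardo a b σ p g =
      eLpNorm (fun z : ℝ × ℝ => g z.1 - g z.2) (ENNReal.ofReal p) (gagliardoMeasure a b σ p) := by
  have hθ : 0 < 1 + σ * p := by positivity
  rw [eLpNorm_eq_lintegral_rpow_enorm_toReal (by simpa using hp) ENNReal.ofReal_ne_top,
    ENNReal.toReal_ofReal hp.le,
    lintegral_gagliardoMeasure (F := fun z => ‖g z.1 - g z.2‖ₑ ^ p)
      ((hg.comp_fst.sub hg.comp_snd).enorm.pow_const p), gagliardo]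
  refine congrArg (· ^ (1 / p)) (lintegral_congr fun x => lintegral_congr fun y => ?_)
  rw [ENNReal.div_eq_inv_mul, mul_comm, ← ENNReal.ofReal_rpow_of_nonneg (abs_nonneg _) hθ.le,
    ENNReal.rpow_neg, ← Real.enorm_eq_ofReal_abs]

theorem lintegral_min_one_rpow_lt_top (hσ : 0 < σ) (hσ1 : σ < 1) (hp : 0 < p) :
    ∫⁻ r : ℝ, min 1 ‖r‖ₑ ^ p * ‖r‖ₑ ^ (-(1 + σ * p)) < ⊤ := by
  have hσp : 0 < σ * p := mul_pos hσ hp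
  have hint : Integrable fun r : ℝ => min 1 ‖r‖ ^ p * ‖r‖ ^ (-(1 + σ * p)) := by
    refine (integrable_fun_norm_addHaar volume
      (f := fun r => min 1 r ^ p * r ^ (-(1 + σ * p)))).2 ?_
    simp only [Module.finrank_self, tsub_self, pow_zero, one_smul]
    rw [← Ioc_union_Ioi_eq_Ioi zero_le_one]
    refine IntegrableOn.union ?_ ?_
    · have hnear : IntegrableOn (fun r : ℝ => r ^ (p - (1 + σ * p))) (Ioc 0 1) := by
        rw [← intervalIntegrable_iff_integrableOn_Ioc_of_le zero_le_one]
        exact intervalIntegral.intervalIntegrable_rpow' (by nlinarith)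
      refine hnear.congr_fun (fun r hr => ?_) measurableSet_Ioc
      simp only [min_eq_right hr.2, ← Real.rpow_add hr.1, sub_eq_add_neg]
    · refine (integrableOn_Ioi_rpow_of_lt (by linarith : -(1 + σ * p) < -1) one_pos).congr_fun
        (fun r hr => ?_) measurableSet_Ioi
      simp [min_eq_left (mem_Ioi.1 hr).le]
  refine (lintegral_congr fun r => ?_).trans_lt hint.2
  rcases eq_or_ne r 0 with rfl | hr
  · simp [Real.zero_rpow hp.ne', ENNReal.zero_rpow_of_pos hp]
  · have hmin : ‖min 1 ‖r‖‖ₑ = min 1 ‖r‖ₑ := by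
      rw [Real.enorm_of_nonneg (by positivity), ENNReal.ofReal_min, ofReal_norm, ENNReal.ofReal_one]
    rw [enorm_mul, Real.enorm_rpow_of_nonneg (by positivity) hp.le, hmin, Real.rpow_neg
      (norm_nonneg r), enorm_inv (by positivity), Real.enorm_rpow_of_nonneg (norm_nonneg r)
      (by positivity), enorm_norm, ENNReal.rpow_neg]

theorem lintegral_comp_mul_left_real {F : ℝ → ℝ≥0∞} (hF : Measurable F) {c : ℝ} (hc : c ≠ 0) :
    ∫⁻ r, F (c * r) = ‖c‖ₑ⁻¹ * ∫⁻ r, F r := by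
  rw [← lintegral_map hF (measurable_const_mul c), Real.map_volume_mul_left hc,
    lintegral_smul_measure, ← Real.enorm_eq_ofReal_abs, enorm_inv hc, smul_eq_mul]

theorem lintegral_min_one_mul_rpow (hσ : 0 < σ) (hp : 0 < p) (c : ℝ≥0) (y : ℝ) :
    ∫⁻ x, min 1 (c * ‖x - y‖ₑ) ^ p * ‖x - y‖ₑ ^ (-(1 + σ * p)) =
      (c : ℝ≥0∞) ^ (σ * p) * ∫⁻ r : ℝ, min 1 ‖r‖ₑ ^ p * ‖r‖ₑ ^ (-(1 + σ * p)) := by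
  rcases eq_or_ne c 0 with rfl | hc
  · simp [hp, mul_pos hσ hp]
  have hscale : ∀ r : ℝ, min 1 (c * ‖r‖ₑ) ^ p * ‖r‖ₑ ^ (-(1 + σ * p)) = (c : ℝ≥0∞) ^ (1 + σ * p) *
      (min 1 ‖(c : ℝ) * r‖ₑ ^ p * ‖(c : ℝ) * r‖ₑ ^ (-(1 + σ * p))) := fun r => by
    rw [enorm_mul, NNReal.enorm_eq, ENNReal.mul_rpow_of_ne_top (by simp) (by simp), mul_left_comm,
      ← mul_assoc (_ ^ (1 + σ * p)), ← ENNReal.rpow_add _ _ (by simpa using hc) (by simp),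
      add_neg_cancel, ENNReal.rpow_zero, one_mul]
  rw [lintegral_sub_right_eq_self fun r => min 1 (c * ‖r‖ₑ) ^ p * ‖r‖ₑ ^ (-(1 + σ * p))]
  simp only [hscale]
  rw [lintegral_const_mul _ (by fun_prop), lintegral_comp_mul_left_real (c := c)
    (F := fun r => min 1 ‖r‖ₑ ^ p * ‖r‖ₑ ^ (-(1 + σ * p))) (by fun_prop) (by simpa using hc),
    ← mul_assoc, NNReal.enorm_eq, ← ENNReal.rpow_neg_one, ← ENNReal.rpow_add _ _
    (by simpa using hc) (by simp), add_neg_cancel_comm]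

theorem exists_eLpNorm_min_one_mul_le (hσ : 0 < σ) (hσ1 : σ < 1) (hp : 0 < p) :
    ∃ C : ℝ≥0, ∀ (a b : ℝ) (c m : ℝ → ℝ≥0), Measurable c → Measurable m →
      eLpNorm (fun z : ℝ × ℝ => min 1 (c z.2 * ‖z.1 - z.2‖ₑ) * m z.2) (ENNReal.ofReal p)
        (gagliardoMeasure a b σ p) ≤
      C * eLpNorm (fun y => (c y : ℝ≥0∞) ^ σ * m y) (ENNReal.ofReal p)
        (volume.restrict (Ioo a b)) := by
  have hK := (lintegral_min_one_rpow_lt_top hσ hσ1 hp).ne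
  set K : ℝ≥0∞ := ∫⁻ r : ℝ, min 1 ‖r‖ₑ ^ p * ‖r‖ₑ ^ (-(1 + σ * p))
  refine ⟨(K ^ (1 / p)).toNNReal, fun a b c m hc hm => ?_⟩
  have hp0 : ENNReal.ofReal p ≠ 0 := by simpa using hp
  simp only [eLpNorm_eq_lintegral_rpow_enorm_toReal hp0 ENNReal.ofReal_ne_top,
    ENNReal.toReal_ofReal hp.le, enorm_eq_self]
  rw [ENNReal.coe_toNNReal (ENNReal.rpow_ne_top_of_nonneg (by positivity) hK),
    ← ENNReal.mul_rpow_of_nonneg _ _ (by positivity)]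
  gcongr
  rw [lintegral_gagliardoMeasure (F := fun z => (min 1 (c z.2 * ‖z.1 - z.2‖ₑ) * m z.2) ^ p)
    (by fun_prop), lintegral_lintegral_swap (by fun_prop), ← lintegral_const_mul' _ _ hK]
  refine lintegral_mono fun y => ?_
  calc ∫⁻ x in Ioo a b, (min 1 (c y * ‖x - y‖ₑ) * m y) ^ p * ‖x - y‖ₑ ^ (-(1 + σ * p))
    _ ≤ ∫⁻ x, (min 1 (c y * ‖x - y‖ₑ) * m y) ^ p * ‖x - y‖ₑ ^ (-(1 + σ * p)) :=
      setLIntegral_le_lintegral _ _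
    _ = ∫⁻ x, (m y : ℝ≥0∞) ^ p * (min 1 (c y * ‖x - y‖ₑ) ^ p * ‖x - y‖ₑ ^ (-(1 + σ * p))) := by
      simp only [ENNReal.mul_rpow_of_nonneg _ _ hp.le]
      exact lintegral_congr fun x => by ring
    _ = (m y : ℝ≥0∞) ^ p * ((c y : ℝ≥0∞) ^ (σ * p) * K) := by
      rw [lintegral_const_mul _ (by fun_prop), lintegral_min_one_mul_rpow hσ hp]
    _ = K * ((c y : ℝ≥0∞) ^ σ * m y) ^ p := by
      rw [ENNReal.mul_rpow_of_nonneg _ _ hp.le, ← ENNReal.rpow_mul]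
      ring

end GagliardoMeasure

section Nodes

variable {V : Type*} [NormedAddCommGroup V] {a b h σ p : ℝ} {n : ℕ} {u : ℝ → V} {N : Set V}

/-- The difference `u x - u y`, cut off to the pairs at distance less than `δ`. -/
noncomputable def nearDiff (u : ℝ → V) (δ : ℝ) : ℝ × ℝ → V :=
  {z : ℝ × ℝ | |z.1 - z.2| < δ}.indicator fun z => u z.1 - u z.2

theorem stronglyMeasurable_nearDiff (hu : StronglyMeasurable u) (δ : ℝ) :
    StronglyMeasurable (nearDiff u δ) :=
  ((hu.comp_measurable measurable_fst).sub (hu.comp_measurable measurable_snd)).indicator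
    (measurableSet_lt (by fun_prop) measurable_const)

theorem nearDiff_of_lt {δ x y : ℝ} (h : |x - y| < δ) : nearDiff u δ (x, y) = u x - u y :=
  indicator_of_mem (s := {z : ℝ × ℝ | |z.1 - z.2| < δ}) h _

theorem exists_mem_and_measure_mul_le_setLIntegral {α : Type*} [MeasurableSpace α] {μ : Measure α}
    {s : Set α} (hs : MeasurableSet s) (hs0 : μ s ≠ 0) (hst : μ s ≠ ⊤) {f : α → ℝ≥0∞}
    (hf : Measurable f) {P : α → Prop} (hP : ∀ᵐ x ∂μ.restrict s, P x) :
    ∃ x ∈ s, P x ∧ μ s * f x ≤ ∫⁻ y in s, f y ∂μ := by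
  have : IsFiniteMeasure (μ.restrict s) := isFiniteMeasure_restrict.2 hst
  obtain ⟨x, hx, hle⟩ := exists_notMem_null_le_laverage (μ := μ.restrict s) (by simpa using hs0)
    hf.aemeasurable (ae_iff.1 ((ae_restrict_mem hs).and hP))
  obtain ⟨hxs, hPx⟩ := not_not.1 hx
  refine ⟨x, hxs, hPx, ?_⟩
  rw [setLAverage_eq] at hle
  calc μ s * f x ≤ μ s * ((∫⁻ y in s, f y ∂μ) / μ s) := by gcongr
    _ = _ := ENNReal.mul_div_cancel hs0 hst

theorem setLIntegral_Ico_eq_sum (F : ℝ → ℝ≥0∞) (a : ℝ) (hh : 0 ≤ h) (n : ℕ) :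
    ∫⁻ x in Ico a (a + n * h), F x =
      ∑ j ∈ Finset.range n, ∫⁻ x in Ico (a + j * h) (a + (j + 1) * h), F x := by
  induction n with
  | zero => simp
  | succ n ih =>
    rw [Finset.sum_range_succ, ← ih, ← lintegral_union measurableSet_Ico Ico_disjoint_Ico_same,
      Ico_union_Ico_eq_Ico (by nlinarith [(Nat.cast_nonneg n : (0 : ℝ) ≤ n)]) (by nlinarith)]
    push_cast
    rfl

theorem Ico_cell_subset (hh : 0 ≤ h) {j : ℕ} (hj : j < n) :
    Ico (a + j * h) (a + (j + 1) * h) ⊆ Ico a (a + n * h) := by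
  have hjn : (j : ℝ) + 1 ≤ n := by exact_mod_cast hj
  exact Ico_subset_Ico (le_add_of_nonneg_right (by positivity)) (by gcongr)

theorem floor_sub_div_eq (hh : 0 < h) {j : ℕ} {x : ℝ}
    (hx : x ∈ Ico (a + j * h) (a + (j + 1) * h)) : ⌊(x - a) / h⌋ = j := by
  rw [Int.floor_eq_iff, le_div_iff₀ hh, div_lt_iff₀ hh]
  push_cast
  exact ⟨by linarith [hx.1], by linarith [hx.2]⟩

theorem sum_range_min_succ_le (o : ℕ → ℝ≥0∞) (n : ℕ) {i : ℕ} (hi : i ≤ 1) :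
    ∑ j ∈ Finset.range (n + 1), o (min (j + i) n) ≤ 2 * ∑ j ∈ Finset.range (n + 1), o j := by
  rw [two_mul]
  obtain rfl | rfl : i = 0 ∨ i = 1 := by omega
  · refine le_add_right (Finset.sum_le_sum fun j hj => ?_)
    rw [add_zero, min_eq_left (Nat.lt_succ_iff.1 (Finset.mem_range.1 hj))]
  · rw [Finset.sum_range_succ, min_eq_right n.le_succ]
    refine add_le_add ?_ (Finset.single_le_sum (f := o) (fun _ _ => zero_le) (by simp))
    rw [Finset.sum_range_succ']
    refine le_add_right (Finset.sum_le_sum fun j hj => ?_)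
    rw [min_eq_left (Finset.mem_range.1 hj)]

theorem setLIntegral_cell_le (hh : 0 ≤ h) {i j : ℕ} (hi : i ≤ 1) (hj : j < n + 1) {x : ℝ}
    (hx : x ∈ Ico (a + (min (j + i) n : ℕ) * h) (a + ((min (j + i) n : ℕ) + 1) * h)) :
    ∫⁻ y in Ico (a + j * h) (a + (j + 1) * h), ‖u y - u x‖ₑ ^ p ≤
      ∫⁻ y in Ico a (a + (n + 1 : ℕ) * h), ‖nearDiff u (2 * h) (x, y)‖ₑ ^ p := by
  have hlow : (j : ℝ) ≤ (min (j + i) n : ℕ) := by exact_mod_cast (by omega : j ≤ min (j + i) n)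
  have hupp : ((min (j + i) n : ℕ) : ℝ) ≤ j + 1 := by
    exact_mod_cast (by omega : min (j + i) n ≤ j + 1)
  refine (setLIntegral_mono' measurableSet_Ico fun y hy => ?_).trans
    (lintegral_mono_set (Ico_cell_subset hh hj))
  rw [nearDiff_of_lt, enorm_sub_rev]
  rw [abs_lt]
  constructor <;> nlinarith [hx.1, hx.2, hy.1, hy.2]

/-- In each cell, choose a node at which the local oscillation of `u` does not exceed its mean. -/
theorem exists_nodes (hh : 0 < h) (hu : StronglyMeasurable u)
    (huN : ∀ᵐ x ∂volume.restrict (Ico a (a + (n + 1 : ℕ) * h)), u x ∈ N) (p : ℝ) :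
    ∃ γ : ℤ → V, (∀ j, γ j ∈ N) ∧ ∀ i : ℕ, i ≤ 1 →
      ENNReal.ofReal h * ∫⁻ x in Ico a (a + (n + 1 : ℕ) * h), ‖u x - γ (⌊(x - a) / h⌋ + i)‖ₑ ^ p ≤
        2 * ∫⁻ x in Ico a (a + (n + 1 : ℕ) * h), ∫⁻ y in Ico a (a + (n + 1 : ℕ) * h),
          ‖nearDiff u (2 * h) (x, y)‖ₑ ^ p := by
  set I := Ico a (a + (n + 1 : ℕ) * h) with hI
  set cell : ℕ → Set ℝ := fun j => Ico (a + j * h) (a + (j + 1) * h)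
  set osc : ℝ → ℝ≥0∞ := fun x => ∫⁻ y in I, ‖nearDiff u (2 * h) (x, y)‖ₑ ^ p
  have hoscm : Measurable osc :=
    ((stronglyMeasurable_nearDiff hu _).enorm.pow_const p).lintegral_prod_right'
  have hcell : ∀ j, volume (cell j) = ENNReal.ofReal h := fun j => by
    simp only [cell, Real.volume_Ico]; congr 1; ring
  have hnode : ∀ j, ∃ x, j < n + 1 → x ∈ cell j ∧ u x ∈ N ∧
      ENNReal.ofReal h * osc x ≤ ∫⁻ y in cell j, osc y := fun j => by
    by_cases hj : j < n + 1
    · obtain ⟨x, hx⟩ := exists_mem_and_measure_mul_le_setLIntegral (s := cell j) measurableSet_Ico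
        (by simpa [hcell] using hh) (by simp [hcell]) hoscm
        (huN.filter_mono (ae_mono (Measure.restrict_mono (Ico_cell_subset hh.le hj) le_rfl)))
      exact ⟨x, fun _ => by rwa [hcell] at hx⟩
    · exact ⟨0, fun h => absurd h hj⟩
  choose x hx using hnode
  have hmin : ∀ j, min j n < n + 1 := fun j => by omega
  refine ⟨fun j => u (x (min j.toNat n)), fun j => (hx _ (hmin _)).2.1, fun i hi => ?_⟩
  have hlocal : ∀ j < n + 1, ∫⁻ y in cell j, ‖u y - u (x (min (⌊(y - a) / h⌋ + i).toNat n))‖ₑ ^ p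
      ≤ osc (x (min (j + i) n)) := fun j hj =>
    (setLIntegral_congr_fun measurableSet_Ico fun y hy => by
      have hfl : (⌊(y - a) / h⌋ + (i : ℤ)).toNat = j + i := by rw [floor_sub_div_eq hh hy]; omega
      simp only [hfl]).trans_le (setLIntegral_cell_le hh.le hi hj (hx _ (hmin _)).1)
  calc ENNReal.ofReal h * ∫⁻ y in I, ‖u y - u (x (min (⌊(y - a) / h⌋ + i).toNat n))‖ₑ ^ p
    _ ≤ ENNReal.ofReal h * ∑ j ∈ Finset.range (n + 1), osc (x (min (j + i) n)) := by
      rw [hI, setLIntegral_Ico_eq_sum _ _ hh.le]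
      gcongr with j hj
      exact hlocal j (Finset.mem_range.1 hj)
    _ ≤ ENNReal.ofReal h * (2 * ∑ j ∈ Finset.range (n + 1), osc (x j)) := by
      gcongr
      exact sum_range_min_succ_le (fun j => osc (x j)) n hi
    _ = 2 * ∑ j ∈ Finset.range (n + 1), ENNReal.ofReal h * osc (x j) := by
      rw [mul_left_comm, Finset.mul_sum]
    _ ≤ 2 * ∫⁻ y in I, osc y := by
      rw [hI, setLIntegral_Ico_eq_sum _ _ hh.le]
      gcongr with j hj
      exact (hx j (Finset.mem_range.1 hj)).2.2

end Nodes

section Lp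

variable {α V : Type*} [MeasurableSpace α] {μ : Measure α} [NormedAddCommGroup V] {p : ℝ}

theorem eLpNorm_ofReal_rpow {ε : Type*} [TopologicalSpace ε] [ESeminormedAddMonoid ε] (hp : 0 < p)
    (f : α → ε) :
    eLpNorm f (ENNReal.ofReal p) μ ^ p = ∫⁻ x, ‖f x‖ₑ ^ p ∂μ := by
  rw [eLpNorm_eq_eLpNorm' (by simpa using hp) ENNReal.ofReal_ne_top, ENNReal.toReal_ofReal hp.le,
    lintegral_rpow_enorm_eq_rpow_eLpNorm' hp]

theorem tendsto_eLpNorm_zero_of_dominated (hp : 0 < p) {F : ℕ → α → V} {g : α → ℝ≥0∞}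
    (hF : ∀ n, AEStronglyMeasurable (F n) μ) (hg : eLpNorm g (ENNReal.ofReal p) μ ≠ ⊤)
    (hFg : ∀ n, ∀ᵐ x ∂μ, ‖F n x‖ₑ ≤ g x) (hlim : ∀ᵐ x ∂μ, Tendsto (F · x) atTop (𝓝 0)) :
    Tendsto (fun n => eLpNorm (F n) (ENNReal.ofReal p) μ) atTop (𝓝 0) := by
  have hpow : Tendsto (fun n => eLpNorm (F n) (ENNReal.ofReal p) μ ^ p) atTop (𝓝 0) := by
    simp only [eLpNorm_ofReal_rpow hp]
    rw [← lintegral_zero (μ := μ)]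
    refine tendsto_lintegral_of_dominated_convergence' (fun x => g x ^ p)
      (fun n => (hF n).enorm.pow_const p)
      (fun n => (hFg n).mono fun x hx => ENNReal.rpow_le_rpow hx hp.le) ?_ ?_
    · simpa only [eLpNorm_ofReal_rpow hp, enorm_eq_self] using
        ENNReal.rpow_ne_top_of_nonneg hp.le hg
    · filter_upwards [hlim] with x hx
      simpa [hp] using (hx.enorm.ennrpow_const p)
  simpa [← ENNReal.rpow_mul, hp.ne', hp] using hpow.ennrpow_const p⁻¹

end Lp

section Density

variable {V : Type*} [NormedAddCommGroup V] {a b h σ p : ℝ} {n : ℕ} {u : ℝ → V} {N : Set V}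

theorem lintegral_nearDiff_le {δ : ℝ} (hδ : 0 < δ) (hp : 0 < p) (hσp : 0 ≤ 1 + σ * p)
    (hu : StronglyMeasurable u) :
    ∫⁻ x in Ioo a b, ∫⁻ y in Ioo a b, ‖nearDiff u δ (x, y)‖ₑ ^ p ≤
      ENNReal.ofReal δ ^ (1 + σ * p) * ∫⁻ z, ‖nearDiff u δ z‖ₑ ^ p ∂gagliardoMeasure a b σ p := by
  rw [lintegral_gagliardoMeasure (by
    exact ((stronglyMeasurable_nearDiff hu δ).enorm.pow_const p).aemeasurable),
    ← lintegral_const_mul' _ _ (by finiteness)]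
  refine lintegral_mono fun x => ?_
  rw [← lintegral_const_mul' _ _ (by finiteness)]
  refine lintegral_mono fun y => ?_
  by_cases hxy : |x - y| < δ
  · have hδ0 : ENNReal.ofReal δ ^ (1 + σ * p) ≠ 0 := by simp [hδ]
    rw [mul_left_comm]
    refine le_mul_of_one_le_right' ?_
    rw [← ENNReal.mul_inv_cancel hδ0 (by finiteness), ENNReal.rpow_neg]
    gcongr
    rw [Real.enorm_eq_ofReal_abs]
    exact ENNReal.ofReal_le_ofReal hxy.le
  · simp [nearDiff, hxy, hp]

theorem tendsto_eLpNorm_nearDiff (hp : 0 < p) {ν : Measure (ℝ × ℝ)}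
    (hu : StronglyMeasurable u) {δ : ℕ → ℝ} (hδ : Tendsto δ atTop (𝓝 0))
    (hfin : eLpNorm (fun z : ℝ × ℝ => u z.1 - u z.2) (ENNReal.ofReal p) ν ≠ ⊤) :
    Tendsto (fun n => eLpNorm (nearDiff u (δ n)) (ENNReal.ofReal p) ν) atTop (𝓝 0) := by
  refine tendsto_eLpNorm_zero_of_dominated hp
    (fun n => (stronglyMeasurable_nearDiff hu _).aestronglyMeasurable)
    (g := fun z => ‖u z.1 - u z.2‖ₑ) (by rwa [eLpNorm_enorm])
    (fun n => ae_of_all _ fun z => enorm_indicator_le_enorm_self _ _) (ae_of_all _ fun z => ?_)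
  refine tendsto_const_nhds.congr' ?_
  rcases eq_or_ne z.1 z.2 with hz | hz
  · filter_upwards with n
    simp [nearDiff, indicator, hz]
  · filter_upwards [hδ.eventually_le_const (abs_pos.2 (sub_ne_zero.2 hz))] with n hn
    exact (indicator_of_notMem (by simpa using hn) _).symm

/-- The distances from `u` to the values of `γ` at the two nearest indices, on the grid of mesh `h`
based at `a`. -/
noncomputable def nodeError (a h : ℝ) (u : ℝ → V) (γ : ℤ → V) (x : ℝ) : ℝ≥0 :=
  ‖u x - γ ⌊(x - a) / h⌋‖₊ + ‖u x - γ (⌊(x - a) / h⌋ + 1)‖₊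

theorem stronglyMeasurable_sub_node (hu : StronglyMeasurable u) (γ : ℤ → V) (a h : ℝ) (i : ℤ) :
    StronglyMeasurable fun x => u x - γ (⌊(x - a) / h⌋ + i) :=
  hu.sub (StronglyMeasurable.of_discrete.comp_measurable (by fun_prop))

theorem measurable_nodeError (hu : StronglyMeasurable u) (γ : ℤ → V) :
    Measurable (nodeError a h u γ) := by
  simpa only [add_zero] using! (stronglyMeasurable_sub_node hu γ a h 0).nnnorm.measurable.add
    (stronglyMeasurable_sub_node hu γ a h 1).nnnorm.measurable

theorem exists_nodes_eLpNorm_le (hh : 0 < h) (hσ : 0 ≤ σ) (hp : 1 ≤ p)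
    (hab : b = a + (n + 1 : ℕ) * h) (hu : StronglyMeasurable u)
    (huN : ∀ᵐ x ∂volume.restrict (Ioo a b), u x ∈ N) :
    ∃ γ : ℤ → V, (∀ j, γ j ∈ N) ∧
      eLpNorm (fun x => (nodeError a h u γ x : ℝ≥0∞)) (ENNReal.ofReal p)
          (volume.restrict (Ioo a b)) ≤
        8 * ENNReal.ofReal (2 * h) ^ σ *
          eLpNorm (nearDiff u (2 * h)) (ENNReal.ofReal p) (gagliardoMeasure a b σ p) := by
  have hp0 : 0 < p := by linarith
  have hH : ENNReal.ofReal h ≠ 0 := by simpa using hh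
  set e := eLpNorm (nearDiff u (2 * h)) (ENNReal.ofReal p) (gagliardoMeasure a b σ p) with he
  have hnear := lintegral_nearDiff_le (a := a) (b := b) (σ := σ) (p := p) (δ := 2 * h)
    (by positivity) hp0 (by positivity) hu
  rw [← eLpNorm_ofReal_rpow hp0, ← he] at hnear
  rw [restrict_Ioo_eq_restrict_Ico, hab] at huN hnear ⊢
  obtain ⟨γ, hγN, hγ⟩ := exists_nodes hh hu huN p
  refine ⟨γ, hγN, ?_⟩
  set μ := volume.restrict (Ico a (a + (n + 1 : ℕ) * h))
  have hnode : ∀ i : ℕ, i ≤ 1 → eLpNorm (fun x => u x - γ (⌊(x - a) / h⌋ + i)) (ENNReal.ofReal p) μ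
      ≤ 4 * ENNReal.ofReal (2 * h) ^ σ * e := fun i hi => by
    rw [← ENNReal.rpow_le_rpow_iff hp0, eLpNorm_ofReal_rpow hp0,
      ← ENNReal.mul_le_mul_iff_right hH ENNReal.ofReal_ne_top]
    calc _ ≤ _ := hγ i hi
      _ ≤ 2 * (ENNReal.ofReal (2 * h) ^ (1 + σ * p) * e ^ p) := by gcongr
      _ = ENNReal.ofReal h * (4 * ENNReal.ofReal (2 * h) ^ (σ * p) * e ^ p) := by
        rw [ENNReal.rpow_add _ _ (by simpa using hh) ENNReal.ofReal_ne_top, ENNReal.rpow_one,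
          ENNReal.ofReal_mul zero_le_two, ENNReal.ofReal_ofNat]
        ring
      _ ≤ _ := by
        rw [ENNReal.mul_rpow_of_nonneg _ _ hp0.le, ENNReal.mul_rpow_of_nonneg _ _ hp0.le,
          ← ENNReal.rpow_mul]
        gcongr
        exact ENNReal.le_rpow_self_of_one_le (by norm_num) hp
  calc eLpNorm (fun x => (nodeError a h u γ x : ℝ≥0∞)) (ENNReal.ofReal p) μ
    _ ≤ eLpNorm (fun x => ‖u x - γ (⌊(x - a) / h⌋ + (0 : ℕ))‖ₑ) (ENNReal.ofReal p) μ +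
        eLpNorm (fun x => ‖u x - γ (⌊(x - a) / h⌋ + (1 : ℕ))‖ₑ) (ENNReal.ofReal p) μ := by
      refine le_trans (eLpNorm_mono_enorm fun x => ?_) (eLpNorm_add_le
        (stronglyMeasurable_sub_node hu γ a h _).enorm.aestronglyMeasurable
        (stronglyMeasurable_sub_node hu γ a h _).enorm.aestronglyMeasurable (by simpa using hp))
      simp [nodeError, enorm_eq_nnnorm]
    _ ≤ 4 * ENNReal.ofReal (2 * h) ^ σ * e + 4 * ENNReal.ofReal (2 * h) ^ σ * e := by
      rw [eLpNorm_enorm, eLpNorm_enorm]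
      exact add_le_add (hnode 0 zero_le_one) (hnode 1 le_rfl)
    _ = 8 * ENNReal.ofReal (2 * h) ^ σ * e := by ring

theorem norm_node_sub_node_le (γ : ℤ → V) (x : ℝ) :
    ‖γ ⌊(x - a) / h⌋ - γ (⌊(x - a) / h⌋ + 1)‖ ≤ nodeError a h u γ x := by
  rw [nodeError, NNReal.coe_add, coe_nnnorm, coe_nnnorm, norm_sub_rev (u x)]
  exact norm_sub_le_norm_sub_add_norm_sub _ _ _

theorem IsQuasiconvex.exists_interpolation_nodeError [NormedSpace ℝ V] (hN : IsQuasiconvex N) :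
    ∃ K : ℝ≥0, ∀ (a h : ℝ) (u : ℝ → V) (γ : ℤ → V), 0 < h → (∀ j, γ j ∈ N) →
      ∃ v, ContDiff ℝ ∞ v ∧ (∀ t, v t ∈ N) ∧ (∀ x, ‖u x - v x‖₊ ≤ K * nodeError a h u γ x) ∧
        ∀ x y, ‖(u x - v x) - (u y - v y)‖₊ ≤ ‖nearDiff u (2 * h) (x, y)‖₊ +
          min 1 (h⁻¹.toNNReal * ‖x - y‖₊) *
            (K * nodeError a h u γ x + K * nodeError a h u γ y) := by
  obtain ⟨C, hC, hinterp⟩ := hN.exists_interpolation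
  lift C to ℝ≥0 using hC
  refine ⟨1 + C, fun a h u γ hh hγ => ?_⟩
  obtain ⟨v, hv, hvN, hnear, hlip⟩ := hinterp γ hγ
  set e := nodeError a h u γ with he
  have hgap : ∀ x, C * ‖γ ⌊(x - a) / h⌋ - γ (⌊(x - a) / h⌋ + 1)‖ ≤ C * e x := fun x => by
    gcongr
    exact norm_node_sub_node_le γ x
  have hgap' : ∀ x, C * ‖γ ⌊(x - a) / h⌋ - γ (⌊(x - a) / h⌋ + 1)‖ ≤ (1 + C : ℝ≥0) * e x :=
    fun x => (hgap x).trans (by gcongr; exact le_add_self)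
  have hclose : ∀ x, ‖u x - v ((x - a) / h)‖ ≤ (1 + C : ℝ≥0) * e x := fun x => by
    rw [NNReal.coe_add, NNReal.coe_one, one_add_mul]
    refine (norm_sub_le_norm_sub_add_norm_sub _ (γ ⌊(x - a) / h⌋) _).trans (add_le_add ?_ ?_)
    · simp [he, nodeError]
    · rw [norm_sub_rev]
      exact (hnear _).trans (hgap x)
  refine ⟨fun x => v ((x - a) / h), hv.comp (by fun_prop), fun _ => hvN _,
    fun x => by exact_mod_cast hclose x, fun x y => ?_⟩
  rw [← NNReal.coe_le_coe]
  push_cast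
  rw [Real.coe_toNNReal _ (inv_nonneg.2 hh.le), Real.norm_eq_abs]
  push_cast at hclose hgap'
  rcases lt_or_ge |x - y| h with hxy | hxy
  · have hdiv : |(x - a) / h - (y - a) / h| = h⁻¹ * |x - y| := by
      rw [← sub_div, sub_sub_sub_cancel_right, abs_div, abs_of_pos hh, inv_mul_eq_div]
    have hone : h⁻¹ * |x - y| ≤ 1 := by rw [inv_mul_le_iff₀ hh, mul_one]; exact hxy.le
    rw [nearDiff_of_lt (by linarith), sub_sub_sub_comm, min_eq_right hone, ← hdiv]
    refine (norm_sub_le _ _).trans (add_le_add le_rfl ((hlip _ _ (hdiv.trans_le hone)).trans ?_))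
    exact mul_le_mul_of_nonneg_left (add_le_add (hgap' x) (hgap' y)) (abs_nonneg _)
  · have hone : 1 ≤ h⁻¹ * |x - y| := by rwa [le_inv_mul_iff₀ hh, mul_one]
    rw [min_eq_left hone, one_mul]
    exact (norm_sub_le _ _).trans (le_add_of_nonneg_of_le (norm_nonneg _)
      (add_le_add (hclose x) (hclose y)))

theorem exists_eLpNorm_min_one_mul_add_le (hσ : 0 < σ) (hσ1 : σ < 1) (hp : 1 ≤ p) :
    ∃ C : ℝ≥0, ∀ (a b : ℝ) (c : ℝ≥0) (m : ℝ → ℝ≥0), Measurable m →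
      eLpNorm (fun z : ℝ × ℝ => min 1 (c * ‖z.1 - z.2‖ₑ) * (m z.1 + m z.2)) (ENNReal.ofReal p)
        (gagliardoMeasure a b σ p) ≤
      C * (c : ℝ≥0∞) ^ σ * eLpNorm (fun y => (m y : ℝ≥0∞)) (ENNReal.ofReal p)
        (volume.restrict (Ioo a b)) := by
  obtain ⟨C, hC⟩ := exists_eLpNorm_min_one_mul_le hσ hσ1 (p := p) (by linarith)
  refine ⟨2 * C, fun a b c m hm => ?_⟩
  set F : ℝ × ℝ → ℝ≥0∞ := fun z => min 1 (c * ‖z.1 - z.2‖ₑ) * m z.2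
  have hF : Measurable F := by fun_prop
  have hswap : eLpNorm (F ∘ Prod.swap) (ENNReal.ofReal p) (gagliardoMeasure a b σ p) =
      eLpNorm F (ENNReal.ofReal p) (gagliardoMeasure a b σ p) :=
    eLpNorm_comp_measurePreserving hF.aestronglyMeasurable measurePreserving_swap_gagliardoMeasure
  have hle : eLpNorm F (ENNReal.ofReal p) (gagliardoMeasure a b σ p) ≤ C * ((c : ℝ≥0∞) ^ σ *
      eLpNorm (fun y => (m y : ℝ≥0∞)) (ENNReal.ofReal p) (volume.restrict (Ioo a b))) := by
    refine (hC a b (fun _ => c) m measurable_const hm).trans ?_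
    gcongr
    refine eLpNorm_le_mul_eLpNorm_of_ae_le_mul'' _ (by fun_prop) (ae_of_all _ fun x => ?_)
    simp
  calc _ = eLpNorm (F ∘ Prod.swap + F) (ENNReal.ofReal p) (gagliardoMeasure a b σ p) := by
        congr 1
        ext z
        simp [F, mul_add, enorm_sub_rev z.1]
    _ ≤ _ := eLpNorm_add_le (hF.comp measurable_swap).aestronglyMeasurable
      hF.aestronglyMeasurable (by simpa using hp)
    _ ≤ C * ((c : ℝ≥0∞) ^ σ * _) + C * ((c : ℝ≥0∞) ^ σ * _) :=
      add_le_add (hswap.trans_le hle) hle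
    _ = _ := by push_cast; ring

theorem toNNReal_inv_rpow_mul_le (hh : 0 < h) (hσ : 0 ≤ σ) (hσ1 : σ ≤ 1) :
    (h⁻¹.toNNReal : ℝ≥0∞) ^ σ * ENNReal.ofReal (2 * h) ^ σ ≤ 2 := by
  have htwo : h⁻¹ * (2 * h) = 2 := by field_simp
  rw [← ENNReal.mul_rpow_of_nonneg _ _ hσ, ← ENNReal.ofReal, ← ENNReal.ofReal_mul (by positivity),
    htwo, ENNReal.ofReal_ofNat]
  exact (ENNReal.rpow_le_rpow_of_exponent_le one_le_two hσ1).trans_eq (ENNReal.rpow_one _)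

theorem IsQuasiconvex.exists_eLpNorm_sub_le [NormedSpace ℝ V] (hN : IsQuasiconvex N)
    (hσ : 0 < σ) (hσ1 : σ < 1) (hp : 1 ≤ p) :
    ∃ K : ℝ≥0, ∀ (a b h : ℝ) (n : ℕ) (u : ℝ → V), 0 < h → b = a + (n + 1 : ℕ) * h →
      StronglyMeasurable u → (∀ᵐ x ∂volume.restrict (Ioo a b), u x ∈ N) →
      ∃ v, ContDiff ℝ ∞ v ∧ (∀ t, v t ∈ N) ∧
        eLpNorm (fun x => u x - v x) (ENNReal.ofReal p) (volume.restrict (Ioo a b)) ≤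
          K * ENNReal.ofReal (2 * h) ^ σ *
            eLpNorm (nearDiff u (2 * h)) (ENNReal.ofReal p) (gagliardoMeasure a b σ p) ∧
        eLpNorm (fun z : ℝ × ℝ => (u z.1 - v z.1) - (u z.2 - v z.2)) (ENNReal.ofReal p)
            (gagliardoMeasure a b σ p) ≤
          K * eLpNorm (nearDiff u (2 * h)) (ENNReal.ofReal p) (gagliardoMeasure a b σ p) := by
  obtain ⟨K, hK⟩ := hN.exists_interpolation_nodeError
  obtain ⟨C, hC⟩ := exists_eLpNorm_min_one_mul_add_le hσ hσ1 hp
  refine ⟨1 + 16 * C * K + 8 * K, fun a b h n u hh hb hu huN => ?_⟩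
  obtain ⟨γ, hγN, hγ⟩ := exists_nodes_eLpNorm_le hh hσ.le hp hb hu huN
  obtain ⟨v, hv, hvN, hclose, hdiff⟩ := hK a h u γ hh hγN
  set e := eLpNorm (nearDiff u (2 * h)) (ENNReal.ofReal p) (gagliardoMeasure a b σ p)
  set m : ℝ → ℝ≥0 := fun x => K * nodeError a h u γ x with hm
  have hmm : Measurable m := (measurable_nodeError hu γ).const_mul K
  have hme : eLpNorm (fun x => (m x : ℝ≥0∞)) (ENNReal.ofReal p) (volume.restrict (Ioo a b)) ≤
      8 * K * ENNReal.ofReal (2 * h) ^ σ * e := by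
    refine (eLpNorm_le_mul_eLpNorm_of_ae_le_mul'' (c := K) _
      (measurable_nodeError hu γ).coe_nnreal_ennreal.aestronglyMeasurable
      (ae_of_all _ fun x => ?_)).trans ((mul_le_mul_right hγ _).trans_eq (by ring))
    simp [hm]
  refine ⟨v, hv, hvN, ?_, ?_⟩
  · refine (eLpNorm_mono_enorm fun x => ?_).trans (hme.trans ?_)
    · rw [enorm_eq_nnnorm, enorm_eq_self]
      exact_mod_cast hclose x
    · gcongr
      push_cast
      exact le_add_self
  · have hdiff' : ∀ x y, ‖(u x - v x) - (u y - v y)‖ₑ ≤ ‖nearDiff u (2 * h) (x, y)‖ₑ +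
        min 1 (h⁻¹.toNNReal * ‖x - y‖ₑ) * (m x + m y) := by
      simp only [enorm_eq_nnnorm]
      exact fun x y => by exact_mod_cast hdiff x y
    calc _ ≤ eLpNorm (fun z => ‖nearDiff u (2 * h) z‖ₑ +
          min 1 (h⁻¹.toNNReal * ‖z.1 - z.2‖ₑ) * (m z.1 + m z.2)) (ENNReal.ofReal p)
            (gagliardoMeasure a b σ p) := eLpNorm_mono_enorm fun z => hdiff' z.1 z.2
      _ ≤ e + C * (h⁻¹.toNNReal : ℝ≥0∞) ^ σ * (8 * K * ENNReal.ofReal (2 * h) ^ σ * e) := by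
        refine (eLpNorm_add_le (stronglyMeasurable_nearDiff hu _).enorm.aestronglyMeasurable
          (Measurable.aestronglyMeasurable (by fun_prop)) (by simpa using hp)).trans ?_
        rw [eLpNorm_enorm]
        gcongr
        exact (hC a b _ m hmm).trans (by gcongr)
      _ = (1 + 8 * C * K *
          ((h⁻¹.toNNReal : ℝ≥0∞) ^ σ * ENNReal.ofReal (2 * h) ^ σ)) * e := by ring
      _ ≤ (1 + 8 * C * K * 2 + 8 * K) * e :=
        mul_le_mul_left (le_add_right (add_le_add le_rfl (mul_le_mul_right
          (toNNReal_inv_rpow_mul_le hh hσ.le hσ1.le) _))) e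
      _ = _ := by push_cast; ring

theorem IsQuasiconvex.exists_gagliardo_sub_lt [NormedSpace ℝ V] (hN : IsQuasiconvex N)
    (hab : a < b) (hσ : 0 < σ) (hσ1 : σ < 1) (hp : 1 ≤ p) (hu : StronglyMeasurable u)
    (huN : ∀ᵐ x ∂volume.restrict (Ioo a b), u x ∈ N) (hfin : gagliardo a b σ p u ≠ ⊤) {ε : ℝ≥0∞}
    (hε : 0 < ε) :
    ∃ v, ContDiff ℝ ∞ v ∧ (∀ t, v t ∈ N) ∧
      eLpNorm (u - v) (ENNReal.ofReal p) (volume.restrict (Ioo a b)) < ε ∧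
      gagliardo a b σ p (u - v) < ε := by
  have hp0 : 0 < p := by linarith
  obtain ⟨K, hK⟩ := hN.exists_eLpNorm_sub_le hσ hσ1 hp
  rw [gagliardo_eq_eLpNorm hσ.le hp0 hu.aestronglyMeasurable] at hfin
  set h : ℕ → ℝ := fun n => (b - a) / (n + 1 : ℕ)
  have hh : ∀ n, 0 < h n := fun n => div_pos (sub_pos.2 hab) (by positivity)
  have hlim : Tendsto (fun n => 2 * h n) atTop (𝓝 0) := by
    simpa [h] using (((tendsto_const_div_atTop_nhds_zero_nat (b - a)).comp
      (tendsto_add_atTop_nat 1)).const_mul 2)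
  have hnear := ENNReal.Tendsto.const_mul (tendsto_eLpNorm_nearDiff hp0 hu hlim hfin)
    (Or.inr (ENNReal.coe_ne_top (r := K)))
  have hpow : Tendsto (fun n => ENNReal.ofReal (2 * h n) ^ σ) atTop (𝓝 0) := by
    simpa [hσ] using (ENNReal.tendsto_ofReal hlim).ennrpow_const σ
  rw [mul_zero] at hnear
  have hprod := ENNReal.Tendsto.mul hpow (Or.inr ENNReal.zero_ne_top) hnear
    (Or.inr ENNReal.zero_ne_top)
  rw [mul_zero] at hprod
  obtain ⟨n, hn, hn'⟩ := ((hnear.eventually_lt_const hε).and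
    (hprod.eventually_lt_const (by simpa using hε))).exists
  obtain ⟨v, hv, hvN, hle, hle'⟩ := hK a b (h n) n u (hh n) (by simp only [h]; field_simp; ring)
    hu huN
  refine ⟨v, hv, hvN, hle.trans_lt ?_, ?_⟩
  · rwa [mul_comm (K : ℝ≥0∞), mul_assoc]
  · rw [gagliardo_eq_eLpNorm hσ.le hp0
      (hu.sub hv.continuous.stronglyMeasurable).aestronglyMeasurable]
    exact hle'.trans_lt hn

end Density

section WeakDerivatives

/-- `φ` is a test function on `(a, b)`, as quantified over in `IsWeakDeriv`: smooth, with compact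
support contained in `(a, b)`. -/
structure IsTest (a b : ℝ) (φ : ℝ → ℝ) : Prop where
  contDiff : ContDiff ℝ ∞ φ
  hasCompactSupport : HasCompactSupport φ
  tsupport_subset : tsupport φ ⊆ Ioo a b

variable {a b : ℝ} {φ ψ : ℝ → ℝ} {E : Type*} [NormedAddCommGroup E] [NormedSpace ℝ E]

theorem contDiff_iteratedDeriv {f : ℝ → E} (hf : ContDiff ℝ ∞ f) (j : ℕ) :
    ContDiff ℝ ∞ (iteratedDeriv j f) := by
  rw [iteratedDeriv_eq_iterate]
  exact hf.iterate_deriv j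

theorem hasDerivAt_iteratedDeriv {f : ℝ → E} (hf : ContDiff ℝ ∞ f) (j : ℕ) (x : ℝ) :
    HasDerivAt (iteratedDeriv j f) (iteratedDeriv (j + 1) f x) x := by
  rw [iteratedDeriv_succ]
  exact ((contDiff_iteratedDeriv hf j).differentiable (by simp)).differentiableAt.hasDerivAt

theorem IsTest.deriv (h : IsTest a b φ) : IsTest a b (deriv φ) :=
  ⟨(contDiff_infty_iff_deriv.1 h.contDiff).2, h.hasCompactSupport.deriv,
    tsupport_deriv_subset.trans h.tsupport_subset⟩

theorem IsTest.iteratedDeriv (h : IsTest a b φ) (j : ℕ) : IsTest a b (iteratedDeriv j φ) := by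
  induction j with
  | zero => simpa using h
  | succ j ih => rw [iteratedDeriv_succ]; exact ih.deriv

theorem IsTest.eq_zero (h : IsTest a b φ) {x : ℝ} (hx : x ∉ Ioo a b) : φ x = 0 :=
  image_eq_zero_of_notMem_tsupport fun hx' => hx (h.tsupport_subset hx')

theorem IsTest.integrable_smul (h : IsTest a b φ) {f : ℝ → E}
    (hf : LocallyIntegrableOn f (Ioo a b)) : Integrable fun x => φ x • f x := by
  have h1 : IntegrableOn f (tsupport φ) :=
    hf.integrableOn_compact_subset h.tsupport_subset h.hasCompactSupport
  have h2 : IntegrableOn (fun x => φ x • f x) (tsupport φ) :=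
    h1.continuousOn_smul h.contDiff.continuous.continuousOn h.hasCompactSupport
  refine (integrableOn_iff_integrable_of_support_subset ?_).1 h2
  intro x hx
  apply subset_tsupport
  intro h0
  exact hx (by simp [h0])

theorem IsTest.setIntegral_smul (h : IsTest a b φ) (f : ℝ → E) :
    ∫ x in Ioo a b, φ x • f x = ∫ x, φ x • f x :=
  setIntegral_eq_integral_of_forall_compl_eq_zero fun x hx => by simp [h.eq_zero hx]

theorem IsTest.integral_deriv_smul (h : IsTest a b φ) {g g' : ℝ → E}
    (hg : ∀ x ∈ Ioo a b, HasDerivAt g (g' x) x) (hg' : LocallyIntegrableOn g' (Ioo a b)) :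
    ∫ x in Ioo a b, _root_.deriv φ x • g x = -∫ x in Ioo a b, φ x • g' x := by
  have hgc : LocallyIntegrableOn g (Ioo a b) :=
    ContinuousOn.locallyIntegrableOn (fun x hx => (hg x hx).continuousAt.continuousWithinAt)
      measurableSet_Ioo
  have hd : ∀ x, HasDerivAt (fun x => φ x • g x) (φ x • g' x + _root_.deriv φ x • g x) x := by
    intro x
    by_cases hx : x ∈ Ioo a b
    · exact ((h.contDiff.differentiable (by simp)).differentiableAt.hasDerivAt).smul (hg x hx)
    · rw [h.eq_zero hx, h.deriv.eq_zero hx]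
      have h0 := notMem_tsupport_iff_eventuallyEq.1 fun h' => hx (h.tsupport_subset h')
      simp only [zero_smul, add_zero]
      refine (hasDerivAt_const x (0 : E)).congr_of_eventuallyEq ?_
      filter_upwards [h0] with y hy
      simp [hy]
  have hz := integral_eq_zero_of_hasDerivAt_of_integrable hd
    ((h.integrable_smul hg').add (h.deriv.integrable_smul hgc)) (h.integrable_smul hgc)
  rw [integral_add (h.integrable_smul hg') (h.deriv.integrable_smul hgc)] at hz
  rw [h.deriv.setIntegral_smul, h.setIntegral_smul]
  exact eq_neg_of_add_eq_zero_right hz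

variable {u g g' w : ℝ → E} {j : ℕ}

theorem IsWeakDeriv.integral_eq_of_isTest (h : IsWeakDeriv a b j u g) (hφ : IsTest a b φ) :
    ∫ x in Ioo a b, _root_.iteratedDeriv j φ x • u x = (-1 : ℝ) ^ j • ∫ x in Ioo a b, φ x • g x :=
  h.integral_eq φ hφ.contDiff hφ.hasCompactSupport hφ.tsupport_subset

theorem isWeakDeriv_zero (hu : LocallyIntegrableOn u (Ioo a b)) : IsWeakDeriv a b 0 u u :=
  ⟨hu, hu, fun φ _ _ _ => by simp⟩

theorem IsWeakDeriv.congr_ae {u' : ℝ → E} (h : IsWeakDeriv a b j u g)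
    (hu : u =ᵐ[volume.restrict (Ioo a b)] u') (hg : g =ᵐ[volume.restrict (Ioo a b)] g') :
    IsWeakDeriv a b j u' g' := by
  have key : ∀ {f f' : ℝ → E}, LocallyIntegrableOn f (Ioo a b) →
      f =ᵐ[volume.restrict (Ioo a b)] f' → LocallyIntegrableOn f' (Ioo a b) := by
    intro f f' hf hff' x hx
    obtain ⟨t, ht, hft⟩ := hf x hx
    refine ⟨t ∩ Ioo a b, inter_mem ht self_mem_nhdsWithin, ?_⟩
    refine (hft.mono_set inter_subset_left).congr ?_
    exact ae_mono (Measure.restrict_mono inter_subset_right le_rfl) hff'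
  refine ⟨key h.1 hu, key h.2 hg, fun φ h1 h2 h3 => ?_⟩
  have e1 : ∫ x in Ioo a b, _root_.iteratedDeriv j φ x • u' x =
      ∫ x in Ioo a b, _root_.iteratedDeriv j φ x • u x :=
    integral_congr_ae (by filter_upwards [hu] with x hx; rw [hx])
  have e2 : ∫ x in Ioo a b, φ x • g' x = ∫ x in Ioo a b, φ x • g x :=
    integral_congr_ae (by filter_upwards [hg] with x hx; rw [hx])
  rw [e1, e2]
  exact h.integral_eq φ h1 h2 h3

theorem IsWeakDeriv.sub {u' : ℝ → E} (h : IsWeakDeriv a b j u g) (h' : IsWeakDeriv a b j u' g') :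
    IsWeakDeriv a b j (u - u') (g - g') := by
  refine ⟨h.1.sub h'.1, h.2.sub h'.2, fun φ h1 h2 h3 => ?_⟩
  have hφ : IsTest a b φ := ⟨h1, h2, h3⟩
  simp only [Pi.sub_apply, smul_sub]
  rw [integral_sub ((hφ.iteratedDeriv j).integrable_smul h.1).integrableOn
    ((hφ.iteratedDeriv j).integrable_smul h'.1).integrableOn,
    integral_sub (hφ.integrable_smul h.2).integrableOn (hφ.integrable_smul h'.2).integrableOn,
    h.integral_eq_of_isTest hφ, h'.integral_eq_of_isTest hφ, smul_sub]

theorem IsWeakDeriv.succ_of_hasDerivAt (h : IsWeakDeriv a b j u g)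
    (hg : ∀ x ∈ Ioo a b, HasDerivAt g (g' x) x) (hg' : LocallyIntegrableOn g' (Ioo a b)) :
    IsWeakDeriv a b (j + 1) u g' := by
  refine ⟨h.1, hg', fun φ h1 h2 h3 => ?_⟩
  have hφ : IsTest a b φ := ⟨h1, h2, h3⟩
  rw [iteratedDeriv_succ', h.integral_eq_of_isTest hφ.deriv, hφ.integral_deriv_smul hg hg',
    pow_succ, smul_neg, mul_neg, mul_one, neg_smul]

theorem IsWeakDeriv.shift {i : ℕ} (h : IsWeakDeriv a b j u g) (h' : IsWeakDeriv a b (j + i) u g') :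
    IsWeakDeriv a b i g g' := by
  refine ⟨h.2, h'.2, fun φ h1 h2 h3 => ?_⟩
  have hφ : IsTest a b φ := ⟨h1, h2, h3⟩
  have e := h.integral_eq_of_isTest (hφ.iteratedDeriv i)
  rw [iteratedDeriv_eq_iterate, iteratedDeriv_eq_iterate, ← Function.iterate_add_apply,
    ← iteratedDeriv_eq_iterate, h'.integral_eq_of_isTest hφ, pow_add, mul_smul,
    ← iteratedDeriv_eq_iterate] at e
  exact (smul_right_injective E (pow_ne_zero j (by norm_num : (-1 : ℝ) ≠ 0)) e).symm

theorem isWeakDeriv_of_contDiffOn (hab : a < b) {v : ℝ → E} (hv : ContDiffOn ℝ ∞ v (Icc a b))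
    (j : ℕ) : IsWeakDeriv a b j v (iteratedDerivWithin j v (Icc a b)) := by
  have hU := uniqueDiffOn_Icc hab
  have hli : ∀ j, LocallyIntegrableOn (iteratedDerivWithin j v (Icc a b)) (Ioo a b) := fun j =>
    ((hv.continuousOn_iteratedDerivWithin (by exact_mod_cast le_top) hU).mono
      Ioo_subset_Icc_self).locallyIntegrableOn measurableSet_Ioo
  induction j with
  | zero => simpa using isWeakDeriv_zero (by simpa using hli 0)
  | succ j ih =>
    refine ih.succ_of_hasDerivAt (fun x hx => ?_) (hli (j + 1))
    have hn : Icc a b ∈ 𝓝 x := Icc_mem_nhds hx.1 hx.2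
    have := (hv.differentiableOn_iteratedDerivWithin (m := j)
      (by exact_mod_cast ENat.natCast_lt_top j) hU x (Ioo_subset_Icc_self hx)).hasDerivWithinAt
    rw [iteratedDerivWithin_succ]
    exact this.hasDerivAt hn

theorem isWeakDeriv_of_contDiff {v : ℝ → E} (hv : ContDiff ℝ ∞ v) (j : ℕ) :
    IsWeakDeriv a b j v (iteratedDeriv j v) := by
  have hli : ∀ j, LocallyIntegrableOn (iteratedDeriv j v) (Ioo a b) := fun j =>
    (contDiff_iteratedDeriv hv j).continuous.continuousOn.locallyIntegrableOn measurableSet_Ioo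
  induction j with
  | zero => simpa using isWeakDeriv_zero (by simpa using hli 0)
  | succ j ih =>
    exact ih.succ_of_hasDerivAt (fun x _ => hasDerivAt_iteratedDeriv hv j x) (hli (j + 1))

theorem IsTest.tendsto_integral_smul (hφ : IsTest a b φ) {un : ℕ → ℝ → E}
    (hun : ∀ n, LocallyIntegrableOn (un n) (Ioo a b)) (hu : LocallyIntegrableOn u (Ioo a b))
    (hlim : Tendsto (fun n => ∫⁻ x in Ioo a b, ‖un n x - u x‖ₑ) atTop (𝓝 0)) :
    Tendsto (fun n => ∫ x in Ioo a b, φ x • un n x) atTop (𝓝 (∫ x in Ioo a b, φ x • u x)) := by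
  obtain ⟨B, hB⟩ := hφ.contDiff.continuous.bounded_above_of_compact_support hφ.hasCompactSupport
  refine tendsto_integral_of_L1 _ (hφ.integrable_smul hu).integrableOn.1
    (Eventually.of_forall fun n => (hφ.integrable_smul (hun n)).integrableOn) ?_
  have h0 : Tendsto (fun n => ENNReal.ofReal B * ∫⁻ x in Ioo a b, ‖un n x - u x‖ₑ) atTop (𝓝 0) := by
    simpa using ENNReal.Tendsto.const_mul hlim (Or.inr ENNReal.ofReal_ne_top)
  refine tendsto_of_tendsto_of_tendsto_of_le_of_le tendsto_const_nhds h0 (fun n => zero_le)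
    fun n => ?_
  simp only
  rw [← lintegral_const_mul' _ _ ENNReal.ofReal_ne_top]
  refine lintegral_mono fun x => ?_
  rw [← smul_sub, enorm_smul]
  gcongr
  rw [← ofReal_norm]
  exact ENNReal.ofReal_le_ofReal (hB x)

theorem IsWeakDeriv.of_tendsto {un gn : ℕ → ℝ → E} (h : ∀ n, IsWeakDeriv a b j (un n) (gn n))
    (hu : LocallyIntegrableOn u (Ioo a b)) (hg : LocallyIntegrableOn g (Ioo a b))
    (hulim : Tendsto (fun n => ∫⁻ x in Ioo a b, ‖un n x - u x‖ₑ) atTop (𝓝 0))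
    (hglim : Tendsto (fun n => ∫⁻ x in Ioo a b, ‖gn n x - g x‖ₑ) atTop (𝓝 0)) :
    IsWeakDeriv a b j u g := by
  refine ⟨hu, hg, fun φ h1 h2 h3 => ?_⟩
  have hφ : IsTest a b φ := ⟨h1, h2, h3⟩
  refine tendsto_nhds_unique
    ((hφ.iteratedDeriv j).tendsto_integral_smul (fun n => (h n).1) hu hulim) ?_
  have := (hφ.tendsto_integral_smul (fun n => (h n).2) hg hglim).const_smul ((-1 : ℝ) ^ j)
  refine this.congr fun n => ?_
  exact ((h n).integral_eq_of_isTest hφ).symm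

theorem exists_Icc_of_isCompact {K : Set ℝ} (hK : IsCompact K) (hab : a < b) (hKab : K ⊆ Ioo a b) :
    ∃ α β, a < α ∧ β < b ∧ K ⊆ Icc α β := by
  rcases K.eq_empty_or_nonempty with rfl | hne
  · exact ⟨b, a, hab, hab, empty_subset _⟩
  · exact ⟨sInf K, sSup K, (hKab (hK.sInf_mem hne)).1, (hKab (hK.sSup_mem hne)).2,
      fun x hx => ⟨csInf_le hK.bddBelow hx, le_csSup hK.bddAbove hx⟩⟩

theorem hasDerivAt_primitive [CompleteSpace E] {f : ℝ → E} (hf : Continuous f) (a x : ℝ) :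
    HasDerivAt (fun y => ∫ t in a..y, f t) (f x) x :=
  intervalIntegral.integral_hasDerivAt_right (hf.intervalIntegrable _ _)
    (hf.stronglyMeasurableAtFilter _ _) hf.continuousAt

theorem support_primitive_subset {α β : ℝ} (haα : a < α) (hφ : Function.support φ ⊆ Icc α β)
    (h0 : ∫ x, φ x = 0) : Function.support (fun x => ∫ t in a..x, φ t) ⊆ Icc α β := by
  intro x hx
  by_contra hxI
  refine hx ?_
  rw [mem_Icc, not_and_or, not_le, not_le] at hxI
  rcases hxI with hxα | hβx
  · refine (intervalIntegral.integral_congr (g := fun _ => 0) fun t ht => ?_).trans (by simp)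
    have htα : t < α := ht.2.trans_lt (max_lt haα hxα)
    exact Function.notMem_support.1 fun ht' => htα.not_ge (hφ ht').1
  · refine (intervalIntegral.integral_eq_integral_of_support_subset fun t ht => ?_).trans h0
    exact ⟨haα.trans_le (hφ ht).1, (hφ ht).2.trans hβx.le⟩

theorem IsTest.exists_primitive (h : IsTest a b φ) (hab : a < b) (h0 : ∫ x, φ x = 0) :
    ∃ Φ, IsTest a b Φ ∧ _root_.deriv Φ = φ := by
  obtain ⟨α, β, haα, hβb, hK⟩ := exists_Icc_of_isCompact h.hasCompactSupport hab h.tsupport_subset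
  have hd := hasDerivAt_primitive h.contDiff.continuous a
  have hder : (_root_.deriv fun x => ∫ t in a..x, φ t) = φ := funext fun x => (hd x).deriv
  have hsupp := support_primitive_subset haα ((subset_tsupport φ).trans hK) h0
  refine ⟨fun x => ∫ t in a..x, φ t, ⟨?_, ?_, ?_⟩, hder⟩
  · rw [contDiff_infty_iff_deriv, hder]
    exact ⟨fun x => (hd x).differentiableAt, h.contDiff⟩
  · exact HasCompactSupport.of_support_subset_isCompact isCompact_Icc hsupp
  · exact (closure_minimal hsupp isClosed_Icc).trans (Icc_subset_Ioo haα hβb)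

theorem exists_isTest_integral_eq_one (hab : a < b) : ∃ φ, IsTest a b φ ∧ ∫ x, φ x = 1 := by
  obtain ⟨f, hfs, hfc, hf, hfr, hf1⟩ := exists_contDiff_tsupport_subset (n := ⊤)
    (Ioo_mem_nhds (show a < (a + b) / 2 by linarith) (show (a + b) / 2 < b by linarith))
  have hpos : 0 < ∫ x, f x := by
    refine hf.continuous.integral_pos_of_hasCompactSupport_nonneg_nonzero hfc
      (fun x => (hfr ⟨x, rfl⟩).1) (x := (a + b) / 2) ?_
    simp [hf1]
  refine ⟨fun x => (∫ x, f x)⁻¹ * f x, ⟨contDiff_const.mul hf, hfc.mul_left, ?_⟩, ?_⟩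
  · exact (closure_mono (Function.support_mul_subset_right _ _)).trans hfs
  · rw [integral_const_mul, inv_mul_cancel₀ hpos.ne']

theorem IsWeakDeriv.integral_smul_eq_zero (h : IsWeakDeriv a b 1 u 0) (hab : a < b)
    (hφ : IsTest a b φ) (h0 : ∫ x, φ x = 0) : ∫ x, φ x • u x = 0 := by
  obtain ⟨Φ, hΦ, rfl⟩ := hφ.exists_primitive hab h0
  simpa [hφ.setIntegral_smul] using h.integral_eq_of_isTest hΦ

theorem IsWeakDeriv.exists_const [CompleteSpace E] (hab : a < b) (h : IsWeakDeriv a b 1 u 0) :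
    ∃ c : E, u =ᵐ[volume.restrict (Ioo a b)] fun _ => c := by
  obtain ⟨η, hη, hη1⟩ := exists_isTest_integral_eq_one hab
  refine ⟨∫ x, η x • u x, (isWeakDeriv_zero h.1).ae_eq ⟨h.1,
    continuousOn_const.locallyIntegrableOn measurableSet_Ioo, fun ψ h1 h2 h3 => ?_⟩⟩
  have hψ : IsTest a b ψ := ⟨h1, h2, h3⟩
  have hiψ : Integrable ψ := h1.continuous.integrable_of_hasCompactSupport h2
  have hiη : Integrable η := hη.contDiff.continuous.integrable_of_hasCompactSupport hη.2
  have hφ : IsTest a b fun x => ψ x - (∫ x, ψ x) * η x :=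
    ⟨h1.sub (contDiff_const.mul hη.1), h2.sub hη.2.mul_left, (tsupport_sub _ _).trans
      (union_subset h3 ((closure_mono (Function.support_mul_subset_right _ _)).trans hη.3))⟩
  have e := h.integral_smul_eq_zero hab hφ (by
    rw [integral_sub hiψ (hiη.const_mul _), integral_const_mul, hη1, mul_one, sub_self])
  simp only [sub_smul, mul_smul] at e
  have hiηu : Integrable fun x => (∫ x, ψ x) • η x • u x := (hη.integrable_smul h.1).smul _
  rw [integral_sub (hψ.integrable_smul h.1) hiηu, integral_smul, sub_eq_zero] at e
  rw [iteratedDeriv_zero, hψ.setIntegral_smul, hψ.setIntegral_smul, e, integral_smul_const,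
    pow_zero, one_smul]

end WeakDerivatives

section Primitives

variable {a b : ℝ} {E : Type*} [NormedAddCommGroup E] {f g u : ℝ → E}

theorem intervalIntegrable_of_integrableOn_Ioo (hf : IntegrableOn f (Ioo a b)) {x : ℝ}
    (hx : x ∈ Icc a b) : IntervalIntegrable f volume a x := by
  rw [intervalIntegrable_iff_integrableOn_Ioc_of_le hx.1, integrableOn_Ioc_iff_integrableOn_Ioo]
  exact hf.mono_set (Ioo_subset_Ioo_right hx.2)

variable [NormedSpace ℝ E]

theorem enorm_primitive_sub_le (hf : IntegrableOn f (Ioo a b)) (hg : IntegrableOn g (Ioo a b))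
    {x : ℝ} (hx : x ∈ Icc a b) :
    ‖(∫ t in a..x, f t) - ∫ t in a..x, g t‖ₑ ≤ ∫⁻ t in Ioo a b, ‖f t - g t‖ₑ := by
  rw [← intervalIntegral.integral_sub (intervalIntegrable_of_integrableOn_Ioo hf hx)
    (intervalIntegrable_of_integrableOn_Ioo hg hx), intervalIntegral.integral_of_le hx.1,
    ← restrict_Ioo_eq_restrict_Ioc]
  exact (enorm_integral_le_lintegral_enorm _).trans
    (lintegral_mono_set (Ioo_subset_Ioo_right hx.2))

theorem continuousOn_primitive (hf : IntegrableOn f (Ioo a b)) :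
    ContinuousOn (fun x => ∫ t in a..x, f t) (Icc a b) := by
  rcases le_or_gt a b with hab | hab
  · rw [← uIcc_of_le hab]
    refine intervalIntegral.continuousOn_primitive_interval ?_
    rwa [uIcc_of_le hab, integrableOn_Icc_iff_integrableOn_Ioo]
  · simp [Icc_eq_empty hab.not_ge]

theorem tendsto_lintegral_enorm_primitive_sub {w : ℕ → ℝ → E}
    (hw : ∀ n, IntegrableOn (w n) (Ioo a b)) (hg : IntegrableOn g (Ioo a b))
    (hlim : Tendsto (fun n => ∫⁻ x in Ioo a b, ‖w n x - g x‖ₑ) atTop (𝓝 0)) :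
    Tendsto (fun n => ∫⁻ x in Ioo a b, ‖(∫ t in a..x, w n t) - ∫ t in a..x, g t‖ₑ) atTop
      (𝓝 0) := by
  have h0 := ENNReal.Tendsto.mul_const (b := volume (Ioo a b)) hlim (Or.inr (by simp))
  rw [zero_mul] at h0
  refine tendsto_of_tendsto_of_tendsto_of_le_of_le tendsto_const_nhds h0 (fun n => zero_le)
    fun n => ?_
  simp only
  rw [← setLIntegral_const]
  exact setLIntegral_mono measurable_const fun x hx =>
    enorm_primitive_sub_le (hw n) hg (Ioo_subset_Icc_self hx)

theorem exists_contDiff_tendsto_lintegral_enorm_sub {s : Set ℝ} (hg : IntegrableOn g s) :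
    ∃ w : ℕ → ℝ → E, (∀ n, ContDiff ℝ ∞ (w n)) ∧ (∀ n, IntegrableOn (w n) s) ∧
      Tendsto (fun n => ∫⁻ x in s, ‖w n x - g x‖ₑ) atTop (𝓝 0) := by
  choose w hwc hw hle using fun n : ℕ =>
    (memLp_one_iff_integrable.2 hg).exist_eLpNorm_sub_le ENNReal.one_ne_top le_rfl
      (ε := 1 / ((n : ℝ) + 1)) (by positivity)
  refine ⟨w, hw, fun n => ((hw n).continuous.integrable_of_hasCompactSupport
    (hwc n)).integrableOn, ?_⟩
  have h0 : Tendsto (fun n : ℕ => ENNReal.ofReal (1 / ((n : ℝ) + 1))) atTop (𝓝 0) := by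
    simpa using ENNReal.tendsto_ofReal tendsto_one_div_add_atTop_nhds_zero_nat
  refine tendsto_of_tendsto_of_tendsto_of_le_of_le tendsto_const_nhds h0 (fun n => zero_le)
    fun n => ?_
  simpa [eLpNorm_one_eq_lintegral_enorm, enorm_sub_rev] using hle n

theorem isWeakDeriv_primitive [CompleteSpace E] (hg : IntegrableOn g (Ioo a b)) :
    IsWeakDeriv a b 1 (fun x => ∫ t in a..x, g t) g := by
  obtain ⟨w, hw, hwi, hlim⟩ := exists_contDiff_tendsto_lintegral_enorm_sub hg
  have hloc : ∀ {f : ℝ → E}, IntegrableOn f (Ioo a b) →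
      LocallyIntegrableOn (fun x => ∫ t in a..x, f t) (Ioo a b) := fun hf =>
    ((continuousOn_primitive hf).mono Ioo_subset_Icc_self).locallyIntegrableOn measurableSet_Ioo
  exact IsWeakDeriv.of_tendsto
    (fun n => (isWeakDeriv_zero (hloc (hwi n))).succ_of_hasDerivAt
      (fun x _ => hasDerivAt_primitive (hw n).continuous a x) (hwi n).locallyIntegrableOn)
    (hloc hg) hg.locallyIntegrableOn (tendsto_lintegral_enorm_primitive_sub hwi hg hlim) hlim

theorem IsWeakDeriv.exists_eq_primitive [CompleteSpace E] (h : IsWeakDeriv a b 1 u g)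
    (hg : IntegrableOn g (Ioo a b)) (hab : a < b) :
    ∃ c : E, u =ᵐ[volume.restrict (Ioo a b)] fun x => c + ∫ t in a..x, g t := by
  have h1 := h.sub (isWeakDeriv_primitive hg)
  rw [sub_self] at h1
  obtain ⟨c, hc⟩ := h1.exists_const hab
  refine ⟨c, hc.mono fun x hx => ?_⟩
  exact sub_eq_iff_eq_add.1 hx

end Primitives

section IteratedPrimitives

variable {a b : ℝ} {E : Type*} [NormedAddCommGroup E] [NormedSpace ℝ E] {f g u : ℝ → E}
  {c : ℕ → E}

/-- The `r`-fold iterated primitive of `f` with base point `a`, where the constant of integration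
of the `(i + 1)`-st primitive is `c i`. -/
noncomputable def iterPrimitive (a : ℝ) (c : ℕ → E) (f : ℝ → E) : ℕ → ℝ → E
  | 0 => f
  | r + 1 => fun x => c r + ∫ t in a..x, iterPrimitive a c f r t

theorem continuousOn_iterPrimitive_succ (hf : IntegrableOn f (Ioo a b)) (r : ℕ) :
    ContinuousOn (iterPrimitive a c f (r + 1)) (Icc a b) := by
  induction r with
  | zero => exact continuousOn_const.add (continuousOn_primitive hf)
  | succ r ih =>
    exact continuousOn_const.add (continuousOn_primitive (ih.integrableOn_Icc.mono_set
      Ioo_subset_Icc_self))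

theorem integrableOn_iterPrimitive (hf : IntegrableOn f (Ioo a b)) :
    ∀ r, IntegrableOn (iterPrimitive a c f r) (Ioo a b)
  | 0 => hf
  | r + 1 => (continuousOn_iterPrimitive_succ hf r).integrableOn_Icc.mono_set Ioo_subset_Icc_self

theorem hasDerivAt_iterPrimitive_succ [CompleteSpace E] {r : ℕ}
    (hf : Continuous (iterPrimitive a c f r)) (x : ℝ) :
    HasDerivAt (iterPrimitive a c f (r + 1)) (iterPrimitive a c f r x) x :=
  (hasDerivAt_primitive hf a x).const_add (c r)

theorem contDiff_iterPrimitive [CompleteSpace E] (hf : ContDiff ℝ ∞ f) (r : ℕ) :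
    ContDiff ℝ ∞ (iterPrimitive a c f r) := by
  induction r with
  | zero => exact hf
  | succ r ih =>
    have hd := hasDerivAt_iterPrimitive_succ ih.continuous
    rw [contDiff_infty_iff_deriv, funext fun x => (hd x).deriv]
    exact ⟨fun x => (hd x).differentiableAt, ih⟩

theorem iteratedDeriv_iterPrimitive [CompleteSpace E] (hf : ContDiff ℝ ∞ f) (i r : ℕ) :
    iteratedDeriv i (iterPrimitive a c f (r + i)) = iterPrimitive a c f r := by
  induction i with
  | zero => exact iteratedDeriv_zero
  | succ i ih =>
    rw [iteratedDeriv_succ', ← add_assoc, ← ih]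
    exact congrArg _ (funext fun x =>
      (hasDerivAt_iterPrimitive_succ (contDiff_iterPrimitive hf _).continuous x).deriv)

theorem enorm_iterPrimitive_sub_le (hf : IntegrableOn f (Ioo a b)) (hg : IntegrableOn g (Ioo a b))
    (r : ℕ) {x : ℝ} (hx : x ∈ Icc a b) :
    ‖iterPrimitive a c f (r + 1) x - iterPrimitive a c g (r + 1) x‖ₑ ≤
      volume (Ioo a b) ^ r * ∫⁻ t in Ioo a b, ‖f t - g t‖ₑ := by
  induction r generalizing x with
  | zero => simpa [iterPrimitive] using enorm_primitive_sub_le hf hg hx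
  | succ r ih =>
    calc ‖iterPrimitive a c f (r + 2) x - iterPrimitive a c g (r + 2) x‖ₑ
        ≤ ∫⁻ t in Ioo a b, ‖iterPrimitive a c f (r + 1) t - iterPrimitive a c g (r + 1) t‖ₑ := by
          simp only [iterPrimitive.eq_2 a c _ (r + 1), add_sub_add_left_eq_sub]
          exact enorm_primitive_sub_le (integrableOn_iterPrimitive hf _)
            (integrableOn_iterPrimitive hg _) hx
      _ ≤ ∫⁻ _ in Ioo a b, volume (Ioo a b) ^ r * ∫⁻ t in Ioo a b, ‖f t - g t‖ₑ :=
          setLIntegral_mono measurable_const fun t ht => ih (Ioo_subset_Icc_self ht)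
      _ = volume (Ioo a b) ^ (r + 1) * ∫⁻ t in Ioo a b, ‖f t - g t‖ₑ := by
          rw [setLIntegral_const]; ring

theorem IsWeakDeriv.exists_ae_eq_iterPrimitive [CompleteSpace E] (hab : a < b) {k : ℕ}
    {D : ℕ → ℝ → E} (hD : ∀ j ≤ k, IsWeakDeriv a b j u (D j))
    (hint : ∀ j ≤ k, IntegrableOn (D j) (Ioo a b)) :
    ∃ c : ℕ → E, u =ᵐ[volume.restrict (Ioo a b)] iterPrimitive a c (D k) k := by
  have hstep : ∀ r, ∃ c : E, r + 1 ≤ k →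
      D (k - (r + 1)) =ᵐ[volume.restrict (Ioo a b)] fun x => c + ∫ t in a..x, D (k - r) t := by
    intro r
    by_cases hr : r + 1 ≤ k
    · have hw : IsWeakDeriv a b 1 (D (k - (r + 1))) (D (k - r)) := by
        refine (hD (k - (r + 1)) (by omega)).shift ?_
        rw [show k - (r + 1) + 1 = k - r by omega]
        exact hD _ (by omega)
      obtain ⟨c, hc⟩ := hw.exists_eq_primitive (hint _ (by omega)) hab
      exact ⟨c, fun _ => hc⟩
    · exact ⟨0, fun h => absurd h hr⟩
  choose c hc using hstep
  have hDr : ∀ r ≤ k, D (k - r) =ᵐ[volume.restrict (Ioo a b)] iterPrimitive a c (D k) r := by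
    intro r hr
    induction r with
    | zero => exact Filter.EventuallyEq.rfl
    | succ r ih =>
      filter_upwards [hc r hr, ae_restrict_mem measurableSet_Ioo] with x hx hxI
      simp only [hx, iterPrimitive, intervalIntegral.integral_of_le hxI.1.le,
        ← restrict_Ioo_eq_restrict_Ioc]
      exact congrArg _ (integral_congr_ae
        (ae_restrict_of_ae_restrict_of_subset (Ioo_subset_Ioo_right hxI.2.le) (ih (by omega))))
  refine ⟨c, ((isWeakDeriv_zero (hD 0 k.zero_le).1).ae_eq (hD 0 k.zero_le)).trans ?_⟩
  simpa using hDr k le_rfl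

end IteratedPrimitives

section ChainRule

variable {E G : Type*} [NormedAddCommGroup E] [NormedSpace ℝ E] [NormedAddCommGroup G]
  [NormedSpace ℝ G]

/-- The jet of order `m` of `u` at `x`: the derivatives of orders `0, …, m`. -/
noncomputable def jet (m : ℕ) (u : ℝ → E) (x : ℝ) : Fin (m + 1) → E :=
  fun i => iteratedDeriv i u x

theorem hasDerivAt_jet {u : ℝ → E} (hu : ContDiff ℝ ∞ u) (m : ℕ) (x : ℝ) :
    HasDerivAt (jet m u) (Fin.tail (jet (m + 1) u x)) x :=
  hasDerivAt_pi.2 fun i => hasDerivAt_iteratedDeriv hu i x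

theorem exists_iteratedDeriv_comp_eq {π : E → G} (hπ : ContDiff ℝ ∞ π) (j : ℕ) :
    ∃ Ψ : (Fin (j + 1) → E) → G, ContDiff ℝ ∞ Ψ ∧ ∀ u : ℝ → E, ContDiff ℝ ∞ u →
      iteratedDeriv j (fun x => π (u x)) = fun x => Ψ (jet j u x) := by
  induction j with
  | zero => exact ⟨fun J => π (J 0), hπ.comp (contDiff_apply ℝ E 0), fun u _ => by simp [jet]⟩
  | succ j ih =>
    obtain ⟨Ψ, hΨ, heq⟩ := ih
    have hinit : ContDiff ℝ ∞ fun J : Fin (j + 2) → E => Fin.init (α := fun _ => E) J :=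
      contDiff_pi.2 fun i => contDiff_apply ℝ E i.castSucc
    have htail : ContDiff ℝ ∞ fun J : Fin (j + 2) → E => Fin.tail (α := fun _ => E) J :=
      contDiff_pi.2 fun i => contDiff_apply ℝ E i.succ
    refine ⟨fun J => fderiv ℝ Ψ (Fin.init J) (Fin.tail J),
      ((hΨ.fderiv_right (by simp)).comp hinit).clm_apply htail, fun u hu => ?_⟩
    ext x
    rw [iteratedDeriv_succ, heq u hu]
    exact ((hΨ.differentiable (by simp)).differentiableAt.hasFDerivAt.comp_hasDerivAt x
      (hasDerivAt_jet hu j x)).deriv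

theorem exists_tail_eq_single_add (m : ℕ) :
    ∃ S : (Fin (m + 1) → E) →L[ℝ] (Fin (m + 1) → E), ∀ J : Fin (m + 2) → E,
      Fin.tail J = Pi.single (Fin.last m) (J (Fin.last (m + 1))) + S (Fin.init J) := by
  refine ⟨ContinuousLinearMap.pi (Fin.snoc (α := fun _ => (Fin (m + 1) → E) →L[ℝ] E)
    (fun i => ContinuousLinearMap.proj i.succ) 0), fun J => funext fun i => ?_⟩
  refine Fin.lastCases ?_ (fun i => ?_) i <;> simp [Fin.tail, Fin.init]

theorem exists_iteratedDeriv_comp_eq_add {π : E → G} (hπ : ContDiff ℝ ∞ π) {j m : ℕ}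
    (hj : j ≤ m + 1) :
    ∃ (A : (Fin (m + 1) → E) → E →L[ℝ] G) (B : (Fin (m + 1) → E) → G), ContDiff ℝ ∞ A ∧
      ContDiff ℝ ∞ B ∧ ∀ u : ℝ → E, ContDiff ℝ ∞ u →
        iteratedDeriv j (fun x => π (u x)) =
          fun x => A (jet m u x) (iteratedDeriv (m + 1) u x) + B (jet m u x) := by
  rcases hj.lt_or_eq with hjm | rfl
  · obtain ⟨Ψ, hΨ, heq⟩ := exists_iteratedDeriv_comp_eq hπ j
    exact ⟨0, fun J => Ψ fun i => J (i.castLE hjm), contDiff_const,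
      hΨ.comp (contDiff_pi.2 fun i => contDiff_apply ℝ E (i.castLE hjm)),
      fun u hu => by
        simp only [heq u hu, jet, Pi.zero_apply, zero_apply, zero_add, Fin.val_castLE]
        rfl⟩
  · obtain ⟨Ψ, hΨ, heq⟩ := exists_iteratedDeriv_comp_eq hπ m
    obtain ⟨S, hS⟩ := exists_tail_eq_single_add (E := E) m
    have hΨ' : ContDiff ℝ ∞ (fderiv ℝ Ψ) := hΨ.fderiv_right (by simp)
    refine ⟨fun J => (fderiv ℝ Ψ J).comp (ContinuousLinearMap.single ℝ (fun _ => E) (Fin.last m)),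
      fun J => fderiv ℝ Ψ J (S J), hΨ'.clm_comp contDiff_const, hΨ'.clm_apply S.contDiff,
      fun u hu => ?_⟩
    ext x
    have hd := ((hΨ.differentiable (by simp)).differentiableAt.hasFDerivAt.comp_hasDerivAt x
      (hasDerivAt_jet hu m x)).deriv
    rw [iteratedDeriv_succ, heq u hu]
    refine hd.trans ?_
    rw [hS, map_add]
    rfl

end ChainRule

section Slice

variable {E : Type*} [NormedAddCommGroup E] {a b σ p : ℝ} {f g : ℝ → E}

/-- The inner integral of the Gagliardo seminorm: the contribution of the pairs `(x, y)` with `y`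
fixed to the `p`-th power of the seminorm. -/
noncomputable def gagliardoSlice (a b σ p : ℝ) (f : ℝ → E) (y : ℝ) : ℝ≥0∞ :=
  ∫⁻ x in Ioo a b, ‖f x - f y‖ₑ ^ p * ‖x - y‖ₑ ^ (-(1 + σ * p))

theorem measurable_gagliardoSlice (hf : StronglyMeasurable f) :
    Measurable (gagliardoSlice a b σ p f) := by
  have hdiff : StronglyMeasurable fun z : ℝ × ℝ => f z.2 - f z.1 :=
    (hf.comp_measurable measurable_snd).sub (hf.comp_measurable measurable_fst)
  exact Measurable.lintegral_prod_right' (f := fun z : ℝ × ℝ =>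
    ‖f z.2 - f z.1‖ₑ ^ p * ‖z.2 - z.1‖ₑ ^ (-(1 + σ * p)))
    ((hdiff.enorm.pow_const p).mul (by fun_prop))

theorem lintegral_gagliardoSlice (hσ : 0 ≤ σ) (hp : 0 < p) (hf : StronglyMeasurable f) :
    ∫⁻ y in Ioo a b, gagliardoSlice a b σ p f y = gagliardo a b σ p f ^ p := by
  have hdiff : StronglyMeasurable fun z : ℝ × ℝ => f z.1 - f z.2 :=
    (hf.comp_measurable measurable_fst).sub (hf.comp_measurable measurable_snd)
  rw [gagliardo_eq_eLpNorm hσ hp hf.aestronglyMeasurable, eLpNorm_ofReal_rpow hp,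
    lintegral_gagliardoMeasure (hdiff.enorm.pow_const p).aemeasurable,
    lintegral_lintegral_swap ((hdiff.enorm.pow_const p).mul (by fun_prop)).aemeasurable]
  rfl

theorem gagliardoSlice_add_le (hp : 1 ≤ p) (hf : StronglyMeasurable f) (y : ℝ) :
    gagliardoSlice a b σ p (f + g) y ≤
      2 ^ (p - 1) * (gagliardoSlice a b σ p f y + gagliardoSlice a b σ p g y) := by
  have hmeas : Measurable fun x => ‖f x - f y‖ₑ ^ p * ‖x - y‖ₑ ^ (-(1 + σ * p)) :=
    ((hf.sub stronglyMeasurable_const).enorm.pow_const p).mul (by fun_prop)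
  simp only [gagliardoSlice]
  rw [← lintegral_add_left hmeas, ← lintegral_const_mul' _ _ (by finiteness)]
  refine lintegral_mono fun x => ?_
  rw [← add_mul, ← mul_assoc, Pi.add_apply, Pi.add_apply, add_sub_add_comm]
  gcongr
  exact (ENNReal.rpow_le_rpow (enorm_add_le _ _) (by linarith)).trans
    (ENNReal.rpow_add_le_mul_rpow_add_rpow _ _ hp)

theorem lintegral_uIoc_enorm_sub_rpow_le (hσ : 0 ≤ σ) (hp : 0 ≤ p) {x y : ℝ} (hx : x ∈ Ioo a b)
    (hy : y ∈ Ioo a b) :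
    ∫⁻ t in uIoc y x, ‖f t - f y‖ₑ ^ p ≤ ‖x - y‖ₑ ^ (1 + σ * p) * gagliardoSlice a b σ p f y := by
  rcases eq_or_ne x y with rfl | hxy
  · simp
  have hxy0 : ‖x - y‖ₑ ^ (1 + σ * p) ≠ ⊤ := by finiteness
  have hsub : uIoc y x ⊆ Ioo a b := uIoc_subset_uIcc.trans (ordConnected_Ioo.uIcc_subset hy hx)
  rw [gagliardoSlice, ← lintegral_const_mul' _ _ hxy0]
  refine (setLIntegral_mono' measurableSet_uIoc fun t ht => ?_).trans (lintegral_mono_set hsub)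
  have hty : ‖t - y‖ₑ ≤ ‖x - y‖ₑ := by
    simpa only [← ofReal_norm, Real.norm_eq_abs] using
      ENNReal.ofReal_le_ofReal (abs_sub_left_of_mem_uIcc (uIoc_subset_uIcc ht))
  have hone : 1 ≤ ‖x - y‖ₑ ^ (1 + σ * p) * ‖t - y‖ₑ ^ (-(1 + σ * p)) := by
    rw [ENNReal.rpow_neg, ← ENNReal.mul_inv_cancel (a := ‖x - y‖ₑ ^ (1 + σ * p))
      (by simp [sub_eq_zero, hxy]) hxy0]
    gcongr
  calc ‖f t - f y‖ₑ ^ p = ‖f t - f y‖ₑ ^ p * 1 := (mul_one _).symm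
    _ ≤ ‖f t - f y‖ₑ ^ p * (‖x - y‖ₑ ^ (1 + σ * p) * ‖t - y‖ₑ ^ (-(1 + σ * p))) := by gcongr
    _ = _ := by ring

theorem lintegral_uIoc_enorm_sub_le (hσ : 0 ≤ σ) (hp : 1 ≤ p) (hf : StronglyMeasurable f)
    {x y : ℝ} (hx : x ∈ Ioo a b) (hy : y ∈ Ioo a b) :
    ∫⁻ t in uIoc y x, ‖f t - f y‖ₑ ≤
      ‖x - y‖ₑ ^ (1 + σ) * gagliardoSlice a b σ p f y ^ (1 / p) := by
  have hp0 : 0 < p := by linarith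
  have hvol : volume (uIoc y x) = ‖x - y‖ₑ := by
    rw [Real.volume_uIoc, ← Real.enorm_eq_ofReal_abs]
  have hLp : eLpNorm (fun t => f t - f y) (ENNReal.ofReal p) (volume.restrict (uIoc y x)) ≤
      ‖x - y‖ₑ ^ (1 / p + σ) * gagliardoSlice a b σ p f y ^ (1 / p) := by
    rw [← ENNReal.rpow_le_rpow_iff hp0, eLpNorm_ofReal_rpow hp0,
      ENNReal.mul_rpow_of_nonneg _ _ hp0.le, ← ENNReal.rpow_mul, ← ENNReal.rpow_mul,
      show (1 / p + σ) * p = 1 + σ * p by field_simp, one_div_mul_cancel hp0.ne', ENNReal.rpow_one]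
    exact lintegral_uIoc_enorm_sub_rpow_le hσ hp0.le hx hy
  calc ∫⁻ t in uIoc y x, ‖f t - f y‖ₑ
      = eLpNorm (fun t => f t - f y) 1 (volume.restrict (uIoc y x)) :=
        eLpNorm_one_eq_lintegral_enorm.symm
    _ ≤ eLpNorm (fun t => f t - f y) (ENNReal.ofReal p) (volume.restrict (uIoc y x)) *
        ‖x - y‖ₑ ^ (1 - 1 / p) := by
        refine (eLpNorm_le_eLpNorm_mul_rpow_measure_univ (q := ENNReal.ofReal p) (by simpa using hp)
          (hf.sub stronglyMeasurable_const).aestronglyMeasurable).trans_eq ?_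
        simp only [Measure.restrict_apply_univ, hvol, ENNReal.toReal_one,
          ENNReal.toReal_ofReal hp0.le, div_one]
        rfl
    _ ≤ ‖x - y‖ₑ ^ (1 / p + σ) * gagliardoSlice a b σ p f y ^ (1 / p) * ‖x - y‖ₑ ^ (1 - 1 / p) := by
        gcongr
    _ = ‖x - y‖ₑ ^ (1 + σ) * gagliardoSlice a b σ p f y ^ (1 / p) := by
        rw [mul_right_comm, ← ENNReal.rpow_add_of_nonneg _ _ (by positivity)
          (sub_nonneg.2 ((div_le_one hp0).2 hp))]
        congr 2
        ring

end Slice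

section PrimitiveBounds

variable {E : Type*} [NormedAddCommGroup E] [NormedSpace ℝ E] {a b σ p x y : ℝ} {f : ℝ → E}

theorem norm_intervalIntegral_sub_smul_le [CompleteSpace E] (hσ : 0 ≤ σ) (hp : 1 ≤ p)
    (hf : StronglyMeasurable f) (hfi : IntegrableOn f (Ioo a b)) (hx : x ∈ Ioo a b)
    (hy : y ∈ Ioo a b) {V : ℝ≥0} (hV : gagliardoSlice a b σ p f y ≤ (V : ℝ≥0∞) ^ (p * (1 + σ))) :
    ‖(∫ t in y..x, f t) - (x - y) • f y‖ ≤ (V * |x - y|) ^ (1 + σ) := by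
  have hsub : uIoc y x ⊆ Ioo a b := uIoc_subset_uIcc.trans (ordConnected_Ioo.uIcc_subset hy hx)
  have hint : IntervalIntegrable f volume y x :=
    intervalIntegrable_iff.2 (hfi.mono_set hsub)
  rw [← intervalIntegral.integral_const, ← intervalIntegral.integral_sub hint (by simp),
    ← ENNReal.ofReal_le_ofReal_iff (by positivity), ofReal_norm,
    ← ENNReal.ofReal_rpow_of_nonneg (by positivity) (by positivity), ENNReal.ofReal_mul (by simp),
    ENNReal.ofReal_coe_nnreal, ← Real.enorm_eq_ofReal_abs]
  calc ‖∫ t in y..x, f t - f y‖ₑ = ‖∫ t in uIoc y x, f t - f y‖ₑ := by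
        simp only [← ofReal_norm, intervalIntegral.norm_intervalIntegral_eq]
    _ ≤ ∫⁻ t in uIoc y x, ‖f t - f y‖ₑ := enorm_integral_le_lintegral_enorm _
    _ ≤ ‖x - y‖ₑ ^ (1 + σ) * gagliardoSlice a b σ p f y ^ (1 / p) :=
        lintegral_uIoc_enorm_sub_le hσ hp hf hx hy
    _ ≤ ‖x - y‖ₑ ^ (1 + σ) * ((V : ℝ≥0∞) ^ (p * (1 + σ))) ^ (1 / p) := by gcongr
    _ = (V * ‖x - y‖ₑ) ^ (1 + σ) := by
        rw [← ENNReal.rpow_mul, ENNReal.mul_rpow_of_nonneg _ _ (by positivity), mul_comm,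
          show p * (1 + σ) * (1 / p) = 1 + σ by field_simp]

theorem exists_mem_Ioo_abs_sub_eq {r : ℝ} (hr : 0 ≤ r) (hrab : r ≤ (b - a) / 4)
    (hy : y ∈ Ioo a b) : ∃ x ∈ Ioo a b, |x - y| = r := by
  obtain ⟨ha, hb⟩ := hy
  rcases le_total y ((a + b) / 2) with h | h
  · exact ⟨y + r, ⟨by linarith, by linarith⟩, by simp [hr]⟩
  · exact ⟨y - r, ⟨by linarith, by linarith⟩, by simp [hr]⟩

theorem norm_le_mul_of_gagliardoSlice_le [CompleteSpace E] (hab : a < b) (hσ : 0 ≤ σ) (hp : 1 ≤ p)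
    (hf : StronglyMeasurable f) (hfi : IntegrableOn f (Ioo a b)) {M : ℝ}
    (hbdd : ∀ x ∈ Ioo a b, ‖∫ t in y..x, f t‖ ≤ M) (hy : y ∈ Ioo a b) {V : ℝ≥0} (hV1 : 1 ≤ V)
    (hV : gagliardoSlice a b σ p f y ≤ (V : ℝ≥0∞) ^ (p * (1 + σ))) :
    ‖f y‖ ≤ (M + ((b - a) / 4) ^ (1 + σ)) / ((b - a) / 4) * V := by
  set ℓ := (b - a) / 4 with hℓdef
  have hℓ : 0 < ℓ := by simp only [hℓdef]; linarith
  have hV1' : (1 : ℝ) ≤ V := by exact_mod_cast hV1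
  have hV0 : (0 : ℝ) < V := by linarith
  -- At distance `ℓ / V` from `y` the deviation of the primitive from its linear part is bounded.
  obtain ⟨x, hx, hxy⟩ := exists_mem_Ioo_abs_sub_eq (r := ℓ / V) (by positivity)
    (div_le_self hℓ.le hV1') hy
  have hosc : ‖(∫ t in y..x, f t) - (x - y) • f y‖ ≤ ℓ ^ (1 + σ) := by
    simpa only [hxy, mul_div_cancel₀ _ hV0.ne'] using
      norm_intervalIntegral_sub_smul_le hσ hp hf hfi hx hy hV
  have hlin : ‖(x - y) • f y‖ ≤ M + ℓ ^ (1 + σ) :=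
    (norm_le_norm_add_norm_sub (∫ t in y..x, f t) _).trans (add_le_add (hbdd x hx) hosc)
  rw [norm_smul, Real.norm_eq_abs, hxy] at hlin
  rw [div_mul_eq_mul_div, le_div_iff₀ hℓ]
  calc ‖f y‖ * ℓ = ℓ / V * ‖f y‖ * V := by field_simp
    _ ≤ _ := by gcongr

theorem exists_norm_le_and_norm_intervalIntegral_le [CompleteSpace E] (hab : a < b) (hσ : 0 ≤ σ)
    (hp : 1 ≤ p) {M : ℝ} (hM : 0 ≤ M) :
    ∃ C : ℝ≥0, ∀ (f : ℝ → E) (y : ℝ) (V : ℝ≥0), StronglyMeasurable f → IntegrableOn f (Ioo a b) →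
      (∀ x ∈ Ioo a b, ‖∫ t in y..x, f t‖ ≤ M) → y ∈ Ioo a b → 1 ≤ V →
      gagliardoSlice a b σ p f y ≤ (V : ℝ≥0∞) ^ (p * (1 + σ)) →
      ‖f y‖ ≤ C * V ∧ ∀ x ∈ Ioo a b, ‖∫ t in y..x, f t‖ ≤ C * min 1 (V * |x - y|) := by
  have hℓ : 0 < (b - a) / 4 := by linarith
  set C := (M + ((b - a) / 4) ^ (1 + σ)) / ((b - a) / 4)
  have hC : 0 ≤ C := div_nonneg (add_nonneg hM (Real.rpow_nonneg hℓ.le _)) hℓ.le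
  obtain ⟨C', hC'⟩ : ∃ C' : ℝ≥0, (C' : ℝ) = M + C + 1 := CanLift.prf _ (by positivity)
  refine ⟨C', fun f y V hf hfi hbdd hy hV1 hV => ?_⟩
  have hfy : ‖f y‖ ≤ C * V := norm_le_mul_of_gagliardoSlice_le hab hσ hp hf hfi hbdd hy hV1 hV
  rw [hC']
  refine ⟨hfy.trans (by gcongr; linarith), fun x hx => ?_⟩
  rcases le_total 1 (V * |x - y|) with h | h
  · rw [min_eq_left h]
    linarith [hbdd x hx]
  · rw [min_eq_right h]
    have hpow : (V * |x - y|) ^ (1 + σ) ≤ V * |x - y| := by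
      simpa using Real.rpow_le_rpow_of_exponent_ge' (by positivity) h zero_le_one
        (le_add_of_nonneg_right hσ)
    calc ‖∫ t in y..x, f t‖ ≤ ‖(x - y) • f y‖ + ‖(∫ t in y..x, f t) - (x - y) • f y‖ :=
          norm_le_norm_add_norm_sub' _ _
      _ ≤ |x - y| * (C * V) + V * |x - y| := by
          rw [norm_smul, Real.norm_eq_abs]
          gcongr
          exact (norm_intervalIntegral_sub_smul_le hσ hp hf hfi hx hy hV).trans hpow
      _ = (C + 1) * (V * |x - y|) := by ring
      _ ≤ (M + C + 1) * (V * |x - y|) := by gcongr; linarith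

end PrimitiveBounds

theorem exists_measurable_one_le_le_rpow {α : Type*} {mα : MeasurableSpace α} {μ : Measure α}
    [IsFiniteMeasure μ] {q : ℝ} (hq : 0 < q) {H : α → ℝ≥0∞} (hH : Measurable H)
    (hHfin : ∫⁻ x, H x ∂μ ≠ ⊤) :
    ∃ V : α → ℝ≥0, Measurable V ∧ (∀ x, 1 ≤ V x) ∧ ∫⁻ x, (V x : ℝ≥0∞) ^ q ∂μ ≠ ⊤ ∧
      ∀ᵐ x ∂μ, H x ≤ (V x : ℝ≥0∞) ^ q := by
  refine ⟨fun x => max 1 ((H x ^ (1 / q)).toNNReal), by fun_prop, fun x => le_max_left _ _, ?_, ?_⟩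
  · have hle : ∀ x, ((max 1 ((H x ^ (1 / q)).toNNReal) : ℝ≥0) : ℝ≥0∞) ^ q ≤ 1 + H x := fun x => by
      rw [ENNReal.coe_max, (ENNReal.monotone_rpow_of_nonneg hq.le).map_max]
      refine max_le (by simp) ?_
      calc (((H x ^ (1 / q)).toNNReal : ℝ≥0) : ℝ≥0∞) ^ q ≤ (H x ^ (1 / q)) ^ q := by
            gcongr
            exact ENNReal.coe_toNNReal_le_self
        _ = H x := by rw [← ENNReal.rpow_mul, one_div_mul_cancel hq.ne', ENNReal.rpow_one]
        _ ≤ 1 + H x := le_add_self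
    refine ((lintegral_mono hle).trans_lt ?_).ne
    rw [lintegral_add_left measurable_const, lintegral_one]
    finiteness
  · filter_upwards [ae_lt_top hH hHfin] with x hx
    calc H x = (H x ^ (1 / q)) ^ q := by
          rw [← ENNReal.rpow_mul, one_div_mul_cancel hq.ne', ENNReal.rpow_one]
      _ = (((H x ^ (1 / q)).toNNReal : ℝ≥0) : ℝ≥0∞) ^ q := by
          rw [ENNReal.coe_toNNReal (by finiteness)]
      _ ≤ _ := by gcongr; exact le_max_right _ _

theorem exists_gagliardoSlice_le_rpow {E : Type*} [NormedAddCommGroup E] {a b σ p : ℝ}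
    (hσ : 0 ≤ σ) (hp : 1 ≤ p) {f : ℝ → E} {F : ℕ → ℝ → E} (hf : StronglyMeasurable f)
    (hF : ∀ n, StronglyMeasurable (F n)) (hfin : gagliardo a b σ p f ≠ ⊤)
    (hsum : ∑' n, gagliardo a b σ p (F n - f) ^ p ≠ ⊤) :
    ∃ V : ℝ → ℝ≥0, Measurable V ∧ (∀ y, 1 ≤ V y) ∧
      ∫⁻ y in Ioo a b, (V y : ℝ≥0∞) ^ (p * (1 + σ)) ≠ ⊤ ∧
      ∀ᵐ y ∂volume.restrict (Ioo a b), ∀ n,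
        gagliardoSlice a b σ p (F n) y ≤ (V y : ℝ≥0∞) ^ (p * (1 + σ)) := by
  have hp0 : 0 < p := by linarith
  have hsub : ∀ n, Measurable (gagliardoSlice a b σ p (F n - f)) := fun n =>
    measurable_gagliardoSlice ((hF n).sub hf)
  set H : ℝ → ℝ≥0∞ := fun y => 2 ^ (p - 1) *
    (∑' n, gagliardoSlice a b σ p (F n - f) y + gagliardoSlice a b σ p f y)
  have hH : Measurable H :=
    ((Measurable.tsum hsub).add (measurable_gagliardoSlice hf)).const_mul _
  have hHfin : ∫⁻ y in Ioo a b, H y ≠ ⊤ := by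
    rw [lintegral_const_mul' _ _ (by finiteness), lintegral_add_right _
      (measurable_gagliardoSlice hf), lintegral_tsum fun n => (hsub n).aemeasurable]
    simp only [lintegral_gagliardoSlice hσ hp0 ((hF _).sub hf), lintegral_gagliardoSlice hσ hp0 hf]
    finiteness
  obtain ⟨V, hV, hV1, hVfin, hHV⟩ :=
    exists_measurable_one_le_le_rpow (q := p * (1 + σ)) (by positivity) hH hHfin
  refine ⟨V, hV, hV1, hVfin, hHV.mono fun y hy n => le_trans ?_ hy⟩
  calc gagliardoSlice a b σ p (F n) y = gagliardoSlice a b σ p (F n - f + f) y := by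
        rw [sub_add_cancel]
    _ ≤ 2 ^ (p - 1) * (gagliardoSlice a b σ p (F n - f) y + gagliardoSlice a b σ p f y) :=
        gagliardoSlice_add_le hp ((hF n).sub hf) y
    _ ≤ H y := by
        simp only [H]
        gcongr
        exact ENNReal.le_tsum n

section Convergence

variable {α E G X : Type*} {mα : MeasurableSpace α} {μ : Measure α} {p : ℝ}
  [NormedAddCommGroup E] [NormedAddCommGroup G]

theorem ae_enorm_le_of_tendsto {F : ℕ → α → G} {F' : α → G} {g : α → ℝ≥0∞}
    (hFg : ∀ n, ∀ᵐ x ∂μ, ‖F n x‖ₑ ≤ g x) (hlim : ∀ᵐ x ∂μ, Tendsto (F · x) atTop (𝓝 (F' x))) :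
    ∀ᵐ x ∂μ, ‖F' x‖ₑ ≤ g x := by
  filter_upwards [ae_all_iff.2 hFg, hlim] with x hx hlim
  exact le_of_tendsto' hlim.enorm hx

theorem tendsto_eLpNorm_sub_of_dominated (hp : 0 < p) {F : ℕ → α → G} {F' : α → G} {g : α → ℝ≥0∞}
    (hF : ∀ n, AEStronglyMeasurable (F n) μ) (hg : eLpNorm g (ENNReal.ofReal p) μ ≠ ⊤)
    (hFg : ∀ n, ∀ᵐ x ∂μ, ‖F n x‖ₑ ≤ g x) (hlim : ∀ᵐ x ∂μ, Tendsto (F · x) atTop (𝓝 (F' x))) :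
    Tendsto (fun n => eLpNorm (F n - F') (ENNReal.ofReal p) μ) atTop (𝓝 0) := by
  have hF' : AEStronglyMeasurable F' μ := aestronglyMeasurable_of_tendsto_ae atTop hF hlim
  refine tendsto_eLpNorm_zero_of_dominated hp (fun n => (hF n).sub hF')
    (g := fun x => (2 : ℝ≥0) * g x) ?_ (fun n => ?_) (hlim.mono fun x hx => ?_)
  · refine ne_top_of_le_ne_top (ENNReal.mul_ne_top (ENNReal.coe_ne_top (r := 2)) hg) ?_
    exact eLpNorm_le_nnreal_smul_eLpNorm_of_ae_le_mul' (ae_of_all _ fun x => le_rfl) _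
  · filter_upwards [hFg n, ae_enorm_le_of_tendsto hFg hlim] with x hx hx'
    calc ‖F n x - F' x‖ₑ ≤ ‖F n x‖ₑ + ‖F' x‖ₑ := enorm_sub_le
      _ ≤ (2 : ℝ≥0) * g x := by
        rw [ENNReal.coe_ofNat, two_mul]
        gcongr
  · simpa using hx.sub_const (F' x)

theorem tendsto_eLpNorm_add_sub_add (hp : 1 ≤ p) {F H : ℕ → α → G} {F' H' : α → G}
    (hF : ∀ n, AEStronglyMeasurable (F n) μ) (hF' : AEStronglyMeasurable F' μ)
    (hH : ∀ n, AEStronglyMeasurable (H n) μ) (hH' : AEStronglyMeasurable H' μ)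
    (hFlim : Tendsto (fun n => eLpNorm (F n - F') (ENNReal.ofReal p) μ) atTop (𝓝 0))
    (hHlim : Tendsto (fun n => eLpNorm (H n - H') (ENNReal.ofReal p) μ) atTop (𝓝 0)) :
    Tendsto (fun n => eLpNorm (F n + H n - (F' + H')) (ENNReal.ofReal p) μ) atTop (𝓝 0) := by
  refine tendsto_of_tendsto_of_tendsto_of_le_of_le tendsto_const_nhds
    (by simpa using hFlim.add hHlim) (fun n => zero_le) fun n => ?_
  rw [add_sub_add_comm]
  exact eLpNorm_add_le ((hF n).sub hF') ((hH n).sub hH') (by simpa using hp)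

theorem exists_nnnorm_le_of_isCompact [TopologicalSpace X] {B : X → G} (hB : Continuous B)
    {K : Set X} (hK : IsCompact K) : ∃ M : ℝ≥0, ∀ x ∈ K, ‖B x‖₊ ≤ M := by
  obtain ⟨M, hM⟩ := hK.exists_bound_of_continuousOn hB.continuousOn
  exact ⟨M.toNNReal, fun x hx => NNReal.le_toNNReal_of_coe_le (hM x hx)⟩

variable [NormedSpace ℝ E] [NormedSpace ℝ G]

theorem aestronglyMeasurable_clm_apply {A : α → E →L[ℝ] G} {f : α → E}
    (hA : AEStronglyMeasurable A μ) (hf : AEStronglyMeasurable f μ) :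
    AEStronglyMeasurable (fun x => A x (f x)) μ :=
  (ContinuousLinearMap.id ℝ (E →L[ℝ] G)).aestronglyMeasurable_comp₂ hA hf

theorem tendsto_eLpNorm_clm_apply_sub (hp : 1 ≤ p) {A : ℕ → α → E →L[ℝ] G} {A' : α → E →L[ℝ] G}
    {h : ℕ → α → E} {h' : α → E} {M : ℝ≥0} (hA : ∀ n, AEStronglyMeasurable (A n) μ)
    (hM : ∀ n, ∀ᵐ x ∂μ, ‖A n x‖₊ ≤ M) (hAlim : ∀ᵐ x ∂μ, Tendsto (A · x) atTop (𝓝 (A' x)))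
    (hh : ∀ n, AEStronglyMeasurable (h n) μ) (hh' : AEStronglyMeasurable h' μ)
    (hfin : eLpNorm h' (ENNReal.ofReal p) μ ≠ ⊤)
    (hlim : Tendsto (fun n => eLpNorm (h n - h') (ENNReal.ofReal p) μ) atTop (𝓝 0)) :
    Tendsto (fun n => eLpNorm (fun x => A n x (h n x) - A' x (h' x)) (ENNReal.ofReal p) μ)
      atTop (𝓝 0) := by
  have happly : ∀ n (k : α → E), AEStronglyMeasurable k μ →
      AEStronglyMeasurable (fun x => A n x (k x)) μ := fun n _ =>
    aestronglyMeasurable_clm_apply (hA n)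
  have hbound : ∀ n, ∀ᵐ x ∂μ, ∀ e : E, ‖A n x e‖₊ ≤ M * ‖e‖₊ := fun n =>
    (hM n).mono fun x hx e => ((A n x).le_opNNNorm e).trans (by gcongr)
  have happlylim : ∀ᵐ x ∂μ, Tendsto (fun n => A n x (h' x)) atTop (𝓝 (A' x (h' x))) :=
    hAlim.mono fun x hx => ((ContinuousLinearMap.apply ℝ G (h' x)).continuous.tendsto _).comp hx
  have hdom : Tendsto (fun n => eLpNorm ((fun x => A n x (h' x)) - fun x => A' x (h' x))
      (ENNReal.ofReal p) μ) atTop (𝓝 0) := by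
    refine tendsto_eLpNorm_sub_of_dominated (by linarith) (fun n => happly n _ hh')
      (g := fun x => M * ‖h' x‖ₑ) ?_ (fun n => ?_)
      happlylim
    · refine ne_top_of_le_ne_top (ENNReal.mul_ne_top (ENNReal.coe_ne_top (r := M)) hfin) ?_
      exact eLpNorm_le_nnreal_smul_eLpNorm_of_ae_le_mul' (ae_of_all _ fun x => le_rfl) _
    · filter_upwards [hbound n] with x hx
      simpa only [enorm_eq_nnnorm] using mod_cast hx (h' x)
  refine tendsto_of_tendsto_of_tendsto_of_le_of_le tendsto_const_nhds
    (by
    simpa using (ENNReal.Tendsto.const_mul hlim (.inr (ENNReal.coe_ne_top (r := M)))).add hdom)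
    (fun n => zero_le) fun n => ?_
  calc eLpNorm (fun x => A n x (h n x) - A' x (h' x)) (ENNReal.ofReal p) μ
      = eLpNorm ((fun x => A n x ((h n - h') x)) +
          ((fun x => A n x (h' x)) - fun x => A' x (h' x))) (ENNReal.ofReal p) μ := by
        congr 1 with x
        simp
    _ ≤ _ := eLpNorm_add_le (happly n _ ((hh n).sub hh'))
        ((happly n _ hh').sub (aestronglyMeasurable_of_tendsto_ae atTop (fun n => happly n _ hh')
          happlylim)) (by simpa using hp)
    _ ≤ M * eLpNorm (h n - h') (ENNReal.ofReal p) μ + _ := by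
        gcongr
        exact eLpNorm_le_nnreal_smul_eLpNorm_of_ae_le_mul ((hbound n).mono fun x hx => hx _) _

/-- The superposition `x ↦ A (J x) (f x) + B (J x)`. The derivatives of `π ∘ u` have this
shape, with `f` the top order derivative of `u` and `J` the collection of the lower order ones. -/
def affineSuperposition (A : X → E →L[ℝ] G) (B : X → G) (J : α → X) (f : α → E) (x : α) : G :=
  A (J x) (f x) + B (J x)

theorem aestronglyMeasurable_affineSuperposition [TopologicalSpace X] {A : X → E →L[ℝ] G}
    {B : X → G} (hA : Continuous A) (hB : Continuous B) {J : α → X} {f : α → E}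
    (hJ : AEStronglyMeasurable J μ) (hf : AEStronglyMeasurable f μ) :
    AEStronglyMeasurable (affineSuperposition A B J f) μ :=
  (aestronglyMeasurable_clm_apply (hA.comp_aestronglyMeasurable hJ) hf).add
    (hB.comp_aestronglyMeasurable hJ)

theorem tendsto_eLpNorm_affineSuperposition_sub [IsFiniteMeasure μ] [TopologicalSpace X]
    [TopologicalSpace.PseudoMetrizableSpace X] (hp : 1 ≤ p) {A : X → E →L[ℝ] G} {B : X → G}
    (hA : Continuous A) (hB : Continuous B) {K : Set X} (hK : IsCompact K) {J : ℕ → α → X}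
    {J' : α → X} {f : ℕ → α → E} {f' : α → E}
    (hJ : ∀ n, AEStronglyMeasurable (J n) μ) (hJK : ∀ n, ∀ᵐ x ∂μ, J n x ∈ K)
    (hJlim : ∀ᵐ x ∂μ, Tendsto (J · x) atTop (𝓝 (J' x)))
    (hf : ∀ n, AEStronglyMeasurable (f n) μ) (hf' : AEStronglyMeasurable f' μ)
    (hfin : eLpNorm f' (ENNReal.ofReal p) μ ≠ ⊤)
    (hlim : Tendsto (fun n => eLpNorm (f n - f') (ENNReal.ofReal p) μ) atTop (𝓝 0)) :
    Tendsto (fun n => eLpNorm (affineSuperposition A B (J n) (f n) - affineSuperposition A B J' f')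
      (ENNReal.ofReal p) μ) atTop (𝓝 0) := by
  obtain ⟨M, hM⟩ := exists_nnnorm_le_of_isCompact hA hK
  obtain ⟨L, hL⟩ := exists_nnnorm_le_of_isCompact hB hK
  have hAJ : ∀ n, AEStronglyMeasurable (A ∘ J n) μ := fun n => hA.comp_aestronglyMeasurable (hJ n)
  have hBJ : ∀ n, AEStronglyMeasurable (B ∘ J n) μ := fun n => hB.comp_aestronglyMeasurable (hJ n)
  have hAlim : ∀ᵐ x ∂μ, Tendsto (fun n => A (J n x)) atTop (𝓝 (A (J' x))) :=
    hJlim.mono fun x hx => (hA.tendsto _).comp hx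
  have hBlim : ∀ᵐ x ∂μ, Tendsto (fun n => B (J n x)) atTop (𝓝 (B (J' x))) :=
    hJlim.mono fun x hx => (hB.tendsto _).comp hx
  have hlinear := tendsto_eLpNorm_clm_apply_sub hp hAJ (fun n => (hJK n).mono fun x => hM _) hAlim
    hf hf' hfin hlim
  have hconst : Tendsto (fun n => eLpNorm (B ∘ J n - B ∘ J') (ENNReal.ofReal p) μ) atTop (𝓝 0) :=
    tendsto_eLpNorm_sub_of_dominated (by linarith) hBJ (g := fun _ => L)
      (memLp_const_enorm (by simp)).eLpNorm_ne_top
      (fun n => (hJK n).mono fun x hx => by simpa [enorm_eq_nnnorm] using hL _ hx) hBlim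
  have hJ' : AEStronglyMeasurable J' μ := aestronglyMeasurable_of_tendsto_ae atTop hJ hJlim
  exact tendsto_eLpNorm_add_sub_add hp (fun n => aestronglyMeasurable_clm_apply (hAJ n) (hf n))
    (aestronglyMeasurable_clm_apply (hA.comp_aestronglyMeasurable hJ') hf') hBJ
    (hB.comp_aestronglyMeasurable hJ') hlinear hconst

end Convergence

section Energy

variable {E G X : Type*} [NormedAddCommGroup E] [NormedSpace ℝ E] [NormedAddCommGroup G]
  [NormedSpace ℝ G] {a b σ p : ℝ} {A : X → E →L[ℝ] G} {B : X → G}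

/-- The part of `affineSuperposition A B J f x - affineSuperposition A B J f y` that involves the
increments of `A ∘ J` and `B ∘ J` but not that of `f`. -/
def superpositionRemainder (A : X → E →L[ℝ] G) (B : X → G) (J : ℝ → X) (f : ℝ → E)
    (z : ℝ × ℝ) : G :=
  (A (J z.1) - A (J z.2)) (f z.2) + (B (J z.1) - B (J z.2))

theorem affineSuperposition_sub (J : ℝ → X) (f : ℝ → E) (z : ℝ × ℝ) :
    affineSuperposition A B J f z.1 - affineSuperposition A B J f z.2 =
      A (J z.1) (f z.1 - f z.2) + superpositionRemainder A B J f z := by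
  simp only [affineSuperposition, superpositionRemainder, sub_apply, map_sub]
  abel

theorem quasiMeasurePreserving_fst_gagliardoMeasure : Measure.QuasiMeasurePreserving Prod.fst
    (gagliardoMeasure a b σ p) (volume.restrict (Ioo a b)) :=
  Measure.quasiMeasurePreserving_fst.mono_left gagliardoMeasure_absolutelyContinuous

theorem quasiMeasurePreserving_snd_gagliardoMeasure : Measure.QuasiMeasurePreserving Prod.snd
    (gagliardoMeasure a b σ p) (volume.restrict (Ioo a b)) :=
  Measure.quasiMeasurePreserving_snd.mono_left gagliardoMeasure_absolutelyContinuous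

theorem aestronglyMeasurable_superpositionRemainder [TopologicalSpace X] (hA : Continuous A)
    (hB : Continuous B) {J : ℝ → X} {f : ℝ → E}
    (hJ : AEStronglyMeasurable J (volume.restrict (Ioo a b)))
    (hf : AEStronglyMeasurable f (volume.restrict (Ioo a b))) :
    AEStronglyMeasurable (superpositionRemainder A B J f) (gagliardoMeasure a b σ p) := by
  have hfst := hJ.comp_quasiMeasurePreserving
    (quasiMeasurePreserving_fst_gagliardoMeasure (σ := σ) (p := p))
  have hsnd := hJ.comp_quasiMeasurePreserving
    (quasiMeasurePreserving_snd_gagliardoMeasure (σ := σ) (p := p))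
  exact (aestronglyMeasurable_clm_apply
    ((hA.comp_aestronglyMeasurable hfst).sub (hA.comp_aestronglyMeasurable hsnd))
    (hf.comp_quasiMeasurePreserving quasiMeasurePreserving_snd_gagliardoMeasure)).add
    ((hB.comp_aestronglyMeasurable hfst).sub (hB.comp_aestronglyMeasurable hsnd))

theorem eLpNorm_min_one_mul_ne_top (hσ : 0 < σ) (hσ1 : σ < 1) (hp : 0 < p) (D : ℝ≥0) {V : ℝ → ℝ≥0}
    (hV : Measurable V) (hVfin : ∫⁻ y in Ioo a b, (V y : ℝ≥0∞) ^ (p * (1 + σ)) ≠ ⊤) :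
    eLpNorm (fun z : ℝ × ℝ => D * (min 1 (V z.2 * ‖z.1 - z.2‖ₑ) * V z.2)) (ENNReal.ofReal p)
      (gagliardoMeasure a b σ p) ≠ ⊤ := by
  obtain ⟨C, hC⟩ := exists_eLpNorm_min_one_mul_le hσ hσ1 hp
  have hfin : eLpNorm (fun y => (V y : ℝ≥0∞) ^ σ * V y) (ENNReal.ofReal p)
      (volume.restrict (Ioo a b)) ≠ ⊤ := by
    refine (ENNReal.rpow_lt_top_iff_of_pos hp).1 ?_ |>.ne
    rw [eLpNorm_ofReal_rpow hp]
    refine (lintegral_congr fun y => ?_).trans_lt hVfin.lt_top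
    rw [enorm_eq_self, mul_comm p, ENNReal.rpow_mul,
      ENNReal.rpow_add_of_nonneg _ _ zero_le_one hσ.le, ENNReal.rpow_one, mul_comm]
  refine ne_top_of_le_ne_top (ENNReal.mul_ne_top (ENNReal.coe_ne_top (r := D))
    (ne_top_of_le_ne_top (ENNReal.mul_ne_top ENNReal.coe_ne_top hfin) (hC a b V V hV hV))) ?_
  exact eLpNorm_le_nnreal_smul_eLpNorm_of_ae_le_mul' (ae_of_all _ fun z => le_rfl) _

variable [PseudoMetricSpace X]

theorem enorm_superpositionRemainder_le {L C V : ℝ≥0} {K : Set X} (hA : LipschitzOnWith L A K)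
    (hB : LipschitzOnWith L B K) {J : ℝ → X} {f : ℝ → E} {z : ℝ × ℝ} (hx : J z.1 ∈ K)
    (hy : J z.2 ∈ K) (hV : 1 ≤ V) (hf : ‖f z.2‖₊ ≤ C * V)
    (hJ : nndist (J z.1) (J z.2) ≤ C * min 1 (V * ‖z.1 - z.2‖₊)) :
    ‖superpositionRemainder A B J f z‖ₑ ≤
      (L * C * (C + 1) : ℝ≥0) * (min 1 (V * ‖z.1 - z.2‖ₑ) * V) := by
  set r := min 1 (V * ‖z.1 - z.2‖₊)
  have hAr : ‖A (J z.1) - A (J z.2)‖₊ ≤ L * (C * r) := by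
    rw [← nndist_eq_nnnorm]
    refine le_trans ?_ (mul_le_mul_right hJ L)
    simpa only [edist_nndist, ← ENNReal.coe_mul, ENNReal.coe_le_coe] using hA hx hy
  have hBr : ‖B (J z.1) - B (J z.2)‖₊ ≤ L * (C * r) := by
    rw [← nndist_eq_nnnorm]
    refine le_trans ?_ (mul_le_mul_right hJ L)
    simpa only [edist_nndist, ← ENNReal.coe_mul, ENNReal.coe_le_coe] using hB hx hy
  have key : ‖superpositionRemainder A B J f z‖₊ ≤ L * C * (C + 1) * (r * V) :=
    calc ‖superpositionRemainder A B J f z‖₊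
        ≤ ‖A (J z.1) - A (J z.2)‖₊ * ‖f z.2‖₊ + ‖B (J z.1) - B (J z.2)‖₊ :=
          (nnnorm_add_le _ _).trans (by gcongr; exact ContinuousLinearMap.le_opNNNorm _ _)
      _ ≤ L * (C * r) * (C * V) + L * (C * r) * V := by
          gcongr
          exact hBr.trans (le_mul_of_one_le_right (by positivity) hV)
      _ = L * C * (C + 1) * (r * V) := by ring
  simpa only [enorm_eq_nnnorm, r] using mod_cast key

theorem tendsto_eLpNorm_superpositionRemainder_sub (hσ : 0 < σ) (hσ1 : σ < 1) (hp : 0 < p)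
    (hA : LocallyLipschitz A) (hB : LocallyLipschitz B) {K : Set X} (hK : IsCompact K)
    {J : ℕ → ℝ → X} {J' : ℝ → X} {f : ℕ → ℝ → E} {f' : ℝ → E}
    (hJ : ∀ n, AEStronglyMeasurable (J n) (volume.restrict (Ioo a b)))
    (hJK : ∀ n, ∀ x ∈ Ioo a b, J n x ∈ K)
    (hJlim : ∀ᵐ x ∂volume.restrict (Ioo a b), Tendsto (J · x) atTop (𝓝 (J' x)))
    (hf : ∀ n, AEStronglyMeasurable (f n) (volume.restrict (Ioo a b)))
    (hflim : ∀ᵐ x ∂volume.restrict (Ioo a b), Tendsto (f · x) atTop (𝓝 (f' x)))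
    {C : ℝ≥0} {V : ℝ → ℝ≥0} (hV : Measurable V) (hV1 : ∀ y, 1 ≤ V y)
    (hVfin : ∫⁻ y in Ioo a b, (V y : ℝ≥0∞) ^ (p * (1 + σ)) ≠ ⊤)
    (hbound : ∀ n, ∀ᵐ y ∂volume.restrict (Ioo a b), ‖f n y‖₊ ≤ C * V y ∧
      ∀ x ∈ Ioo a b, nndist (J n x) (J n y) ≤ C * min 1 (V y * ‖x - y‖₊)) :
    Tendsto (fun n => eLpNorm
      (superpositionRemainder A B (J n) (f n) - superpositionRemainder A B J' f')
      (ENNReal.ofReal p) (gagliardoMeasure a b σ p)) atTop (𝓝 0) := by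
  obtain ⟨L₁, hL₁⟩ := hA.locallyLipschitzOn.exists_lipschitzOnWith_of_compact hK
  obtain ⟨L₂, hL₂⟩ := hB.locallyLipschitzOn.exists_lipschitzOnWith_of_compact hK
  have hfst := quasiMeasurePreserving_fst_gagliardoMeasure (a := a) (b := b) (σ := σ) (p := p)
  have hsnd := quasiMeasurePreserving_snd_gagliardoMeasure (a := a) (b := b) (σ := σ) (p := p)
  refine tendsto_eLpNorm_sub_of_dominated hp (fun n => ?_)
    (eLpNorm_min_one_mul_ne_top hσ hσ1 hp (max L₁ L₂ * C * (C + 1)) hV hVfin) (fun n => ?_) ?_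
  · exact aestronglyMeasurable_superpositionRemainder hA.continuous hB.continuous (hJ n) (hf n)
  · filter_upwards [hfst.ae (ae_restrict_mem measurableSet_Ioo),
      hsnd.ae (ae_restrict_mem measurableSet_Ioo), hsnd.ae (hbound n)] with z hx hy hz
    exact enorm_superpositionRemainder_le (hL₁.weaken (le_max_left _ _))
      (hL₂.weaken (le_max_right _ _)) (hJK n _ hx) (hJK n _ hy) (hV1 _) hz.1 (hz.2 _ hx)
  · filter_upwards [hfst.ae hJlim, hsnd.ae hJlim, hsnd.ae hflim] with z hx hy hf
    have hAz := ((hA.continuous.tendsto _).comp hx).sub ((hA.continuous.tendsto _).comp hy)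
    have hBz := ((hB.continuous.tendsto _).comp hx).sub ((hB.continuous.tendsto _).comp hy)
    exact ((isBoundedBilinearMap_apply.continuous.tendsto _).comp (hAz.prodMk_nhds hf)).add hBz

theorem tendsto_gagliardo_affineSuperposition_sub (hσ : 0 < σ) (hσ1 : σ < 1) (hp : 1 ≤ p)
    (hA : LocallyLipschitz A) (hB : LocallyLipschitz B) {K : Set X} (hK : IsCompact K)
    {J : ℕ → ℝ → X} {J' : ℝ → X} {f : ℕ → ℝ → E} {f' : ℝ → E}
    (hJ : ∀ n, AEStronglyMeasurable (J n) (volume.restrict (Ioo a b)))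
    (hJK : ∀ n, ∀ x ∈ Ioo a b, J n x ∈ K)
    (hJlim : ∀ᵐ x ∂volume.restrict (Ioo a b), Tendsto (J · x) atTop (𝓝 (J' x)))
    (hf : ∀ n, AEStronglyMeasurable (f n) (volume.restrict (Ioo a b)))
    (hflim : ∀ᵐ x ∂volume.restrict (Ioo a b), Tendsto (f · x) atTop (𝓝 (f' x)))
    (hfin : gagliardo a b σ p f' ≠ ⊤)
    (hlim : Tendsto (fun n => gagliardo a b σ p (f n - f')) atTop (𝓝 0))
    {C : ℝ≥0} {V : ℝ → ℝ≥0} (hV : Measurable V) (hV1 : ∀ y, 1 ≤ V y)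
    (hVfin : ∫⁻ y in Ioo a b, (V y : ℝ≥0∞) ^ (p * (1 + σ)) ≠ ⊤)
    (hbound : ∀ n, ∀ᵐ y ∂volume.restrict (Ioo a b), ‖f n y‖₊ ≤ C * V y ∧
      ∀ x ∈ Ioo a b, nndist (J n x) (J n y) ≤ C * min 1 (V y * ‖x - y‖₊)) :
    Tendsto (fun n => gagliardo a b σ p
      (affineSuperposition A B (J n) (f n) - affineSuperposition A B J' f')) atTop (𝓝 0) := by
  have hp0 : 0 < p := by linarith
  have hf' := aestronglyMeasurable_of_tendsto_ae atTop hf hflim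
  have hJ' := aestronglyMeasurable_of_tendsto_ae atTop hJ hJlim
  have hT := fun n => aestronglyMeasurable_affineSuperposition hA.continuous hB.continuous
    (hJ n) (hf n)
  have hT' := aestronglyMeasurable_affineSuperposition hA.continuous hB.continuous hJ' hf'
  have hfst := quasiMeasurePreserving_fst_gagliardoMeasure (a := a) (b := b) (σ := σ) (p := p)
  have hsnd := quasiMeasurePreserving_snd_gagliardoMeasure (a := a) (b := b) (σ := σ) (p := p)
  have hdiff : ∀ {g : ℝ → E}, AEStronglyMeasurable g (volume.restrict (Ioo a b)) →
      AEStronglyMeasurable (fun z : ℝ × ℝ => g z.1 - g z.2) (gagliardoMeasure a b σ p) := fun hg =>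
    (hg.comp_quasiMeasurePreserving hfst).sub (hg.comp_quasiMeasurePreserving hsnd)
  have hcoeff : ∀ {I : ℝ → X}, AEStronglyMeasurable I (volume.restrict (Ioo a b)) →
      AEStronglyMeasurable (fun z : ℝ × ℝ => A (I z.1)) (gagliardoMeasure a b σ p) := fun hI =>
    (hA.continuous.comp_aestronglyMeasurable hI).comp_quasiMeasurePreserving hfst
  obtain ⟨M, hM⟩ := exists_nnnorm_le_of_isCompact hA.continuous hK
  rw [gagliardo_eq_eLpNorm hσ.le hp0 hf'] at hfin
  simp only [gagliardo_eq_eLpNorm hσ.le hp0 ((hf _).sub hf')] at hlim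
  have hlinear := tendsto_eLpNorm_clm_apply_sub hp (fun n => hcoeff (hJ n))
    (fun n => (hfst.ae (ae_restrict_mem measurableSet_Ioo)).mono fun z hz => hM _ (hJK n _ hz))
    ((hfst.ae hJlim).mono fun z hz => (hA.continuous.tendsto _).comp hz)
    (fun n => hdiff (hf n)) (hdiff hf') hfin
    (by simpa only [Pi.sub_def, sub_sub_sub_comm] using hlim)
  have hremainder := tendsto_eLpNorm_superpositionRemainder_sub hσ hσ1 hp0 hA hB hK hJ hJK hJlim
    hf hflim hV hV1 hVfin hbound
  refine (tendsto_eLpNorm_add_sub_add hp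
    (fun n => aestronglyMeasurable_clm_apply (hcoeff (hJ n)) (hdiff (hf n)))
    (aestronglyMeasurable_clm_apply (hcoeff hJ') (hdiff hf'))
    (fun n => aestronglyMeasurable_superpositionRemainder hA.continuous hB.continuous (hJ n) (hf n))
    (aestronglyMeasurable_superpositionRemainder hA.continuous hB.continuous hJ' hf')
    hlinear hremainder).congr fun n => ?_
  rw [gagliardo_eq_eLpNorm hσ.le hp0 ((hT n).sub hT')]
  congr 1 with z
  simp only [Pi.sub_apply, Pi.add_apply, sub_sub_sub_comm _ (affineSuperposition A B J' f' _),
    affineSuperposition_sub]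

end Energy

section PrimitiveJet

variable {E : Type*} [NormedAddCommGroup E] [NormedSpace ℝ E] {a b σ p x y : ℝ} {f g : ℝ → E}
  {c : ℕ → E}

/-- The jet of order `m` of the iterated primitive `iterPrimitive a c f (m + 1)`, which makes sense
even where `f` is merely integrable. -/
noncomputable def primitiveJet (a : ℝ) (c : ℕ → E) (m : ℕ) (f : ℝ → E) (x : ℝ) : Fin (m + 1) → E :=
  fun i => iterPrimitive a c f (i.rev + 1) x

theorem jet_iterPrimitive [CompleteSpace E] (hf : ContDiff ℝ ∞ f) (m : ℕ) :
    jet m (iterPrimitive a c f (m + 1)) = primitiveJet a c m f := by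
  ext x i
  have h := iteratedDeriv_iterPrimitive (a := a) (c := c) hf i (i.rev + 1)
  rw [show (i.rev : ℕ) + 1 + i = m + 1 by simp only [Fin.val_rev]; omega] at h
  exact congrFun h x

theorem primitiveJet_zero (m : ℕ) (x : ℝ) :
    primitiveJet a c m f x 0 = iterPrimitive a c f (m + 1) x := by
  simp [primitiveJet]

theorem continuousOn_primitiveJet (hf : IntegrableOn f (Ioo a b)) (m : ℕ) :
    ContinuousOn (primitiveJet a c m f) (Icc a b) :=
  continuousOn_pi.2 fun i => continuousOn_iterPrimitive_succ hf i.rev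

theorem enorm_primitiveJet_sub_le (hf : IntegrableOn f (Ioo a b)) (hg : IntegrableOn g (Ioo a b))
    (m : ℕ) (hx : x ∈ Icc a b) :
    ‖primitiveJet a c m f x - primitiveJet a c m g x‖ₑ ≤
      (1 + volume (Ioo a b)) ^ m * ∫⁻ t in Ioo a b, ‖f t - g t‖ₑ := by
  rw [← edist_eq_enorm_sub, edist_pi_le_iff]
  intro i
  rw [edist_eq_enorm_sub]
  refine (enorm_iterPrimitive_sub_le hf hg i.rev hx).trans ?_
  gcongr ?_ * _
  calc volume (Ioo a b) ^ (i.rev : ℕ) ≤ (1 + volume (Ioo a b)) ^ (i.rev : ℕ) := by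
        gcongr
        exact le_add_self
    _ ≤ (1 + volume (Ioo a b)) ^ m :=
        pow_le_pow_right₀ le_self_add (Nat.lt_succ_iff.1 i.rev.2)

theorem iterPrimitive_succ_sub (hf : IntegrableOn f (Ioo a b)) (r : ℕ) (hx : x ∈ Icc a b)
    (hy : y ∈ Icc a b) :
    iterPrimitive a c f (r + 1) x - iterPrimitive a c f (r + 1) y =
      ∫ t in y..x, iterPrimitive a c f r t := by
  have hint := integrableOn_iterPrimitive (c := c) hf r
  rw [iterPrimitive, add_sub_add_left_eq_sub, intervalIntegral.integral_interval_sub_left]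
  · exact intervalIntegrable_of_integrableOn_Ioo hint hx
  · exact intervalIntegrable_of_integrableOn_Ioo hint hy

theorem norm_intervalIntegral_le_mul_min {R V : ℝ} (hf : ∀ t ∈ Ioo a b, ‖f t‖ ≤ R)
    (hint : ‖∫ t in y..x, f t‖ ≤ 2 * R) (hx : x ∈ Ioo a b) (hy : y ∈ Ioo a b) (hV : 1 ≤ V) :
    ‖∫ t in y..x, f t‖ ≤ 2 * R * min 1 (V * |x - y|) := by
  have hR : 0 ≤ R := (norm_nonneg _).trans (hf x hx)
  have hlip : ‖∫ t in y..x, f t‖ ≤ R * |x - y| :=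
    intervalIntegral.norm_integral_le_of_norm_le_const fun t ht =>
      hf t (ordConnected_Ioo.uIcc_subset hy hx (uIoc_subset_uIcc ht))
  rw [mul_min_of_nonneg _ _ (by positivity), mul_one]
  refine le_min hint (hlip.trans ?_)
  calc R * |x - y| = 1 * R * (1 * |x - y|) := by ring
    _ ≤ 2 * R * (V * |x - y|) := by gcongr; norm_num

theorem exists_norm_le_and_norm_primitiveJet_sub_le [CompleteSpace E] (hab : a < b) (hσ : 0 ≤ σ)
    (hp : 1 ≤ p) (m : ℕ) (R : ℝ≥0) :
    ∃ C : ℝ≥0, ∀ (f : ℝ → E) (y : ℝ) (V : ℝ≥0), StronglyMeasurable f → IntegrableOn f (Ioo a b) →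
      (∀ x ∈ Ioo a b, ‖primitiveJet a c m f x‖ ≤ R) → y ∈ Ioo a b → 1 ≤ V →
      gagliardoSlice a b σ p f y ≤ (V : ℝ≥0∞) ^ (p * (1 + σ)) →
      ‖f y‖ ≤ C * V ∧ ∀ x ∈ Ioo a b,
        ‖primitiveJet a c m f x - primitiveJet a c m f y‖ ≤ C * min 1 (V * |x - y|) := by
  obtain ⟨C, hC⟩ := exists_norm_le_and_norm_intervalIntegral_le (E := E) hab hσ hp
    (M := 2 * R) (by positivity)
  refine ⟨C + 2 * R, fun f y V hf hfi hR hy hV1 hV => ?_⟩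
  have hcomp : ∀ x ∈ Ioo a b, ∀ i : Fin (m + 1), ‖iterPrimitive a c f (i.rev + 1) x‖ ≤ R :=
    fun x hx i => (norm_le_pi_norm _ i).trans (hR x hx)
  have hsub : ∀ x ∈ Ioo a b, ∀ r, iterPrimitive a c f (r + 1) x - iterPrimitive a c f (r + 1) y =
      ∫ t in y..x, iterPrimitive a c f r t := fun x hx r =>
    iterPrimitive_succ_sub hfi r (Ioo_subset_Icc_self hx) (Ioo_subset_Icc_self hy)
  have hdiff : ∀ x ∈ Ioo a b, ∀ i : Fin (m + 1),
      ‖∫ t in y..x, iterPrimitive a c f i.rev t‖ ≤ 2 * R := fun x hx i => by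
    rw [← hsub x hx, two_mul]
    exact (norm_sub_le _ _).trans (add_le_add (hcomp x hx i) (hcomp y hy i))
  obtain ⟨hfy, hfx⟩ := hC f y V hf hfi
    (fun x hx => by simpa [iterPrimitive] using hdiff x hx (Fin.last m)) hy hV1 hV
  push_cast
  refine ⟨hfy.trans (by gcongr; simp), fun x hx => (pi_norm_le_iff_of_nonneg (by positivity)).2
    fun i => ?_⟩
  rw [Pi.sub_apply, primitiveJet, primitiveJet, hsub x hx]
  rcases hr : (i.rev : ℕ) with _ | r
  · exact (hfx x hx).trans (by gcongr; simp)
  · have hrm : r < m + 1 := by have := i.rev.2; omega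
    have hbd : ∀ t ∈ Ioo a b, ‖iterPrimitive a c f (r + 1) t‖ ≤ R := fun t ht => by
      simpa [Fin.rev_rev] using hcomp t ht (Fin.rev ⟨r, hrm⟩)
    calc ‖∫ t in y..x, iterPrimitive a c f (r + 1) t‖
        ≤ 2 * R * min 1 (V * |x - y|) :=
          norm_intervalIntegral_le_mul_min hbd (hr ▸ hdiff x hx i) hx hy (mod_cast hV1)
      _ ≤ (C + 2 * R) * min 1 (V * |x - y|) := by gcongr; simp

end PrimitiveJet

section FractionalSeminorm

variable {E : Type*} [NormedAddCommGroup E] {a b s p : ℝ} {f g : ℝ → E}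

/-- The Gagliardo seminorm whose exponent is the fractional part of `s`, which is the last term of
the Sobolev norm of order `s`. That term is omitted for integral `s`, hence the value `0` there. -/
noncomputable def fractionalSeminorm (a b s p : ℝ) (g : ℝ → E) : ℝ≥0∞ :=
  if s = (⌊s⌋₊ : ℝ) then 0 else gagliardo a b (s - ⌊s⌋₊) p g

theorem sub_floor_mem_Ioo (hs : 0 ≤ s) (h : s ≠ (⌊s⌋₊ : ℝ)) : s - ⌊s⌋₊ ∈ Ioo (0 : ℝ) 1 :=
  ⟨sub_pos.2 ((Nat.floor_le hs).lt_of_ne' h), by linarith [Nat.lt_floor_add_one s]⟩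

theorem gagliardo_sub_comm (a b σ p : ℝ) (f g : ℝ → E) :
    gagliardo a b σ p (f - g) = gagliardo a b σ p (g - f) := by
  have h : ∀ x y, ‖(f - g) x - (f - g) y‖ₑ = ‖(g - f) x - (g - f) y‖ₑ := fun x y => by
    rw [← enorm_neg]
    congr 1
    simp only [Pi.sub_apply]
    abel
  simp only [gagliardo, h]

theorem exists_contDiff_approx [NormedSpace ℝ E] (hab : a < b) (hs : 0 ≤ s) (hp : 1 ≤ p)
    (hf : StronglyMeasurable f) (hfp : MemLp f (ENNReal.ofReal p) (volume.restrict (Ioo a b)))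
    (hfin : fractionalSeminorm a b s p f ≠ ⊤) {ε : ℝ≥0∞} (hε : 0 < ε) :
    ∃ g, ContDiff ℝ ∞ g ∧ eLpNorm (g - f) (ENNReal.ofReal p) (volume.restrict (Ioo a b)) < ε ∧
      fractionalSeminorm a b s p (g - f) < ε := by
  by_cases h : s = (⌊s⌋₊ : ℝ)
  · obtain ⟨δ, hδ, hδε⟩ := ENNReal.lt_iff_exists_nnreal_btwn.1 hε
    obtain ⟨g, -, hg, hle⟩ := hfp.exist_eLpNorm_sub_le ENNReal.ofReal_ne_top (by simpa using hp)
      (ε := δ) (mod_cast hδ)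
    refine ⟨g, hg, ?_, by rwa [fractionalSeminorm, if_pos h]⟩
    rw [eLpNorm_sub_comm]
    exact hle.trans_lt (by simpa using hδε)
  · obtain ⟨hσ, hσ1⟩ := sub_floor_mem_Ioo hs h
    simp only [fractionalSeminorm, if_neg h] at hfin ⊢
    obtain ⟨g, hg, -, hLp, hgag⟩ := isQuasiconvex_univ.exists_gagliardo_sub_lt hab hσ hσ1 hp hf
      (Eventually.of_forall fun x => mem_univ (f x)) hfin hε
    exact ⟨g, hg, eLpNorm_sub_comm f g _ _ ▸ hLp, gagliardo_sub_comm _ _ _ _ f g ▸ hgag⟩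

end FractionalSeminorm

section RapidApprox

theorem lintegral_enorm_le_mul_eLpNorm {α E : Type*} [MeasurableSpace α] {μ : Measure α}
    [NormedAddCommGroup E] {p : ℝ} (hp : 1 ≤ p) {g : α → E} (hg : AEStronglyMeasurable g μ) :
    ∫⁻ x, ‖g x‖ₑ ∂μ ≤ μ univ ^ (1 - 1 / p) * eLpNorm g (ENNReal.ofReal p) μ := by
  have hle := eLpNorm_le_eLpNorm_mul_rpow_measure_univ (p := 1) (q := ENNReal.ofReal p)
    (by simpa using hp) hg
  rwa [eLpNorm_one_eq_lintegral_enorm, mul_comm, ENNReal.toReal_one, div_one,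
    ENNReal.toReal_ofReal (by linarith)] at hle

theorem ae_tendsto_of_tsum_lintegral_ne_top {α E : Type*} [MeasurableSpace α] {μ : Measure α}
    [NormedAddCommGroup E] {F : ℕ → α → E} {f : α → E} (hF : ∀ n, AEStronglyMeasurable (F n) μ)
    (hf : AEStronglyMeasurable f μ) (h : ∑' n, ∫⁻ x, ‖F n x - f x‖ₑ ∂μ ≠ ⊤) :
    ∀ᵐ x ∂μ, Tendsto (F · x) atTop (𝓝 (f x)) := by
  have hm : ∀ n, AEMeasurable (fun x => ‖F n x - f x‖ₑ) μ := fun n => ((hF n).sub hf).enorm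
  rw [← lintegral_tsum hm] at h
  filter_upwards [ae_lt_top' (AEMeasurable.tsum hm) h] with x hx
  simpa only [tendsto_iff_edist_tendsto_0, edist_eq_enorm_sub] using
    ENNReal.tendsto_atTop_zero_of_tsum_ne_top hx.ne

theorem tendsto_two_inv_pow : Tendsto (fun n : ℕ => (2⁻¹ : ℝ≥0∞) ^ n) atTop (𝓝 0) :=
  ENNReal.tendsto_pow_atTop_nhds_zero_of_lt_one (by norm_num)

theorem tsum_two_inv_pow_ne_top : ∑' n : ℕ, (2⁻¹ : ℝ≥0∞) ^ n ≠ ⊤ := by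
  simp [ENNReal.tsum_geometric]

/-- Smooth functions `F n` that converge to `f` in `W^{s - ⌊s⌋, p}(a, b)` at the rate `2⁻ⁿ`. The
summability of the errors turns convergence of norms into convergence and domination almost
everywhere. -/
structure IsRapidApprox {E : Type*} [NormedAddCommGroup E] [NormedSpace ℝ E] (a b s p : ℝ)
    (F : ℕ → ℝ → E) (f : ℝ → E) : Prop where
  contDiff : ∀ n, ContDiff ℝ ∞ (F n)
  stronglyMeasurable : StronglyMeasurable f
  memLp : MemLp f (ENNReal.ofReal p) (volume.restrict (Ioo a b))
  fractionalSeminorm_ne_top : fractionalSeminorm a b s p f ≠ ⊤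
  eLpNorm_sub_lt : ∀ n,
    eLpNorm (F n - f) (ENNReal.ofReal p) (volume.restrict (Ioo a b)) < 2⁻¹ ^ n
  fractionalSeminorm_sub_lt : ∀ n, fractionalSeminorm a b s p (F n - f) < 2⁻¹ ^ n

variable {E G : Type*} [NormedAddCommGroup E] [NormedSpace ℝ E] [NormedAddCommGroup G]
  [NormedSpace ℝ G] {a b s p : ℝ} {f : ℝ → E} {F : ℕ → ℝ → E} {c : ℕ → E} {m : ℕ}

theorem exists_isRapidApprox (hab : a < b) (hs : 0 ≤ s) (hp : 1 ≤ p)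
    (hf : StronglyMeasurable f) (hfp : MemLp f (ENNReal.ofReal p) (volume.restrict (Ioo a b)))
    (hfin : fractionalSeminorm a b s p f ≠ ⊤) : ∃ F, IsRapidApprox a b s p F f := by
  choose F hF hLp hgag using fun n : ℕ =>
    exists_contDiff_approx hab hs hp hf hfp hfin (ENNReal.pow_pos (a := 2⁻¹) (by simp) n)
  exact ⟨F, hF, hf, hfp, hfin, hLp, hgag⟩

namespace IsRapidApprox

theorem integrableOn (h : IsRapidApprox a b s p F f) (hp : 1 ≤ p) : IntegrableOn f (Ioo a b) :=
  h.memLp.integrable (by simpa using hp)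

theorem integrableOn_approx (h : IsRapidApprox a b s p F f) (n : ℕ) :
    IntegrableOn (F n) (Ioo a b) :=
  ((h.contDiff n).continuous.integrableOn_Icc).mono_set Ioo_subset_Icc_self

theorem aestronglyMeasurable_approx (h : IsRapidApprox a b s p F f) (n : ℕ) (μ : Measure ℝ) :
    AEStronglyMeasurable (F n) μ :=
  (h.contDiff n).continuous.aestronglyMeasurable

theorem tendsto_eLpNorm_sub (h : IsRapidApprox a b s p F f) :
    Tendsto (fun n => eLpNorm (F n - f) (ENNReal.ofReal p) (volume.restrict (Ioo a b)))
      atTop (𝓝 0) :=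
  tendsto_of_tendsto_of_tendsto_of_le_of_le tendsto_const_nhds tendsto_two_inv_pow
    (fun _ => zero_le) fun n => (h.eLpNorm_sub_lt n).le

theorem exists_lintegral_enorm_sub_le (h : IsRapidApprox a b s p F f) (hp : 1 ≤ p) :
    ∃ C : ℝ≥0∞, C ≠ ⊤ ∧ ∀ n, ∫⁻ x in Ioo a b, ‖F n x - f x‖ₑ ≤ C * 2⁻¹ ^ n := by
  refine ⟨volume.restrict (Ioo a b) univ ^ (1 - 1 / p),
    ENNReal.rpow_ne_top_of_nonneg (sub_nonneg.2 ((div_le_one (by linarith)).2 hp))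
      (measure_ne_top _ _), fun n => ?_⟩
  exact (lintegral_enorm_le_mul_eLpNorm hp ((h.aestronglyMeasurable_approx n _).sub
    h.stronglyMeasurable.aestronglyMeasurable)).trans (by gcongr; exact (h.eLpNorm_sub_lt n).le)

theorem ae_tendsto (h : IsRapidApprox a b s p F f) (hp : 1 ≤ p) :
    ∀ᵐ x ∂volume.restrict (Ioo a b), Tendsto (F · x) atTop (𝓝 (f x)) := by
  obtain ⟨C, hC, hle⟩ := h.exists_lintegral_enorm_sub_le hp
  refine ae_tendsto_of_tsum_lintegral_ne_top (fun n => h.aestronglyMeasurable_approx n _)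
    h.stronglyMeasurable.aestronglyMeasurable
    (ne_top_of_le_ne_top ?_ (ENNReal.tsum_le_tsum hle))
  rw [ENNReal.tsum_mul_left]
  exact ENNReal.mul_ne_top hC tsum_two_inv_pow_ne_top

theorem exists_edist_primitiveJet_le (h : IsRapidApprox a b s p F f) (hp : 1 ≤ p) (c : ℕ → E)
    (m : ℕ) : ∃ C : ℝ≥0∞, C ≠ ⊤ ∧ ∀ n, ∀ x ∈ Icc a b,
      edist (primitiveJet a c m (F n) x) (primitiveJet a c m f x) ≤ C * 2⁻¹ ^ n := by
  obtain ⟨C, hC, hle⟩ := h.exists_lintegral_enorm_sub_le hp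
  refine ⟨(1 + volume (Ioo a b)) ^ m * C, ENNReal.mul_ne_top (by simp) hC, fun n x hx => ?_⟩
  rw [edist_eq_enorm_sub, mul_assoc]
  exact (enorm_primitiveJet_sub_le (h.integrableOn_approx n) (h.integrableOn hp) m hx).trans
    (by gcongr; exact hle n)

theorem tendstoUniformlyOn_primitiveJet (h : IsRapidApprox a b s p F f) (hp : 1 ≤ p) (c : ℕ → E)
    (m : ℕ) : TendstoUniformlyOn (fun n => primitiveJet a c m (F n)) (primitiveJet a c m f) atTop
      (Icc a b) := by
  obtain ⟨C, hC, hle⟩ := h.exists_edist_primitiveJet_le hp c m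
  have hlim : Tendsto (fun n : ℕ => C * 2⁻¹ ^ n) atTop (𝓝 0) := by
    simpa using ENNReal.Tendsto.const_mul tendsto_two_inv_pow (Or.inr hC)
  refine EMetric.tendstoUniformlyOn_iff.2 fun ε hε => ?_
  filter_upwards [hlim.eventually_lt_const hε] with n hn x hx
  rw [edist_comm]
  exact (hle n x hx).trans_lt hn

theorem exists_norm_primitiveJet_le (h : IsRapidApprox a b s p F f) (hp : 1 ≤ p) (c : ℕ → E)
    (m : ℕ) : ∃ R : ℝ≥0, ∀ n, ∀ x ∈ Icc a b, ‖primitiveJet a c m (F n) x‖ ≤ R := by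
  obtain ⟨C, hC, hle⟩ := h.exists_edist_primitiveJet_le hp c m
  obtain ⟨R, hR⟩ := isCompact_Icc.exists_bound_of_continuousOn
    (continuousOn_primitiveJet (c := c) (h.integrableOn hp) m)
  lift C to ℝ≥0 using hC
  refine ⟨C + R.toNNReal, fun n x hx => ?_⟩
  have hdist : dist (primitiveJet a c m (F n) x) (primitiveJet a c m f x) ≤ C := by
    rw [dist_edist]
    refine ENNReal.toReal_le_coe_of_le_coe ((hle n x hx).trans ?_)
    exact mul_le_of_le_one_right' (pow_le_one' (by norm_num) n)
  have htri := norm_le_norm_add_norm_sub' (primitiveJet a c m (F n) x) (primitiveJet a c m f x)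
  rw [← dist_eq_norm] at htri
  push_cast
  linarith [hR x hx, Real.le_coe_toNNReal R]

theorem ae_tendsto_primitiveJet (h : IsRapidApprox a b s p F f) (hp : 1 ≤ p) (c : ℕ → E) (m : ℕ) :
    ∀ᵐ x ∂volume.restrict (Ioo a b),
      Tendsto (fun n => primitiveJet a c m (F n) x) atTop (𝓝 (primitiveJet a c m f x)) := by
  filter_upwards [ae_restrict_mem measurableSet_Ioo] with x hx
  exact (h.tendstoUniformlyOn_primitiveJet hp c m).tendsto_at (Ioo_subset_Icc_self hx)

theorem aestronglyMeasurable_primitiveJet (h : IsRapidApprox a b s p F f) (c : ℕ → E) (m n : ℕ) :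
    AEStronglyMeasurable (primitiveJet a c m (F n)) (volume.restrict (Ioo a b)) :=
  ((continuousOn_primitiveJet (h.integrableOn_approx n) m).mono
    Ioo_subset_Icc_self).aestronglyMeasurable measurableSet_Ioo

variable {A : (Fin (m + 1) → E) → E →L[ℝ] G} {B : (Fin (m + 1) → E) → G}

theorem tendsto_eLpNorm_affineSuperposition_sub [FiniteDimensional ℝ E]
    (h : IsRapidApprox a b s p F f) (hp : 1 ≤ p) (c : ℕ → E) (hA : Continuous A)
    (hB : Continuous B) :
    Tendsto (fun n => eLpNorm (affineSuperposition A B (primitiveJet a c m (F n)) (F n) -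
      affineSuperposition A B (primitiveJet a c m f) f) (ENNReal.ofReal p)
        (volume.restrict (Ioo a b))) atTop (𝓝 0) := by
  obtain ⟨R, hR⟩ := h.exists_norm_primitiveJet_le hp c m
  refine IntervalSobolev.tendsto_eLpNorm_affineSuperposition_sub hp hA hB
    (isCompact_closedBall (0 : Fin (m + 1) → E) R) (h.aestronglyMeasurable_primitiveJet c m)
    (fun n => ?_) (h.ae_tendsto_primitiveJet hp c m)
    (fun n => h.aestronglyMeasurable_approx n _) h.memLp.1 h.memLp.2.ne h.tendsto_eLpNorm_sub
  filter_upwards [ae_restrict_mem measurableSet_Ioo] with x hx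
  exact mem_closedBall_zero_iff.2 (hR n x (Ioo_subset_Icc_self hx))

theorem exists_ae_nnnorm_le_and_nndist_primitiveJet_le [CompleteSpace E]
    (h : IsRapidApprox a b s p F f) (hab : a < b) (hs : 0 ≤ s) (hp : 1 ≤ p)
    (hfrac : s ≠ (⌊s⌋₊ : ℝ)) (c : ℕ → E) (m : ℕ) :
    ∃ (C : ℝ≥0) (V : ℝ → ℝ≥0), Measurable V ∧ (∀ y, 1 ≤ V y) ∧
      ∫⁻ y in Ioo a b, (V y : ℝ≥0∞) ^ (p * (1 + (s - ⌊s⌋₊))) ≠ ⊤ ∧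
      ∀ n, ∀ᵐ y ∂volume.restrict (Ioo a b), ‖F n y‖₊ ≤ C * V y ∧ ∀ x ∈ Ioo a b,
        nndist (primitiveJet a c m (F n) x) (primitiveJet a c m (F n) y) ≤
          C * min 1 (V y * ‖x - y‖₊) := by
  obtain ⟨hσ, -⟩ := sub_floor_mem_Ioo hs hfrac
  have hfin := h.fractionalSeminorm_ne_top
  have hlt := h.fractionalSeminorm_sub_lt
  simp only [fractionalSeminorm, if_neg hfrac] at hfin hlt
  have hsum : ∑' n, gagliardo a b (s - ⌊s⌋₊) p (F n - f) ^ p ≠ ⊤ := by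
    refine ne_top_of_le_ne_top tsum_two_inv_pow_ne_top (ENNReal.tsum_le_tsum fun n => ?_)
    exact (ENNReal.rpow_le_self_of_le_one
      ((hlt n).le.trans (pow_le_one' (by norm_num) n)) hp).trans (hlt n).le
  have hF : ∀ n, StronglyMeasurable (F n) := fun n => (h.contDiff n).continuous.stronglyMeasurable
  obtain ⟨V, hV, hV1, hVfin, hslice⟩ := exists_gagliardoSlice_le_rpow hσ.le hp
    h.stronglyMeasurable hF hfin hsum
  obtain ⟨R, hR⟩ := h.exists_norm_primitiveJet_le hp c m
  obtain ⟨C, hC⟩ := exists_norm_le_and_norm_primitiveJet_sub_le (c := c) hab hσ.le hp m R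
  refine ⟨C, V, hV, hV1, hVfin, fun n => ?_⟩
  filter_upwards [hslice, ae_restrict_mem measurableSet_Ioo] with y hy hyI
  obtain ⟨hnorm, hdist⟩ := hC (F n) y (V y) (hF n) (h.integrableOn_approx n)
    (fun x hx => hR n x (Ioo_subset_Icc_self hx)) hyI (hV1 y) (hy n)
  refine ⟨mod_cast hnorm, fun x hx => NNReal.coe_le_coe.1 ?_⟩
  simpa [dist_eq_norm] using hdist x hx

theorem tendsto_fractionalSeminorm_affineSuperposition_sub [FiniteDimensional ℝ E]
    (h : IsRapidApprox a b s p F f) (hab : a < b) (hs : 0 ≤ s) (hp : 1 ≤ p) (c : ℕ → E)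
    (hA : LocallyLipschitz A) (hB : LocallyLipschitz B) :
    Tendsto (fun n => fractionalSeminorm a b s p
      (affineSuperposition A B (primitiveJet a c m (F n)) (F n) -
        affineSuperposition A B (primitiveJet a c m f) f)) atTop (𝓝 0) := by
  by_cases hfrac : s = (⌊s⌋₊ : ℝ)
  · simpa only [fractionalSeminorm, if_pos hfrac] using tendsto_const_nhds
  have : CompleteSpace E := FiniteDimensional.complete ℝ E
  obtain ⟨hσ, hσ1⟩ := sub_floor_mem_Ioo hs hfrac
  obtain ⟨C, V, hV, hV1, hVfin, hbound⟩ :=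
    h.exists_ae_nnnorm_le_and_nndist_primitiveJet_le hab hs hp hfrac c m
  obtain ⟨R, hR⟩ := h.exists_norm_primitiveJet_le hp c m
  have hfin := h.fractionalSeminorm_ne_top
  have hlim : Tendsto (fun n => fractionalSeminorm a b s p (F n - f)) atTop (𝓝 0) :=
    tendsto_of_tendsto_of_tendsto_of_le_of_le tendsto_const_nhds tendsto_two_inv_pow
      (fun _ => zero_le) fun n => (h.fractionalSeminorm_sub_lt n).le
  simp only [fractionalSeminorm, if_neg hfrac] at hfin hlim ⊢
  exact tendsto_gagliardo_affineSuperposition_sub hσ hσ1 hp hA hB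
    (isCompact_closedBall (0 : Fin (m + 1) → E) R) (h.aestronglyMeasurable_primitiveJet c m)
    (fun n x hx => mem_closedBall_zero_iff.2 (hR n x (Ioo_subset_Icc_self hx)))
    (h.ae_tendsto_primitiveJet hp c m) (fun n => h.aestronglyMeasurable_approx n _)
    (h.ae_tendsto hp) hfin hlim hV hV1 hVfin hbound

end IsRapidApprox

end RapidApprox

section SmoothMaps

variable {E : Type*} [NormedAddCommGroup E] {a b s p : ℝ}

theorem gagliardo_ne_top_of_lipschitzOnWith {σ : ℝ} (hσ : 0 < σ) (hσ1 : σ < 1) (hp : 0 < p)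
    {L : ℝ≥0} {g : ℝ → E} (hg : LipschitzOnWith L g (Ioo a b)) : gagliardo a b σ p g ≠ ⊤ := by
  rw [gagliardo_eq_eLpNorm hσ.le hp (hg.continuousOn.aestronglyMeasurable measurableSet_Ioo)]
  refine ne_top_of_le_ne_top (eLpNorm_min_one_mul_ne_top (V := 1) hσ hσ1 hp
    (L * max 1 (b - a).toNNReal) measurable_const (by simp)) (eLpNorm_mono_enorm_ae ?_)
  filter_upwards
    [quasiMeasurePreserving_fst_gagliardoMeasure.ae (ae_restrict_mem measurableSet_Ioo),
    quasiMeasurePreserving_snd_gagliardoMeasure.ae (ae_restrict_mem measurableSet_Ioo)]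
    with ⟨x, y⟩ hx hy
  have hxy : ‖x - y‖₊ ≤ (b - a).toNNReal := NNReal.le_toNNReal_of_coe_le
    (Real.dist_le_of_mem_Icc (Ioo_subset_Icc_self hx) (Ioo_subset_Icc_self hy))
  have hmin : ‖x - y‖₊ ≤ max 1 (b - a).toNNReal * min 1 ‖x - y‖₊ := by
    rcases le_total 1 ‖x - y‖₊ with h | h
    · rw [min_eq_left h, mul_one]
      exact hxy.trans (le_max_right _ _)
    · rw [min_eq_right h]
      exact le_mul_of_one_le_left' (le_max_left _ _)
  have hdist : ‖g x - g y‖₊ ≤ L * max 1 (b - a).toNNReal * min 1 ‖x - y‖₊ := by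
    rw [mul_assoc]
    refine le_trans ?_ (mul_le_mul_right hmin L)
    simpa only [edist_nndist, ← ENNReal.coe_mul, ENNReal.coe_le_coe, nndist_eq_nnnorm]
      using hg hx hy
  simpa only [enorm_eq_nnnorm, Pi.one_apply, ENNReal.coe_one, one_mul, mul_one,
    enorm_eq_self] using mod_cast hdist

theorem memLp_of_continuousOn_Icc {f : ℝ → E} (hf : ContinuousOn f (Icc a b)) (q : ℝ≥0∞) :
    MemLp f q (volume.restrict (Ioo a b)) := by
  obtain ⟨C, hC⟩ := isCompact_Icc.exists_bound_of_continuousOn hf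
  refine .of_bound ((hf.mono Ioo_subset_Icc_self).aestronglyMeasurable measurableSet_Ioo) C ?_
  filter_upwards [ae_restrict_mem measurableSet_Ioo] with x hx
  exact hC x (Ioo_subset_Icc_self hx)

theorem smoothMaps_subset_sobolevMaps [NormedSpace ℝ E] (hab : a < b) (hs : 0 ≤ s) (hp : 0 < p)
    (N : Set E) : smoothMaps a b N ⊆ sobolevMaps a b s p N := by
  rintro v ⟨hv, hvN⟩
  have hU := uniqueDiffOn_Icc hab
  have hcont : ∀ j, ContinuousOn (iteratedDerivWithin j v (Icc a b)) (Icc a b) := fun j =>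
    hv.continuousOn_iteratedDerivWithin (by exact_mod_cast le_top) hU
  refine ⟨⟨fun j => iteratedDerivWithin j v (Icc a b),
    fun j _ => isWeakDeriv_of_contDiffOn hab hv j, ENNReal.add_lt_top.2
      ⟨ENNReal.sum_lt_top.2 fun j _ => (memLp_of_continuousOn_Icc (hcont j) _).2, ?_⟩⟩, ?_⟩
  · split_ifs with h
    · exact ENNReal.zero_lt_top
    · obtain ⟨h0, h1⟩ := sub_floor_mem_Ioo hs h
      obtain ⟨C, hC⟩ := isCompact_Icc.exists_bound_of_continuousOn (hcont (⌊s⌋₊ + 1))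
      have hlip : LipschitzOnWith C.toNNReal (iteratedDerivWithin ⌊s⌋₊ v (Icc a b)) (Icc a b) :=
        (convex_Icc a b).lipschitzOnWith_of_nnnorm_derivWithin_le (𝕜 := ℝ)
          (hv.differentiableOn_iteratedDerivWithin (m := ⌊s⌋₊)
            (by exact_mod_cast ENat.natCast_lt_top _) hU)
          fun x hx => NNReal.le_toNNReal_of_coe_le (by
            rw [← iteratedDerivWithin_succ]
            exact hC x hx)
      exact (gagliardo_ne_top_of_lipschitzOnWith h0 h1 hp
        (hlip.mono Ioo_subset_Icc_self)).lt_top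
  · filter_upwards [ae_restrict_mem measurableSet_Ioo] with x hx
    exact hvN x (Ioo_subset_Icc_self hx)

end SmoothMaps

section Composition

theorem memLp_of_tendsto_eLpNorm_sub {α E : Type*} [NormedAddCommGroup E] [MeasurableSpace α]
    {μ : Measure α} {q : ℝ≥0∞} {un : ℕ → α → E} {u : α → E}
    (hun : ∀ n, MemLp (un n) q μ) (hu : AEStronglyMeasurable u μ)
    (hlim : Tendsto (fun n => eLpNorm (un n - u) q μ) atTop (𝓝 0)) : MemLp u q μ := by
  obtain ⟨n, hn⟩ := (hlim.eventually_lt_const ENNReal.zero_lt_top).exists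
  simpa using (hun n).sub ⟨(hun n).1.sub hu, hn⟩

theorem tendsto_lintegral_enorm_sub {α E : Type*} [NormedAddCommGroup E] [MeasurableSpace α]
    {μ : Measure α} [IsFiniteMeasure μ] {p : ℝ} (hp : 1 ≤ p) {un : ℕ → α → E} {u : α → E}
    (hun : ∀ n, AEStronglyMeasurable (un n) μ) (hu : AEStronglyMeasurable u μ)
    (hlim : Tendsto (fun n => eLpNorm (un n - u) (ENNReal.ofReal p) μ) atTop (𝓝 0)) :
    Tendsto (fun n => ∫⁻ x, ‖un n x - u x‖ₑ ∂μ) atTop (𝓝 0) := by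
  have hC : μ univ ^ (1 - 1 / p) ≠ ⊤ :=
    ENNReal.rpow_ne_top_of_nonneg (sub_nonneg.2 ((div_le_one (by linarith)).2 hp))
      (measure_ne_top _ _)
  have hmul := ENNReal.Tendsto.const_mul hlim (Or.inr hC)
  rw [mul_zero] at hmul
  exact tendsto_of_tendsto_of_tendsto_of_le_of_le tendsto_const_nhds hmul (fun _ => zero_le)
    fun n => lintegral_enorm_le_mul_eLpNorm hp ((hun n).sub hu)

variable {E G : Type*} [NormedAddCommGroup E] [NormedSpace ℝ E] [NormedAddCommGroup G]
  [NormedSpace ℝ G] {a b s p : ℝ}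

theorem IsWeakDeriv.of_tendsto_eLpNorm (hp : 1 ≤ p) {j : ℕ} {un gn : ℕ → ℝ → E} {u g : ℝ → E}
    (h : ∀ n, IsWeakDeriv a b j (un n) (gn n))
    (hun : ∀ n, MemLp (un n) (ENNReal.ofReal p) (volume.restrict (Ioo a b)))
    (hgn : ∀ n, MemLp (gn n) (ENNReal.ofReal p) (volume.restrict (Ioo a b)))
    (hu : AEStronglyMeasurable u (volume.restrict (Ioo a b)))
    (hg : AEStronglyMeasurable g (volume.restrict (Ioo a b)))
    (hulim : Tendsto (fun n => eLpNorm (un n - u) (ENNReal.ofReal p) (volume.restrict (Ioo a b)))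
      atTop (𝓝 0))
    (hglim : Tendsto (fun n => eLpNorm (gn n - g) (ENNReal.ofReal p) (volume.restrict (Ioo a b)))
      atTop (𝓝 0)) :
    IsWeakDeriv a b j u g := by
  have hint : ∀ {f : ℝ → E}, MemLp f (ENNReal.ofReal p) (volume.restrict (Ioo a b)) →
      LocallyIntegrableOn f (Ioo a b) := fun hf => by
    have : IntegrableOn _ (Ioo a b) := hf.integrable (by simpa using hp)
    exact this.locallyIntegrableOn
  exact .of_tendsto h (hint (memLp_of_tendsto_eLpNorm_sub hun hu hulim))
    (hint (memLp_of_tendsto_eLpNorm_sub hgn hg hglim))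
    (tendsto_lintegral_enorm_sub hp (fun n => (hun n).1) hu hulim)
    (tendsto_lintegral_enorm_sub hp (fun n => (hgn n).1) hg hglim)

theorem exists_iteratedDeriv_comp_iterPrimitive_eq [FiniteDimensional ℝ E] {π : E → G}
    (hπ : ContDiff ℝ ∞ π) (a : ℝ) (c : ℕ → E) {j m : ℕ} (hj : j ≤ m + 1) :
    ∃ (A : (Fin (m + 1) → E) → E →L[ℝ] G) (B : (Fin (m + 1) → E) → G),
      ContDiff ℝ ∞ A ∧ ContDiff ℝ ∞ B ∧ ∀ f, ContDiff ℝ ∞ f →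
        iteratedDeriv j (π ∘ iterPrimitive a c f (m + 1)) =
          affineSuperposition A B (primitiveJet a c m f) f := by
  have : CompleteSpace E := FiniteDimensional.complete ℝ E
  obtain ⟨A, B, hA, hB, hAB⟩ := exists_iteratedDeriv_comp_eq_add hπ hj
  refine ⟨A, B, hA, hB, fun f hf => ?_⟩
  have htop : iteratedDeriv (m + 1) (iterPrimitive a c f (m + 1)) = f := by
    simpa [iterPrimitive] using iteratedDeriv_iterPrimitive (c := c) hf (m + 1) 0
  refine (hAB _ (contDiff_iterPrimitive hf _)).trans ?_
  simp only [htop, jet_iterPrimitive hf]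
  rfl

theorem IsRapidApprox.exists_isWeakDeriv_comp [FiniteDimensional ℝ E] {f : ℝ → E}
    {F : ℕ → ℝ → E} (h : IsRapidApprox a b s p F f) (hab : a < b) (hs : 0 ≤ s) (hp : 1 ≤ p)
    {π : E → G} (hπ : ContDiff ℝ ∞ π) (c : ℕ → E) {j m : ℕ} (hj : j ≤ m + 1) :
    ∃ g : ℝ → G, IsWeakDeriv a b j (π ∘ iterPrimitive a c f (m + 1)) g ∧
      Tendsto (fun n => eLpNorm (iteratedDeriv j (π ∘ iterPrimitive a c (F n) (m + 1)) - g)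
        (ENNReal.ofReal p) (volume.restrict (Ioo a b))) atTop (𝓝 0) ∧
      Tendsto (fun n => fractionalSeminorm a b s p
        (iteratedDeriv j (π ∘ iterPrimitive a c (F n) (m + 1)) - g)) atTop (𝓝 0) := by
  obtain ⟨A, B, hA, hB, hAB⟩ := exists_iteratedDeriv_comp_iterPrimitive_eq hπ a c hj
  have hderiv := fun n => hAB (F n) (h.contDiff n)
  have hvn : ∀ n, ContDiff ℝ ∞ (π ∘ iterPrimitive a c (F n) (m + 1)) := fun n =>
    hπ.comp (contDiff_iterPrimitive (h.contDiff n) _)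
  have hlim := h.tendsto_eLpNorm_affineSuperposition_sub hp c hA.continuous hB.continuous
  have hlim0 := h.tendsto_eLpNorm_affineSuperposition_sub hp c (m := m)
    (A := 0) (B := fun J => π (J 0)) continuous_const (hπ.continuous.comp (continuous_apply 0))
  have hsup : ∀ f, affineSuperposition 0 (fun J => π (J 0)) (primitiveJet a c m f) f =
      π ∘ iterPrimitive a c f (m + 1) := fun f => by
    ext x
    simp [affineSuperposition, primitiveJet_zero]
  simp only [hsup] at hlim0
  simp only [hderiv]
  refine ⟨_, .of_tendsto_eLpNorm hp (fun n => isWeakDeriv_of_contDiff (hvn n) j)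
    (fun n => memLp_of_continuousOn_Icc (hvn n).continuous.continuousOn _) (fun n =>
      memLp_of_continuousOn_Icc (contDiff_iteratedDeriv (hvn n) j).continuous.continuousOn _) ?_ ?_
    hlim0 (by simpa only [hderiv] using hlim), hlim,
    h.tendsto_fractionalSeminorm_affineSuperposition_sub hab hs hp c ?_ ?_⟩
  · exact (hπ.continuous.comp_continuousOn ((continuousOn_iterPrimitive_succ
      (h.integrableOn hp) m).mono Ioo_subset_Icc_self)).aestronglyMeasurable measurableSet_Ioo
  · exact aestronglyMeasurable_affineSuperposition hA.continuous hB.continuous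
      (((continuousOn_primitiveJet (h.integrableOn hp) m).mono
        Ioo_subset_Icc_self).aestronglyMeasurable measurableSet_Ioo)
      h.stronglyMeasurable.aestronglyMeasurable
  · exact (hA.of_le (by simp)).locallyLipschitz
  · exact (hB.of_le (by simp)).locallyLipschitz

end Composition

section SmoothDensity

variable {E : Type*} [NormedAddCommGroup E] [NormedSpace ℝ E] {a b s p : ℝ} {N : Set E}
  {u : ℝ → E}

theorem sobolevNormOf_lt_top_iff {E : Type*} [NormedAddCommGroup E] {D : ℕ → ℝ → E} :
    sobolevNormOf a b s p D < ⊤ ↔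
      (∀ j ≤ ⌊s⌋₊, eLpNorm (D j) (ENNReal.ofReal p) (volume.restrict (Ioo a b)) < ⊤) ∧
        fractionalSeminorm a b s p (D ⌊s⌋₊) < ⊤ := by
  simp only [sobolevNormOf, fractionalSeminorm, ENNReal.add_lt_top, ENNReal.sum_lt_top,
    Finset.mem_range, Nat.lt_succ_iff]

theorem MemSobolev.exists_stronglyMeasurable (hu : MemSobolev a b s p u) :
    ∃ D : ℕ → ℝ → E, (∀ j, StronglyMeasurable (D j)) ∧
      (∀ j ≤ ⌊s⌋₊, IsWeakDeriv a b j u (D j)) ∧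
      (∀ j ≤ ⌊s⌋₊, MemLp (D j) (ENNReal.ofReal p) (volume.restrict (Ioo a b))) ∧
      fractionalSeminorm a b s p (D ⌊s⌋₊) ≠ ⊤ := by
  obtain ⟨D₀, hD₀, hfin⟩ := hu
  have hex : ∀ j, ∃ g : ℝ → E, StronglyMeasurable g ∧
      (j ≤ ⌊s⌋₊ → D₀ j =ᵐ[volume.restrict (Ioo a b)] g) := fun j => by
    by_cases hj : j ≤ ⌊s⌋₊
    · have hm : AEStronglyMeasurable (D₀ j) (volume.restrict (Ioo a b)) :=
        (hD₀ j hj).locallyIntegrable_deriv.aestronglyMeasurable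
      exact ⟨hm.mk _, hm.stronglyMeasurable_mk, fun _ => hm.ae_eq_mk⟩
    · exact ⟨0, stronglyMeasurable_zero, fun h => (hj h).elim⟩
  choose D hDm hDae using hex
  rw [sobolevNormOf_congr hDae, sobolevNormOf_lt_top_iff] at hfin
  exact ⟨D, hDm, fun j hj => (hD₀ j hj).congr_ae (ae_eq_refl u) (hDae j hj),
    fun j hj => ⟨(hDm j).aestronglyMeasurable, hfin.1 j hj⟩, hfin.2.ne⟩

theorem tendsto_sobolevNorm_sub [CompleteSpace E] {D : ℕ → ℝ → E}
    (hD : ∀ j ≤ ⌊s⌋₊, IsWeakDeriv a b j u (D j)) {v : ℕ → ℝ → E} (hv : ∀ n, ContDiff ℝ ∞ (v n))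
    (hlim : ∀ j ≤ ⌊s⌋₊, Tendsto (fun n => eLpNorm (iteratedDeriv j (v n) - D j) (ENNReal.ofReal p)
      (volume.restrict (Ioo a b))) atTop (𝓝 0))
    (hfrac : Tendsto (fun n => fractionalSeminorm a b s p (iteratedDeriv ⌊s⌋₊ (v n) - D ⌊s⌋₊))
      atTop (𝓝 0)) :
    Tendsto (fun n => sobolevNorm a b s p (u - v n)) atTop (𝓝 0) := by
  have hnorm : ∀ n, sobolevNorm a b s p (u - v n) =
      ∑ j ∈ Finset.range (⌊s⌋₊ + 1), eLpNorm (iteratedDeriv j (v n) - D j) (ENNReal.ofReal p)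
        (volume.restrict (Ioo a b)) +
      fractionalSeminorm a b s p (iteratedDeriv ⌊s⌋₊ (v n) - D ⌊s⌋₊) := fun n => by
    rw [sobolevNorm_eq (D := fun j => D j - iteratedDeriv j (v n))
      fun j hj => (hD j hj).sub (isWeakDeriv_of_contDiff (hv n) j)]
    simp only [sobolevNormOf, fractionalSeminorm, eLpNorm_sub_comm (D _), gagliardo_sub_comm a b _ p
      (D _)]
  have hsum := tendsto_finsetSum (Finset.range (⌊s⌋₊ + 1)) fun j hj =>
    hlim j (Nat.lt_succ_iff.1 (Finset.mem_range.1 hj))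
  simpa only [hnorm, Finset.sum_const_zero, add_zero] using hsum.add hfrac

theorem mapsTo_Icc_of_ae_restrict_Ioo {X : Type*} [TopologicalSpace X] (hab : a < b) {w : ℝ → X}
    (hw : ContinuousOn w (Icc a b)) {S : Set X} (hS : IsClosed S)
    (h : ∀ᵐ x ∂volume.restrict (Ioo a b), w x ∈ S) : MapsTo w (Icc a b) S := by
  have hopen : IsOpen (Ioo a b ∩ w ⁻¹' Sᶜ) :=
    (hw.mono Ioo_subset_Icc_self).isOpen_inter_preimage isOpen_Ioo hS.isOpen_compl
  have hnull : volume (Ioo a b ∩ w ⁻¹' Sᶜ) = 0 := by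
    rw [ae_restrict_iff' measurableSet_Ioo, ae_iff] at h
    exact measure_mono_null (fun x hx (h' : x ∈ Ioo a b → w x ∈ S) => hx.2 (h' hx.1)) h
  have hempty := hopen.eq_empty_of_measure_zero hnull
  have hIoo : MapsTo w (Ioo a b) S := fun x hx => by
    by_contra hxS
    exact (hempty.subset ⟨hx, hxS⟩ : x ∈ (∅ : Set ℝ))
  rw [← closure_Ioo hab.ne] at hw ⊢
  simpa only [hS.closure_eq] using hIoo.closure_of_continuousOn hw

variable [FiniteDimensional ℝ E]

theorem exists_tendsto_sobolevNorm_of_lt_one (hN : IsQuasiconvex N) (hab : a < b) (hs : 0 < s)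
    (hs1 : s < 1) (hp : 1 ≤ p) (hu : u ∈ sobolevMaps a b s p N) :
    ∃ v : ℕ → ℝ → E, (∀ n, v n ∈ smoothMaps a b N) ∧
      Tendsto (fun n => sobolevNorm a b s p (u - v n)) atTop (𝓝 0) := by
  have : CompleteSpace E := FiniteDimensional.complete ℝ E
  obtain ⟨D, hDm, hD, -, hfin⟩ := hu.1.exists_stronglyMeasurable
  have hfloor : ⌊s⌋₊ = 0 := Nat.floor_eq_zero.2 hs1
  have hfrac : ∀ g : ℝ → E, fractionalSeminorm a b s p g = gagliardo a b s p g := fun g => by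
    simp [fractionalSeminorm, hfloor, hs.ne']
  have hu0 : u =ᵐ[volume.restrict (Ioo a b)] D 0 :=
    (isWeakDeriv_zero (hD 0 (Nat.zero_le _)).1).ae_eq (hD 0 (Nat.zero_le _))
  rw [hfrac, hfloor] at hfin
  choose v hv hvN hLp hgag using fun n : ℕ =>
    hN.exists_gagliardo_sub_lt hab hs hs1 hp (hDm 0)
      (by filter_upwards [hu.2, hu0] with x hx h0 using h0 ▸ hx) hfin
      (ENNReal.pow_pos (a := 2⁻¹) (by simp) n)
  have hlim : ∀ {e : ℕ → ℝ≥0∞}, (∀ n, e n < 2⁻¹ ^ n) → Tendsto e atTop (𝓝 0) := fun he =>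
    tendsto_of_tendsto_of_tendsto_of_le_of_le tendsto_const_nhds tendsto_two_inv_pow
      (fun _ => zero_le) fun n => (he n).le
  refine ⟨v, fun n => ⟨(hv n).contDiffOn, fun x _ => hvN n x⟩,
    tendsto_sobolevNorm_sub hD hv (fun j hj => ?_) ?_⟩
  · obtain rfl : j = 0 := by omega
    simpa only [iteratedDeriv_zero, eLpNorm_sub_comm (v _)] using hlim hLp
  · simpa only [hfrac, hfloor, iteratedDeriv_zero, gagliardo_sub_comm a b s p (v _)] using hlim hgag

theorem IsRapidApprox.eventually_comp_mem_smoothMaps {F : ℕ → ℝ → E} {f : ℝ → E}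
    (h : IsRapidApprox a b s p F f) (hp : 1 ≤ p) {W : Set E} {π : E → E} (hπ : ContDiff ℝ ∞ π)
    (hret : IsRetractionOn N W π) (hN : IsCompact N) (hNW : N ⊆ W) {c : ℕ → E} {m : ℕ}
    (hmaps : MapsTo (iterPrimitive a c f (m + 1)) (Icc a b) N) :
    ∀ᶠ n in atTop, π ∘ iterPrimitive a c (F n) (m + 1) ∈ smoothMaps a b N := by
  obtain ⟨δ, hδ, hδW⟩ := hN.exists_thickening_subset_open hret.isOpen hNW
  have hunif := Metric.tendstoUniformlyOn_iff.1 (h.tendstoUniformlyOn_primitiveJet hp c m) δ hδ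
  filter_upwards [hunif] with n hn
  refine ⟨(hπ.comp (contDiff_iterPrimitive (h.contDiff n) _)).contDiffOn, fun x hx =>
    hret.mapsTo (hδW (Metric.mem_thickening_iff.2 ⟨_, hmaps hx, ?_⟩))⟩
  rw [dist_comm]
  simpa only [primitiveJet_zero] using (dist_le_pi_dist _ _ 0).trans_lt (hn x hx)

theorem exists_tendsto_sobolevNorm_of_one_le (hN : IsSmoothNhdRetract N) (hc : IsCompact N)
    (hab : a < b) (hs : 1 ≤ s) (hp : 1 ≤ p) (hu : u ∈ sobolevMaps a b s p N) :
    ∃ v : ℕ → ℝ → E, (∀ᶠ n in atTop, v n ∈ smoothMaps a b N) ∧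
      Tendsto (fun n => sobolevNorm a b s p (u - v n)) atTop (𝓝 0) := by
  have : CompleteSpace E := FiniteDimensional.complete ℝ E
  obtain ⟨π, W, hπ, hret, hNW⟩ := hN.exists_contDiff hc.isClosed
  obtain ⟨D, hDm, hD, hDp, hfin⟩ := hu.1.exists_stronglyMeasurable
  obtain ⟨m, hm⟩ : ∃ m, ⌊s⌋₊ = m + 1 := Nat.exists_eq_add_one.2 (Nat.floor_pos.2 hs)
  obtain ⟨F, hF⟩ := exists_isRapidApprox hab (by linarith) hp (hDm _) (hDp _ le_rfl) hfin
  obtain ⟨c, huw⟩ := IsWeakDeriv.exists_ae_eq_iterPrimitive hab hD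
    fun j hj => (hDp j hj).integrable (by simpa using hp)
  simp only [hm] at huw hF
  set w := iterPrimitive a c (D (m + 1)) (m + 1)
  have hwN : MapsTo w (Icc a b) N := mapsTo_Icc_of_ae_restrict_Ioo hab
    (continuousOn_iterPrimitive_succ (hF.integrableOn hp) m) hc.isClosed
    (by filter_upwards [hu.2, huw] with x hx h0 using (congrArg (· ∈ N) h0).mp hx)
  have hπw : π ∘ w =ᵐ[volume.restrict (Ioo a b)] u := by
    filter_upwards [hu.2, huw] with x hx h0
    rw [Function.comp_apply, ← h0, hret.eq_self _ hx (hNW hx)]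
  choose! g hg hlim hfrac using fun j (hj : j ≤ m + 1) =>
    hF.exists_isWeakDeriv_comp hab (by linarith) hp hπ c hj
  have hgu : ∀ j ≤ ⌊s⌋₊, IsWeakDeriv a b j u (g j) := fun j hj =>
    (hg j (hm ▸ hj)).congr_ae hπw (ae_eq_refl _)
  refine ⟨fun n => π ∘ iterPrimitive a c (F n) (m + 1),
    hF.eventually_comp_mem_smoothMaps hp hπ hret hc hNW hwN,
    tendsto_sobolevNorm_sub hgu (fun n => hπ.comp (contDiff_iterPrimitive (hF.contDiff n) _))
      (fun j hj => hlim j (hm ▸ hj)) ?_⟩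
  simpa only [hm] using hfrac (m + 1) le_rfl

theorem exists_tendsto_sobolevNorm (hN : IsSmoothNhdRetract N) (hc : IsCompact N)
    (hconn : IsPreconnected N) (hab : a < b) (hs : 0 < s) (hp : 1 ≤ p)
    (hu : u ∈ sobolevMaps a b s p N) :
    ∃ v : ℕ → ℝ → E, (∀ᶠ n in atTop, v n ∈ smoothMaps a b N) ∧
      Tendsto (fun n => sobolevNorm a b s p (u - v n)) atTop (𝓝 0) := by
  rcases lt_or_ge s 1 with hs1 | hs1
  · obtain ⟨v, hv, hlim⟩ :=
      exists_tendsto_sobolevNorm_of_lt_one (hN.isQuasiconvex hc hconn) hab hs hs1 hp hu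
    exact ⟨v, .of_forall hv, hlim⟩
  · exact exists_tendsto_sobolevNorm_of_one_le hN hc hab hs1 hp hu

end SmoothDensity

end IntervalSobolev

theorem corollary3p1_general {E : Type*} [NormedAddCommGroup E] [NormedSpace ℝ E]
    [FiniteDimensional ℝ E] {N : Set E} (hN : IntervalSobolev.IsSmoothNhdRetract N)
    (hNcompact : IsCompact N) (hNconn : IsPreconnected N) {a b : ℝ} (hab : a < b) {s p : ℝ}
    (hs : 0 < s) (hp : 1 ≤ p) :
    IntervalSobolev.smoothMaps a b N ⊆ IntervalSobolev.sobolevMaps a b s p N ∧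
      ∀ u ∈ IntervalSobolev.sobolevMaps a b s p N, ∀ ε : ℝ≥0∞, 0 < ε →
        ∃ v ∈ IntervalSobolev.smoothMaps a b N,
          IntervalSobolev.sobolevNorm a b s p (u - v) < ε := by
  refine ⟨IntervalSobolev.smoothMaps_subset_sobolevMaps hab hs.le (by linarith) N,
    fun u hu ε hε => ?_⟩
  obtain ⟨v, hv, hlim⟩ :=
    IntervalSobolev.exists_tendsto_sobolevNorm hN hNcompact hNconn hab hs hp hu
  obtain ⟨n, hn, hlt⟩ := (hv.and (hlim.eventually_lt_const hε)).exists
  exact ⟨v n, hn, hlt⟩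

theorem corollary3p1 {m d : ℕ} (N : Set (EuclideanSpace ℝ (Fin m)))
    (hN : IntervalSobolev.IsSmoothSubmanifold d N) (hNcompact : IsCompact N)
    (hNconn : IsConnected N) (a b : ℝ) (hab : a < b) (s p : ℝ) (hs : 0 < s) (hp : 1 ≤ p) :
    IntervalSobolev.smoothMaps a b N ⊆ IntervalSobolev.sobolevMaps a b s p N ∧
      ∀ u ∈ IntervalSobolev.sobolevMaps a b s p N, ∀ ε : ENNReal, 0 < ε →
        ∃ v ∈ IntervalSobolev.smoothMaps a b N, IntervalSobolev.sobolevNorm a b s p (u - v) < ε :=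
  corollary3p1_general (hN.isSmoothNhdRetract hNcompact) hNcompact hNconn.isPreconnected hab hs hp
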